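/- Let $n\ge 1$ and $\mathbb R^{n+1}_+=\{(x,t):x\in\mathbb R^n,\ t>0\}$. Weights. $\gamma\in A_1^{\rm loc}(\mathbb R^{n+1})$ with constant $C_\gamma$ means: $\gamma\in L_1^{\rm loc}(\mathbb R^{n+1})$, $\gamma>0$ a.e., and $\frac1{|Q|}\iint_Q\gamma\le C_\gamma\operatorname{ess\,inf}_Q\gamma$ for every open cube $Q\subset\mathbb R^{n+1}$ (sides parallel to the axes) with side length at most $1$. $W^1_1(\mathbb R^{n+1}_+,\gamma)$ is the space of locally integrable $f$ on $\mathbb R^{n+1}_+$ with finite norm $\|f|W^1_1(\mathbb R^{n+1}_+,\gamma)\|=\sum_{|\beta|\le1}\|\gamma D^\beta f|L_1(\mathbb R^{n+1}_+)\|$, where $D^\beta$ are generalized derivatives. $\varphi\in L_1^{\rm loc}(\mathbb R^n)$ is the trace of $f$, written $\varphi=\operatorname{tr}|_{t=0}f$, if $\int_Q|\varphi(x)-f(x,t)|\,dx\to0$ as $t\to0+$ for every open cube $Q\subset\mathbb R^n$. Tilings. For $k\in\mathbb Z_+$, $m\in\mathbb Z^n$ let $Q_{k,m}=\prod_{i=1}^n(m_i2^{-k},(m_i+1)2^{-k})$.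 Fix $\lambda=1+2^{-k_0}$ with $k_0\in\mathbb Z_+$. For $\alpha=(k,m)$ let $r(Q_\alpha)=2^{-k}$, let $\widetilde Q_\alpha=\lambda Q_\alpha$ be the open concentric cube dilated by the factor $\lambda$, and let $\widehat\gamma_\alpha$ be the mean value of $\gamma$ over $Q_\alpha\times(0,r(Q_\alpha))$. A tiling is a family $\{\overline Q_\alpha\}_{\alpha\in A}$, $A\subset\mathbb Z_+\times\mathbb Z^n$, with pairwise disjoint interiors and union $\mathbb R^n$. A system of tilings is a sequence of tilings with index sets $A^s$, $s\in\mathbb Z_+$, such that every cube of the $(s+1)$-st tiling lies in a cube of the $s$-th. It is admissible for $\gamma$ with constants $c_1,c_2\ge1$ if for every $s\in\mathbb Z_+$: 1) $\widehat\gamma_\alpha\le c_1\widehat\gamma_{\alpha'}$ whenever $\alpha,\alpha'\in A^s$ and $\widetilde Q_\alpha\cap\widetilde Q_{\alpha'}\ne\varnothing$; 2) $\widehat\gamma_\alpha\le c_2\widehat\gamma_{\alpha'}$ and $\widehat\gamma_{\alpha'}\le c_2\widehat\gamma_\alpha$ whenever $\alpha\in A^s$, $\alpha'\in A^{s+1}$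 and $Q_{\alpha'}\subset Q_\alpha$; 3) $r(Q_{\alpha'})\le\frac12 r(Q_\alpha)$ whenever $\alpha\in A^s$, $\alpha'\in A^{s+1}$ and $\widetilde Q_\alpha\cap\widetilde Q_{\alpha'}\neq\varnothing$; 4) $r(Q_\alpha)\ge2^{-l_s}$ for all $\alpha\in A^s$, where $\{l_j\}_{j\ge0}$ is a strictly increasing sequence of nonnegative integers, independent of $s$, with $l_0=0$. For each $s$ let $\widetilde A^s\subset A^s$ be a reduced index set: the cubes $\widetilde Q_\alpha$, $\alpha\in\widetilde A^s$, cover $\mathbb R^n$, and none of them is contained in the union of the others. For $\alpha\in\widetilde A^s$ let $\varphi^s_\alpha$ be the mean value of $\varphi$ over $\widetilde Q_\alpha$. Theorem. Let $\gamma\in A_1^{\rm loc}(\mathbb R^{n+1})$, $c_1,c_2\ge1$ and $\varphi\in L_1^{\rm loc}(\mathbb R^n)$. Suppose that there are a system of tilings admissible for $\gamma$ with constants $c_1,c_2$, and reduced index sets $\widetilde A^s$, such that $$S:=\sum_{m\in\mathbb Z^n}\widehat\gamma_{0,m}\|\varphi|L_1(Q_{0,m})\|+\sum_{s=1}^\infty\sum_{\alpha\in\widetilde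 A^s}\widehat\gamma_\alpha\int_{\widetilde Q_\alpha}|\varphi^s_\alpha-\varphi(x)|\,dx<\infty .$$ Then there exists $f\in W^1_1(\mathbb R^{n+1}_+,\gamma)$ with $\varphi=\operatorname{tr}|_{t=0}f$ and $$C\,\|f|W^1_1(\mathbb R^{n+1}_+,\gamma)\|\le S,$$ where the constant $C>0$ depends only on $n,C_\gamma,\lambda,c_1,c_2$. -/

import Mathlib

open MeasureTheory Set Filter Topology
open scoped ENNReal ContDiff

namespace WeightedTrace

/-- `ℝⁿ`, with Lebesgue measure `volume`. -/
abbrev Base (n : ℕ) : Type := Fin n → ℝ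

/-- `ℝⁿ⁺¹`, whose points are written as pairs `(x, t)`; `volume` is Lebesgue measure. -/
abbrev Space (n : ℕ) : Type := Base n × ℝ

/-- The open half-space `ℝⁿ⁺¹₊ = {(x, t) : t > 0}`. -/
def upperHalf (n : ℕ) : Set (Space n) := {z | 0 < z.2}

/-- The open cube in `ℝⁿ` with lower corner `a` and side length `r`. -/
def openCube {n : ℕ} (a : Base n) (r : ℝ) : Set (Base n) :=
  {x | ∀ i, a i < x i ∧ x i < a i + r}

/-! ### Weights -/

/-- `γ` is a weight on `ℝⁿ⁺¹` in the class `A₁^loc`, with constant `Cγ`: it is locally integrable,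
positive almost everywhere, and for each open cube `Q ⊆ ℝⁿ⁺¹` of side length at most `1` the mean
of `γ` over `Q` is at most `Cγ · ess inf_Q γ`, that is, at most `Cγ · γ z` for almost every
`z ∈ Q`. -/
structure IsA1locWeight {n : ℕ} (γ : Space n → ℝ) (Cγ : ℝ) : Prop where
  locallyIntegrable : LocallyIntegrable γ volume
  pos : ∀ᵐ z ∂(volume : Measure (Space n)), 0 < γ z
  average_le : ∀ (a : Base n) (b r : ℝ), 0 < r → r ≤ 1 →
    ∀ᵐ z ∂(volume.restrict (openCube a r ×ˢ Ioo b (b + r))),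
      (⨍ w in openCube a r ×ˢ Ioo b (b + r), γ w) ≤ Cγ * γ z

/-! ### Weighted Sobolev space of order one -/

/-- `g` is the generalized (Sobolev) derivative of `f` on the open set `Ω` in the direction `v`. -/
structure HasWeakDerivOn {n : ℕ} (Ω : Set (Space n)) (f : Space n → ℝ) (v : Space n)
    (g : Space n → ℝ) : Prop where
  locallyIntegrableOn : LocallyIntegrableOn f Ω volume
  locallyIntegrableOn_deriv : LocallyIntegrableOn g Ω volume
  integral_eq : ∀ η : Space n → ℝ, ContDiff ℝ ∞ η → HasCompactSupport η → tsupport η ⊆ Ω →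
    ∫ z in Ω, f z * fderiv ℝ η z v = -∫ z in Ω, g z * η z

/-- The weighted norm `‖γ D_v f | L₁(Ω)‖`. The generalized derivative is unique up to null sets,
so the infimum is over a single value; it is `⊤` if the generalized derivative does not exist. -/
noncomputable def weakDerivNorm {n : ℕ} (Ω : Set (Space n)) (γ f : Space n → ℝ) (v : Space n) :
    ℝ≥0∞ :=
  ⨅ (g : Space n → ℝ) (_ : HasWeakDerivOn Ω f v g), ∫⁻ z in Ω, ‖γ z * g z‖ₑ

/-- The norm of `W¹₁(Ω, γ)`: the sum of `‖γ D^α f | L₁(Ω)‖` over the multi-indices `|α| ≤ 1`. -/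
noncomputable def sobolevNorm {n : ℕ} (Ω : Set (Space n)) (γ f : Space n → ℝ) : ℝ≥0∞ :=
  (∫⁻ z in Ω, ‖γ z * f z‖ₑ)
    + (∑ i : Fin n, weakDerivNorm Ω γ f (Pi.single i 1, 0))
    + weakDerivNorm Ω γ f (0, 1)

/-- Membership in `W¹₁(Ω, γ)`. -/
def MemSobolev {n : ℕ} (Ω : Set (Space n)) (γ f : Space n → ℝ) : Prop :=
  LocallyIntegrableOn f Ω volume ∧ sobolevNorm Ω γ f < ⊤

/-- `φ` is the trace of `f` (a function on the upper half-space) on the hyperplane `t = 0`: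
`∫_Q |φ(x) - f(x, t)| dx → 0` as `t → 0+`, for every open cube `Q` of `ℝⁿ`. -/
def HasTrace {n : ℕ} (f : Space n → ℝ) (φ : Base n → ℝ) : Prop :=
  ∀ (a : Base n) (r : ℝ),
    (∀ᶠ t in 𝓝[>] (0 : ℝ), IntegrableOn (fun x => φ x - f (x, t)) (openCube a r) volume) ∧
    Tendsto (fun t : ℝ => ∫ x in openCube a r, |φ x - f (x, t)|) (𝓝[>] 0) (𝓝 0)

/-! ### Dyadic cubes and tilings -/

/-- Indices `(k, m)` of dyadic cubes: `k` is the rank. -/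
abbrev Index (n : ℕ) : Type := ℕ × (Fin n → ℤ)

/-- The side length `2⁻ᵏ` of the dyadic cube with index `α = (k, m)`. -/
noncomputable def side {n : ℕ} (α : Index n) : ℝ := ((2 : ℝ) ^ α.1)⁻¹

/-- The open dyadic cube `Q_{k,m} = ∏ᵢ (mᵢ / 2ᵏ, (mᵢ + 1) / 2ᵏ)`. -/
def dyadicCube {n : ℕ} (α : Index n) : Set (Base n) :=
  {x | ∀ i, (α.2 i : ℝ) * side α < x i ∧ x i < ((α.2 i : ℝ) + 1) * side α}

/-- The closed dyadic cube. -/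
def closedDyadicCube {n : ℕ} (α : Index n) : Set (Base n) :=
  {x | ∀ i, (α.2 i : ℝ) * side α ≤ x i ∧ x i ≤ ((α.2 i : ℝ) + 1) * side α}

/-- The open cube `κ Q_α`, concentric with `Q_α`, with side length `κ` times that of `Q_α`. -/
def dilatedCube {n : ℕ} (κ : ℝ) (α : Index n) : Set (Base n) :=
  {x | ∀ i, |x i - ((α.2 i : ℝ) + 1 / 2) * side α| < κ * side α / 2}

/-- `γ̂_α`: the mean value of `γ` over `Π_α = Q_α × (0, r(Q_α))`. -/
noncomputable def weightAvg {n : ℕ} (γ : Space n → ℝ) (α : Index n) : ℝ :=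
  ⨍ z in dyadicCube α ×ˢ Ioo 0 (side α), γ z

/-- The closed dyadic cubes with indices in `A` form a tiling of `ℝⁿ`. -/
structure IsTiling {n : ℕ} (A : Set (Index n)) : Prop where
  disjoint : ∀ α ∈ A, ∀ β ∈ A, α ≠ β → Disjoint (dyadicCube α) (dyadicCube β)
  cover : (⋃ α ∈ A, closedDyadicCube α) = univ

/-- `T^0, T^1, …` is a system of tilings: each tiling succeeds the previous one. -/
structure IsTilingSystem {n : ℕ} (A : ℕ → Set (Index n)) : Prop where
  tiling : ∀ s, IsTiling (A s)
  succeeds : ∀ s, ∀ α' ∈ A (s + 1), ∃ α ∈ A s, closedDyadicCube α' ⊆ closedDyadicCube α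

/-- The system of tilings is admissible for the weight `γ`, with constants `c₁, c₂` and
dilation factor `κ`. -/
structure IsAdmissible {n : ℕ} (κ : ℝ) (γ : Space n → ℝ) (c₁ c₂ : ℝ)
    (A : ℕ → Set (Index n)) : Prop where
  system : IsTilingSystem A
  neighbours : ∀ s, ∀ α ∈ A s, ∀ α' ∈ A s, (dilatedCube κ α ∩ dilatedCube κ α').Nonempty →
    weightAvg γ α ≤ c₁ * weightAvg γ α'
  nested : ∀ s, ∀ α ∈ A s, ∀ α' ∈ A (s + 1), dyadicCube α' ⊆ dyadicCube α →
    weightAvg γ α ≤ c₂ * weightAvg γ α' ∧ weightAvg γ α' ≤ c₂ * weightAvg γ α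
  shrink : ∀ s, ∀ x : Base n, ∀ α ∈ A s, ∀ α' ∈ A (s + 1),
    x ∈ dilatedCube κ α → x ∈ dilatedCube κ α' → side α' ≤ side α / 2
  side_ge : ∃ l : ℕ → ℕ, StrictMono l ∧ l 0 = 0 ∧
    ∀ s, ∀ α ∈ A s, ((2 : ℝ) ^ l s)⁻¹ ≤ side α

/-- `A'` is a possible reduced index set `Ã` of the tiling `A`: the dilated cubes with indices in
`A'` still cover `ℝⁿ`, and none of them is contained in the union of the others. For a tiling
whose side lengths are bounded below, these are exactly the possible results of enumerating the
dilated cubes and successively deleting each one that is covered by the remaining ones. -/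
structure IsReduction {n : ℕ} (κ : ℝ) (A A' : Set (Index n)) : Prop where
  subset : A' ⊆ A
  cover : (⋃ α ∈ A', dilatedCube κ α) = univ
  irredundant : ∀ α ∈ A', ¬ dilatedCube κ α ⊆ ⋃ β ∈ A' \ {α}, dilatedCube κ β

/-! ### The oscillation sum -/

/-- `φ_α`: the mean value of `φ` over the dilated cube. -/
noncomputable def dilatedAvg {n : ℕ} (κ : ℝ) (φ : Base n → ℝ) (α : Index n) : ℝ :=
  ⨍ x in dilatedCube κ α, φ x

/-- `∑_m γ̂_{0,m} ‖φ | L₁(Q_{0,m})‖ + ∑_{s ≥ 1} ∑_{α ∈ Ã^s} γ̂_α ∫_{Q̃_α} |φ_α - φ(x)| dx`. -/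
noncomputable def oscillationSum {n : ℕ} (κ : ℝ) (γ : Space n → ℝ) (φ : Base n → ℝ)
    (A' : ℕ → Set (Index n)) : ℝ≥0∞ :=
  (∑' m : Fin n → ℤ,
      ENNReal.ofReal (weightAvg γ (0, m)) * ∫⁻ x in dyadicCube ((0, m) : Index n), ‖φ x‖ₑ)
    + ∑' s : ℕ, ∑' α : A' (s + 1),
        ENNReal.ofReal (weightAvg γ α.1) *
          ∫⁻ x in dilatedCube κ α.1, ‖dilatedAvg κ φ α.1 - φ x‖ₑ

end WeightedTrace

open WeightedTrace

/-! The extension interpolates means of `φ` over cubes adapted to the weight. To a lattice point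
`2⁻ʲ m` with `j ≥ k₀ + 2` is attached one dilated cube containing it, of rank at most `j - k₀ - 2`
and of the latest possible level (`sel`). The value `F j m` is the mean of `φ` over that cube, and
`F` is zero at coarser scales. With smooth partitions of unity at scale `2⁻ʲ`, let `G j` be the
interpolant of `F j`; then `f` is the sum of the differences `G (j+1) - G j`, each cut off at height
`2⁻⁽ʲ⁺¹⁾`.

Norm. A building block costs `|F (j+1) m - F j m'|` times `2ʲ⁺¹` times the mass of `γ` near the
lattice point. Cubes of the level after the selected one are no larger than a multiple of the
lattice step, so the A₁ condition and admissibility bound this mass by `2⁻⁽ʲ⁺¹⁾⁽ⁿ⁺¹⁾` times the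
average of `γ` for the selected cube (`lintegral_bumpRegion_le`). The difference vanishes unless the
selection changes. A given pair of cubes is exchanged either at the single scale where the new cube
becomes eligible, or at lattice points on the boundary of the new cube, a set of dimension `n - 1`.
Either way the number of exchanges, weighted by `2⁻ʲⁿ`, is at most a constant times `2⁻ᵏⁿ` with `k`
the larger rank (`tsum_switch_le`). Up to a constant, this is at most the measure of the
intersection of the two dilated cubes, so the difference of the means is paid for by the oscillation
there (`enorm_avg_sub_avg_le`). Reduced families overlap boundedly (`encard_le_overlapBound`), so
summing over pairs costs only a constant (`tsum_related_le`).

Trace. Near `t = 0`, `f (x, t)` is a convex combination of values `F j m` of high scale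
(`enorm_sub_latticeExtension_le`), that is, of means over cubes of high level containing `x`. Hence
`|φ - f|` is dominated by a tail of the oscillation series, while the averages of `γ` for cubes
meeting a bounded set stay away from zero. -/

namespace WeightedTrace

variable {n : ℕ}

/-! ### Geometry of dyadic cubes and their dilations -/

/-- The dilated cube with dilation factor `1 + 2^{-k₀}`. -/
abbrev dil (k₀ : ℕ) (α : Index n) : Set (Base n) := dilatedCube (1 + ((2 : ℝ) ^ k₀)⁻¹) α

/-- Lower endpoint of the `i`-th edge of the dilated cube. -/
noncomputable def lo (k₀ : ℕ) (α : Index n) (i : Fin n) : ℝ :=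
  ((α.2 i * 2 ^ (k₀ + 1) - 1 : ℤ) : ℝ) / 2 ^ (α.1 + k₀ + 1)

/-- Upper endpoint of the `i`-th edge of the dilated cube. -/
noncomputable def hi (k₀ : ℕ) (α : Index n) (i : Fin n) : ℝ :=
  (((α.2 i + 1) * 2 ^ (k₀ + 1) + 1 : ℤ) : ℝ) / 2 ^ (α.1 + k₀ + 1)

/-- The lattice point `2⁻ʲ m`. -/
noncomputable def pt (j : ℕ) (m : Fin n → ℤ) : Base n := fun i => (m i : ℝ) / 2 ^ j

lemma side_pos (α : Index n) : 0 < side α := by unfold side; positivity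

lemma side_le_one (α : Index n) : side α ≤ 1 := by
  unfold side
  exact inv_le_one_of_one_le₀ (one_le_pow₀ (by norm_num))

lemma side_le_side_iff {α β : Index n} : side α ≤ side β ↔ β.1 ≤ α.1 := by
  unfold side
  rw [inv_le_inv₀ (by positivity) (by positivity)]
  exact pow_le_pow_iff_right₀ (by norm_num)

lemma side_le_half_iff {α β : Index n} : side α ≤ side β / 2 ↔ β.1 + 1 ≤ α.1 := by
  have : side β / 2 = side ((β.1 + 1, β.2) : Index n) := by
    unfold side; rw [pow_succ]; field_simp
  rw [this, side_le_side_iff]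

lemma lo_eq (k₀ : ℕ) (α : Index n) (i : Fin n) :
    lo k₀ α i = (α.2 i : ℝ) * side α - side α / 2 ^ (k₀ + 1) := by
  unfold lo side
  push_cast
  rw [show α.1 + k₀ + 1 = α.1 + (k₀ + 1) by ring, pow_add 2 α.1]
  field_simp

lemma hi_eq (k₀ : ℕ) (α : Index n) (i : Fin n) :
    hi k₀ α i = ((α.2 i : ℝ) + 1) * side α + side α / 2 ^ (k₀ + 1) := by
  unfold hi side
  push_cast
  rw [show α.1 + k₀ + 1 = α.1 + (k₀ + 1) by ring, pow_add 2 α.1]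
  field_simp

lemma mem_dil {k₀ : ℕ} {α : Index n} {x : Base n} :
    x ∈ dil k₀ α ↔ ∀ i, lo k₀ α i < x i ∧ x i < hi k₀ α i := by
  unfold dil dilatedCube
  simp only [mem_ofPred_eq]
  refine forall_congr' fun i => ?_
  rw [lo_eq, hi_eq, abs_lt, pow_succ]
  have e : side α / (2 ^ k₀ * 2) = (2 ^ k₀)⁻¹ * side α / 2 := by field_simp
  rw [e]
  constructor
  · rintro ⟨h1, h2⟩; constructor <;> linarith
  · rintro ⟨h1, h2⟩; constructor <;> linarith

lemma margin_le (k₀ : ℕ) (α : Index n) : side α / 2 ^ (k₀ + 1) ≤ side α / 2 := by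
  have := side_pos α
  gcongr
  calc (2 : ℝ) = 2 ^ 1 := by norm_num
    _ ≤ 2 ^ (k₀ + 1) := pow_le_pow_right₀ (by norm_num) (by omega)

lemma hi_sub_lo_le (k₀ : ℕ) (α : Index n) (i : Fin n) :
    hi k₀ α i - lo k₀ α i ≤ 2 * side α := by
  rw [lo_eq, hi_eq]
  have := margin_le k₀ α
  linarith

/-- Both numbers are multiples of `2⁻ʳ`. The faces of a dilated cube of rank `k` lie on the grid of
step `2^-(k+k₀+1)` because the dilation factor is `1 + 2^-k₀`; every quantitative separation of
faces comes from this. -/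
lemma grid_gap {a b : ℤ} {p q r : ℕ} (hp : p ≤ r) (hq : q ≤ r)
    (h : (a : ℝ) / 2 ^ p < b / 2 ^ q) : (a : ℝ) / 2 ^ p + 1 / 2 ^ r ≤ b / 2 ^ q := by
  obtain ⟨u, rfl⟩ := Nat.exists_eq_add_of_le hp
  obtain ⟨v, hv⟩ := Nat.exists_eq_add_of_le hq
  have e1 : (a : ℝ) / 2 ^ p = ((a * 2 ^ u : ℤ) : ℝ) / 2 ^ (p + u) := by
    push_cast; rw [pow_add]; field_simp
  have e2 : (b : ℝ) / 2 ^ q = ((b * 2 ^ v : ℤ) : ℝ) / 2 ^ (p + u) := by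
    push_cast; rw [hv, pow_add]; field_simp
  rw [e1, e2] at h ⊢
  rw [div_lt_div_iff_of_pos_right (by positivity)] at h
  rw [← add_div, div_le_div_iff_of_pos_right (by positivity)]
  have h' : a * 2 ^ u < b * 2 ^ v := by exact_mod_cast h
  exact_mod_cast h'

lemma dil_eq_pi (k₀ : ℕ) (α : Index n) :
    dil k₀ α = Set.pi univ fun i => Ioo (lo k₀ α i) (hi k₀ α i) := by
  ext x; simp [mem_dil, Set.mem_pi]

lemma isOpen_dil (k₀ : ℕ) (α : Index n) : IsOpen (dil k₀ α) := by
  rw [dil_eq_pi]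
  exact isOpen_set_pi finite_univ fun _ _ => isOpen_Ioo

lemma measurableSet_dil (k₀ : ℕ) (α : Index n) : MeasurableSet (dil k₀ α) :=
  (isOpen_dil k₀ α).measurableSet

lemma dyadicCube_eq_pi (α : Index n) :
    dyadicCube α = Set.pi univ fun i => Ioo ((α.2 i : ℝ) * side α) (((α.2 i : ℝ) + 1) * side α) := by
  ext x; simp [dyadicCube, Set.mem_pi]

lemma dyadicCube_subset_closed (α : Index n) : dyadicCube α ⊆ closedDyadicCube α :=
  fun _ hx i => ⟨(hx i).1.le, (hx i).2.le⟩

lemma closed_subset_dil (k₀ : ℕ) (α : Index n) : closedDyadicCube α ⊆ dil k₀ α := by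
  intro x hx
  rw [mem_dil]
  intro i
  have := side_pos α
  have : 0 < side α / 2 ^ (k₀ + 1) := by positivity
  rw [lo_eq, hi_eq]
  constructor <;> linarith [(hx i).1, (hx i).2]

lemma volume_dyadicCube (α : Index n) : volume (dyadicCube α) = ENNReal.ofReal (side α) ^ n := by
  rw [dyadicCube_eq_pi, volume_pi_pi]
  simp only [Real.volume_Ioo]
  rw [Finset.prod_congr rfl (g := fun _ => ENNReal.ofReal (side α))
    (fun i _ => by congr 1; ring)]
  simp

lemma volume_dil_ge (k₀ : ℕ) (α : Index n) : ENNReal.ofReal (side α) ^ n ≤ volume (dil k₀ α) := by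
  rw [← volume_dyadicCube α]
  exact measure_mono ((dyadicCube_subset_closed α).trans (closed_subset_dil k₀ α))

lemma volume_dil_lt_top (k₀ : ℕ) (α : Index n) : volume (dil k₀ α) < ⊤ := by
  rw [dil_eq_pi, volume_pi_pi]
  exact ENNReal.prod_lt_top fun i _ => by simp

lemma volume_dil_pos (k₀ : ℕ) (α : Index n) : 0 < volume (dil k₀ α) := by
  refine lt_of_lt_of_le ?_ (volume_dil_ge k₀ α)
  have := side_pos α
  positivity

/-- Two intersecting dilated cubes share a cube comparable to the smaller one. -/
lemma volume_dil_inter_ge {k₀ : ℕ} {α β : Index n} (h : (dil k₀ α ∩ dil k₀ β).Nonempty)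
    {k : ℕ} (hα : α.1 ≤ k) (hβ : β.1 ≤ k) :
    ENNReal.ofReal (1 / 2 ^ (k + k₀ + 1)) ^ n ≤ volume (dil k₀ α ∩ dil k₀ β) := by
  obtain ⟨x, hxα, hxβ⟩ := h
  rw [mem_dil] at hxα hxβ
  rw [dil_eq_pi, dil_eq_pi, ← Set.pi_inter_distrib]
  simp only [Ioo_inter_Ioo]
  rw [volume_pi_pi]
  simp only [Real.volume_Ioo]
  calc ENNReal.ofReal (1 / 2 ^ (k + k₀ + 1)) ^ n
      = ∏ _i : Fin n, ENNReal.ofReal (1 / 2 ^ (k + k₀ + 1)) := by simp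
    _ ≤ _ := by
      refine Finset.prod_le_prod' fun i _ => ENNReal.ofReal_le_ofReal ?_
      -- All endpoints lie on the grid of step `2^-(k+k₀+1)`, so each nonempty edge of the
      -- intersection has at least one step.
      have gap : ∀ γ δ : Index n, γ.1 ≤ k → δ.1 ≤ k → lo k₀ γ i < hi k₀ δ i →
          lo k₀ γ i + 1 / 2 ^ (k + k₀ + 1) ≤ hi k₀ δ i := fun γ δ hγ hδ h =>
        grid_gap (by omega) (by omega) h
      rw [le_sub_iff_add_le, ← sub_nonneg]
      rw [sub_nonneg, add_comm]
      rcases le_total (lo k₀ α i) (lo k₀ β i) with h1 | h1 <;>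
      rcases le_total (hi k₀ α i) (hi k₀ β i) with h2 | h2 <;>
      simp only [sup_eq_right.2, sup_eq_left.2, inf_eq_left.2, inf_eq_right.2, h1, h2]
      · exact gap _ _ hβ hα ((hxβ i).1.trans (hxα i).2)
      · exact gap _ _ hβ hβ ((hxβ i).1.trans (hxβ i).2)
      · exact gap _ _ hα hα ((hxα i).1.trans (hxα i).2)
      · exact gap _ _ hα hβ ((hxα i).1.trans (hxβ i).2)

lemma endpoints_of_closed_subset {α β : Index n}
    (h : closedDyadicCube β ⊆ closedDyadicCube α) (i : Fin n) :
    (α.2 i : ℝ) * side α ≤ (β.2 i : ℝ) * side β ∧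
      ((β.2 i : ℝ) + 1) * side β ≤ ((α.2 i : ℝ) + 1) * side α := by
  have hs := side_pos β
  constructor
  · refine (h (a := fun l => (β.2 l : ℝ) * side β) ?_ i).1
    intro l; constructor <;> simp only <;> linarith
  · refine (h (a := fun l => ((β.2 l : ℝ) + 1) * side β) ?_ i).2
    intro l; constructor <;> simp only <;> linarith

lemma dyadic_subset_of_closed_subset {α β : Index n}
    (h : closedDyadicCube β ⊆ closedDyadicCube α) : dyadicCube β ⊆ dyadicCube α := by
  intro x hx i
  have := endpoints_of_closed_subset h i
  exact ⟨this.1.trans_lt (hx i).1, (hx i).2.trans_le this.2⟩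

lemma dil_subset_of_closed_subset {k₀ : ℕ} {α β : Index n}
    (h : closedDyadicCube β ⊆ closedDyadicCube α) : dil k₀ β ⊆ dil k₀ α := by
  intro x hx
  rw [mem_dil] at hx ⊢
  intro i
  have e := endpoints_of_closed_subset h i
  have hs : side β ≤ side α := by linarith [e.1, e.2]
  have hs' : side β / 2 ^ (k₀ + 1) ≤ side α / 2 ^ (k₀ + 1) := by gcongr
  have := hx i
  rw [lo_eq, hi_eq] at this ⊢
  constructor <;> linarith [e.1, e.2, this.1, this.2]

/-! ### Levels of a system of tilings -/

lemma IsTiling.exists_mem_dil {A : Set (Index n)} (h : IsTiling A) (k₀ : ℕ) (x : Base n) :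
    ∃ α ∈ A, x ∈ dil k₀ α := by
  have := h.cover ▸ mem_univ x
  simp only [mem_iUnion] at this
  obtain ⟨α, hα, hx⟩ := this
  exact ⟨α, hα, closed_subset_dil k₀ α hx⟩

section admissible

variable {k₀ : ℕ} {γ : Space n → ℝ} {c₁ c₂ : ℝ} {A : ℕ → Set (Index n)}

/-- The rank increases with the level along intersecting dilated cubes. -/
lemma IsAdmissible.rank_add_lt (hA : IsAdmissible (1 + ((2 : ℝ) ^ k₀)⁻¹) γ c₁ c₂ A) {x : Base n}
    {s : ℕ} {α : Index n} (hα : α ∈ A s) (hx : x ∈ dil k₀ α) (d : ℕ) :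
    ∀ β ∈ A (s + d + 1), x ∈ dil k₀ β → α.1 + d < β.1 := by
  induction d with
  | zero =>
    intro β hβ hxβ
    exact side_le_half_iff.1 (hA.shrink s x α hα β hβ hx hxβ)
  | succ d ih =>
    intro β hβ hxβ
    obtain ⟨δ, hδ, hxδ⟩ := (hA.system.tiling (s + d + 1)).exists_mem_dil k₀ x
    have h1 := ih δ hδ hxδ
    have h2 := side_le_half_iff.1 (hA.shrink (s + d + 1) x δ hδ β hβ hxδ hxβ)
    omega

lemma IsAdmissible.rank_lt (hA : IsAdmissible (1 + ((2 : ℝ) ^ k₀)⁻¹) γ c₁ c₂ A) {x : Base n}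
    {s s' : ℕ} {α β : Index n} (hα : α ∈ A s) (hβ : β ∈ A s') (h : s < s')
    (hx : x ∈ dil k₀ α) (hx' : x ∈ dil k₀ β) : α.1 < β.1 := by
  obtain ⟨d, rfl⟩ := Nat.exists_eq_add_of_lt h
  exact (Nat.le_add_right _ _).trans_lt (hA.rank_add_lt hα hx d β hβ hx')

/-- Each level raises the rank by at least one along cubes meeting at a point. This bounds the
levels of the cubes competing at a given lattice point. -/
lemma IsAdmissible.level_le_rank (hA : IsAdmissible (1 + ((2 : ℝ) ^ k₀)⁻¹) γ c₁ c₂ A)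
    {s : ℕ} {α : Index n} (hα : α ∈ A s) : s ≤ α.1 := by
  have hx : (fun i => (α.2 i : ℝ) * side α) ∈ dil k₀ α := by
    apply closed_subset_dil
    intro i
    have := side_pos α
    constructor <;> simp only <;> linarith
  obtain ⟨β, hβ, hxβ⟩ := (hA.system.tiling 0).exists_mem_dil k₀ (fun i => (α.2 i : ℝ) * side α)
  rcases s with _ | s
  · exact Nat.zero_le _
  · have := hA.rank_add_lt hβ hxβ s α (by simpa using hα) hx
    omega

/-- Here `l 0 = 0` enters: it makes level zero the grid of unit cubes. -/
lemma IsAdmissible.rank_zero (hA : IsAdmissible (1 + ((2 : ℝ) ^ k₀)⁻¹) γ c₁ c₂ A)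
    {α : Index n} (hα : α ∈ A 0) : α.1 = 0 := by
  obtain ⟨l, -, hl0, hl⟩ := hA.side_ge
  have := hl 0 α hα
  have h : side ((0, α.2) : Index n) ≤ side α := by simpa [side, hl0] using this
  have := side_le_side_iff.1 h
  omega

lemma IsAdmissible.unit_mem (hA : IsAdmissible (1 + ((2 : ℝ) ^ k₀)⁻¹) γ c₁ c₂ A)
    (m : Fin n → ℤ) : ((0, m) : Index n) ∈ A 0 := by
  have := (hA.system.tiling 0).cover ▸ mem_univ (fun i => (m i : ℝ) + 1 / 2)
  simp only [mem_iUnion] at this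
  obtain ⟨α, hα, hx⟩ := this
  have h0 := hA.rank_zero hα
  have : α = (0, m) := by
    refine Prod.ext h0 (funext fun i => ?_)
    have := hx i
    simp only [side, h0, pow_zero, inv_one, mul_one] at this
    have h1 : (α.2 i : ℝ) < m i + 1 := by linarith [this.1]
    have h2 : (m i : ℝ) < α.2 i + 1 := by linarith [this.2]
    have h1' : α.2 i < m i + 1 := by exact_mod_cast h1
    have h2' : m i < α.2 i + 1 := by exact_mod_cast h2
    simp only
    omega
  exact this ▸ hα

/-- Weight averages over cubes of equal or consecutive levels are comparable. -/
lemma IsAdmissible.weightAvg_le (hA : IsAdmissible (1 + ((2 : ℝ) ^ k₀)⁻¹) γ c₁ c₂ A)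
    (hc₁ : 1 ≤ c₁) (hc₂ : 1 ≤ c₂) (hγ : ∀ α : Index n, 0 ≤ weightAvg γ α)
    {s s' : ℕ} {α β : Index n} (hα : α ∈ A s) (hβ : β ∈ A s') (h : s' ≤ s + 1) (h' : s ≤ s' + 1)
    (hne : (dil k₀ α ∩ dil k₀ β).Nonempty) :
    weightAvg γ α ≤ c₁ * c₂ * weightAvg γ β := by
  have c1 : 0 ≤ c₁ := by linarith
  have c2 : 0 ≤ c₂ := by linarith
  obtain rfl | rfl | rfl : s = s' ∨ s' = s + 1 ∨ s = s' + 1 := by omega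
  · calc _ ≤ c₁ * weightAvg γ β := hA.neighbours s α hα β hβ hne
      _ ≤ c₁ * (c₂ * weightAvg γ β) := by
        gcongr; exact le_mul_of_one_le_left (hγ β) hc₂
      _ = _ := by ring
  -- The parent of the finer cube has a larger dilation, so it meets the other cube at equal level;
  -- one neighbour step and one nesting step then suffice.
  · obtain ⟨p, hp, hsub⟩ := hA.system.succeeds s β hβ
    have h1 : weightAvg γ α ≤ c₁ * weightAvg γ p :=
      hA.neighbours s α hα p hp
        (hne.mono (inter_subset_inter_right _ (dil_subset_of_closed_subset hsub)))
    have h2 := (hA.nested s p hp β hβ (dyadic_subset_of_closed_subset hsub)).1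
    calc _ ≤ _ := h1
      _ ≤ c₁ * (c₂ * weightAvg γ β) := by gcongr
      _ = _ := by ring
  · obtain ⟨p, hp, hsub⟩ := hA.system.succeeds s' α hα
    have h1 : weightAvg γ p ≤ c₁ * weightAvg γ β :=
      hA.neighbours s' p hp β hβ
        (hne.mono (inter_subset_inter_left _ (dil_subset_of_closed_subset hsub)))
    have h2 := (hA.nested s' p hp α hα (dyadic_subset_of_closed_subset hsub)).2
    calc _ ≤ _ := h2
      _ ≤ c₂ * (c₁ * weightAvg γ β) := by gcongr
      _ = _ := by ring

end admissible

/-! ### Overlap of irredundant families -/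

/-- The dilated cube `β` sticks out of the dilated cube `α` through the face `p`. -/
def SticksOut (k₀ : ℕ) (α β : Index n) (p : Fin n × Bool) : Prop :=
  if p.2 then hi k₀ α p.1 < hi k₀ β p.1 else lo k₀ β p.1 < lo k₀ α p.1

lemma exists_sticksOut {k₀ : ℕ} {α β : Index n} (h : ¬ dil k₀ β ⊆ dil k₀ α) :
    ∃ p, SticksOut k₀ α β p := by
  by_contra! hp
  refine h fun x hx => ?_
  rw [mem_dil] at hx ⊢
  intro i
  have h1 := hp (i, true)
  have h2 := hp (i, false)
  simp only [SticksOut, if_true, Bool.false_eq_true, if_false, not_lt] at h1 h2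
  exact ⟨h2.trans_lt (hx i).1, (hx i).2.trans_le h1⟩

/-- A cube of much larger rank cannot stick out through a face beyond which the middle cube
already protrudes. -/
lemma not_sticksOut {k₀ : ℕ} {α β δ : Index n} {x : Base n} {p : Fin n × Bool}
    (hα : x ∈ dil k₀ α) (hδ : x ∈ dil k₀ δ) (hαβ : α.1 ≤ β.1)
    (hβδ : β.1 + k₀ + 2 ≤ δ.1) (h : SticksOut k₀ α β p) : ¬ SticksOut k₀ β δ p := by
  obtain ⟨i, e⟩ := p
  have hlen := hi_sub_lo_le k₀ δ i
  -- `β` exceeds `α` at the face by at least one grid step, while `δ` contains a point of `α` and is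
  -- no longer than that step, so `δ` cannot reach beyond `β`.
  have hs : 2 * side δ ≤ 1 / 2 ^ (β.1 + k₀ + 1) := by
    unfold side
    rw [← div_eq_mul_inv, div_le_div_iff₀ (by positivity) (by positivity), one_mul, ← pow_succ']
    exact pow_le_pow_right₀ (by norm_num) (by omega)
  rw [mem_dil] at hα hδ
  have a := hα i
  have d := hδ i
  cases e
  · simp only [SticksOut, Bool.false_eq_true, if_false, not_lt] at h ⊢
    have g : lo k₀ β i + 1 / 2 ^ (β.1 + k₀ + 1) ≤ lo k₀ α i :=
      grid_gap (by omega) (by omega) h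
    linarith
  · simp only [SticksOut, if_true, not_lt] at h ⊢
    have g : hi k₀ α i + 1 / 2 ^ (β.1 + k₀ + 1) ≤ hi k₀ β i :=
      grid_gap (by omega) (by omega) h
    linarith

/-- The bound for the overlap multiplicity of a reduced family of dilated cubes. -/
def overlapBound (n k₀ : ℕ) : ℕ :=
  Fintype.card (ZMod (k₀ + 2) × Set (Fin n × Bool) × (Fin n → ZMod 2))

/-- Cubes through `x` are told apart by a key with finitely many values: the rank modulo `k₀ + 2`,
the faces through which much smaller members stick out, and the parity of the position. Equal
residues mean equal ranks or a rank gap of at least `k₀ + 2`. The face set excludes the gap; for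
equal ranks, the cubes through `x` have positions differing by less than two, so parity decides. -/
lemma encard_le_overlapBound {k₀ : ℕ} {x : Base n} {B : Set (Index n)}
    (hx : ∀ β ∈ B, x ∈ dil k₀ β)
    (hB : ∀ α ∈ B, ∀ β ∈ B, α ≠ β → ¬ dil k₀ β ⊆ dil k₀ α) :
    B.encard ≤ overlapBound n k₀ := by
  classical
  let key : Index n → ZMod (k₀ + 2) × Set (Fin n × Bool) × (Fin n → ZMod 2) := fun β =>
    (β.1, {p | ∃ β' ∈ B, β.1 + k₀ + 2 ≤ β'.1 ∧ SticksOut k₀ β β' p}, fun i => (β.2 i : ZMod 2))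
  have gap : ∀ α ∈ B, ∀ β ∈ B, (α.1 : ZMod (k₀ + 2)) = β.1 → α.1 < β.1 →
      α.1 + k₀ + 2 ≤ β.1 := by
    intro α _ β _ h hlt
    rw [ZMod.natCast_eq_natCast_iff] at h
    have := (Nat.modEq_iff_dvd' hlt.le).1 h
    have := Nat.le_of_dvd (by omega) this
    omega
  have far : ∀ α ∈ B, ∀ β ∈ B, α.1 + k₀ + 2 ≤ β.1 → (key α).2.1 ≠ (key β).2.1 := by
    intro α hα β hβ h he
    -- The face `p` lies in the set of `α`. If it also lay in that of `β`, a still smaller cube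
    -- would stick out of `β` through `p`, which `not_sticksOut` forbids.
    obtain ⟨p, hp⟩ := exists_sticksOut (hB α hα β hβ (by rintro rfl; omega))
    have : p ∈ (key β).2.1 := he ▸ ⟨β, hβ, h, hp⟩
    obtain ⟨δ, hδ, hβδ, hs⟩ := this
    exact not_sticksOut (hx α hα) (hx δ hδ) (by omega) hβδ hp hs
  have inj : Set.InjOn key B := by
    intro α hα β hβ h
    have h1 : (α.1 : ZMod (k₀ + 2)) = β.1 := congrArg Prod.fst h
    have h2 : (key α).2.1 = (key β).2.1 := by rw [h]
    have h3 : (fun i => (α.2 i : ZMod 2)) = fun i => (β.2 i : ZMod 2) :=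
      congrArg (fun q => q.2.2) h
    have hk : α.1 = β.1 := by
      rcases lt_trichotomy α.1 β.1 with hlt | he | hlt
      · exact absurd h2 (far α hα β hβ (gap α hα β hβ h1 hlt))
      · exact he
      · exact absurd h2.symm (far β hβ α hα (gap β hβ α hα h1.symm hlt))
    refine Prod.ext hk (funext fun i => ?_)
    have hsα := side_pos α
    have hs : side β = side α := by unfold side; rw [hk]
    have a := (mem_dil.1 (hx α hα)) i
    have b := (mem_dil.1 (hx β hβ)) i
    have mα := margin_le k₀ α
    rw [lo_eq, hi_eq] at a b
    rw [hs] at b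
    have u1 : (α.2 i : ℝ) < β.2 i + 2 := by
      have : (α.2 i : ℝ) * side α < (β.2 i + 2) * side α := by linarith [a.1, b.2]
      exact lt_of_mul_lt_mul_right this hsα.le
    have u2 : (β.2 i : ℝ) < α.2 i + 2 := by
      have : (β.2 i : ℝ) * side α < (α.2 i + 2) * side α := by linarith [b.1, a.2]
      exact lt_of_mul_lt_mul_right this hsα.le
    have u1' : α.2 i < β.2 i + 2 := by exact_mod_cast u1
    have u2' : β.2 i < α.2 i + 2 := by exact_mod_cast u2
    have h3' : (α.2 i : ZMod 2) = β.2 i := congrFun h3 i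
    rw [ZMod.intCast_eq_intCast_iff_dvd_sub] at h3'
    push_cast at h3'
    omega
  calc B.encard ≤ (univ : Set (ZMod (k₀ + 2) × Set (Fin n × Bool) × (Fin n → ZMod 2))).encard :=
        Set.encard_le_encard_of_injOn (fun _ _ => mem_univ _) inj
    _ = overlapBound n k₀ := by
      rw [Set.encard_univ, ENat.card_eq_coe_fintype_card, overlapBound]

-- Irredundance enters only through its pairwise consequence: no dilated cube of the reduced family
-- contains another.
open Classical in
lemma IsReduction.tsum_indicator_le {k₀ : ℕ} {A A' : Set (Index n)}
    (h : IsReduction (1 + ((2 : ℝ) ^ k₀)⁻¹) A A') (x : Base n) :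
    ∑' α : A', (dil k₀ α.1).indicator (fun _ => (1 : ℝ≥0∞)) x ≤ overlapBound n k₀ := by
  have hB := encard_le_overlapBound (k₀ := k₀) (x := x) (B := {β | β ∈ A' ∧ x ∈ dil k₀ β})
    (fun β hβ => hβ.2) (fun α hα β hβ hne hsub => h.irredundant β hβ.1 (hsub.trans
      (subset_biUnion_of_mem (u := fun δ => dilatedCube (1 + ((2 : ℝ) ^ k₀)⁻¹) δ)
        (show α ∈ A' \ {β} from ⟨hα.1, hne⟩))))
  have e : ∑' α : A', (dil k₀ α.1).indicator (fun _ => (1 : ℝ≥0∞)) x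
      = ∑' α : {β | β ∈ A' ∧ x ∈ dil k₀ β}, (1 : ℝ≥0∞) := by
    rw [tsum_subtype A' (fun α => (dil k₀ α).indicator (fun _ => (1 : ℝ≥0∞)) x),
      tsum_subtype {β | β ∈ A' ∧ x ∈ dil k₀ β} (fun _ => (1 : ℝ≥0∞))]
    refine tsum_congr fun α => ?_
    by_cases h1 : α ∈ A' <;> by_cases h2 : x ∈ dil k₀ α <;> simp [indicator, h1, h2]
  rw [e, ENNReal.tsum_set_one]
  exact_mod_cast hB

/-! ### Counting lattice points -/

/-- The integers `m` with `u ≤ m / 2 ^ j ≤ v`. -/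
noncomputable def latticeIcc (j : ℕ) (u v : ℝ) : Finset ℤ := Finset.Icc ⌈u * 2 ^ j⌉ ⌊v * 2 ^ j⌋

lemma mem_latticeIcc {j : ℕ} {u v : ℝ} {m : ℤ} :
    m ∈ latticeIcc j u v ↔ u ≤ m / 2 ^ j ∧ (m : ℝ) / 2 ^ j ≤ v := by
  unfold latticeIcc
  rw [Finset.mem_Icc, Int.ceil_le, Int.le_floor, le_div_iff₀ (by positivity),
    div_le_iff₀ (by positivity)]

lemma card_latticeIcc_le {j : ℕ} {u v c : ℝ} (hc : 0 ≤ c) (h : (v - u) * 2 ^ j ≤ c) :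
    ((latticeIcc j u v).card : ℝ) ≤ c + 1 := by
  unfold latticeIcc
  rw [Int.card_Icc]
  rcases le_total (⌊v * 2 ^ j⌋ + 1 - ⌈u * 2 ^ j⌉) 0 with h0 | h0
  · rw [Int.toNat_of_nonpos h0]; simp; linarith
  · have : (((⌊v * 2 ^ j⌋ + 1 - ⌈u * 2 ^ j⌉).toNat : ℤ) : ℝ)
        = ((⌊v * 2 ^ j⌋ + 1 - ⌈u * 2 ^ j⌉ : ℤ) : ℝ) := by rw [Int.toNat_of_nonneg h0]
    rw [Int.cast_natCast] at this
    rw [this]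
    push_cast
    have h1 := Int.floor_le (v * 2 ^ j)
    have h2 := Int.le_ceil (u * 2 ^ j)
    linarith

lemma tsum_ite_le_card {ι : Type*} {P : ι → Prop} [DecidablePred P] (T : Finset ι)
    (h : ∀ i, P i → i ∈ T) (c : ℝ≥0∞) :
    ∑' i, (if P i then c else 0) ≤ T.card * c := by
  classical
  calc ∑' i, (if P i then c else 0) ≤ ∑' i, (if i ∈ T then c else 0) := by
        refine ENNReal.tsum_le_tsum fun i => ?_
        by_cases hi : P i
        · simp [hi, h i hi]
        · simp [hi]
    _ = ∑ i ∈ T, c := by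
        rw [tsum_eq_sum (s := T) (fun i hi => by simp [hi])]
        exact Finset.sum_congr rfl fun i hi => by simp [hi]
    _ = T.card * c := by simp

lemma tsum_half_pow_le (k : ℕ) :
    ∑' j : ℕ, (if k ≤ j then ((2 : ℝ≥0∞)⁻¹) ^ (j - k) else 0) ≤ 2 := by
  rw [← (add_right_injective k).tsum_eq (f := fun j : ℕ =>
    (if k ≤ j then ((2 : ℝ≥0∞)⁻¹) ^ (j - k) else 0))]
  · simp [ENNReal.tsum_geometric]
  · intro j hj
    have : k ≤ j := by
      by_contra h
      simp [h] at hj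
    exact ⟨j - k, by simp; omega⟩

/-- The lattice points of scale `j` in a box whose edges are at most `2ᵃ` lattice steps long. -/
lemma card_box_le {j a : ℕ} {u v : Fin n → ℝ} (h : ∀ l, (v l - u l) * 2 ^ j ≤ 2 ^ a) :
    (Fintype.piFinset fun l => latticeIcc j (u l) (v l)).card ≤ (2 ^ (a + 1)) ^ n := by
  rw [Fintype.card_piFinset]
  calc ∏ l, (latticeIcc j (u l) (v l)).card ≤ ∏ _l : Fin n, 2 ^ (a + 1) := by
        refine Finset.prod_le_prod' fun l _ => ?_
        have h1 := card_latticeIcc_le (by positivity) (h l)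
        have h2 : ((latticeIcc j (u l) (v l)).card : ℝ) ≤ ((2 ^ (a + 1) : ℕ) : ℝ) := by
          push_cast
          have : (1 : ℝ) ≤ 2 ^ a := one_le_pow₀ (by norm_num)
          rw [pow_succ]; linarith
        exact_mod_cast h2
    _ = _ := by simp

/-- The lattice points of scale `j` on finitely many hyperplane sections of such a box. -/
lemma card_faces_le {j a : ℕ} {u v : Fin n → ℝ} (w : Fin n → Bool → ℝ)
    (h : ∀ l, (v l - u l) * 2 ^ j ≤ 2 ^ a) :
    ((Finset.univ : Finset (Fin n × Bool)).biUnion fun p => Fintype.piFinset fun l =>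
      if l = p.1 then latticeIcc j (w p.1 p.2) (w p.1 p.2) else latticeIcc j (u l) (v l)).card
      ≤ 2 * n * (2 ^ (a + 1)) ^ (n - 1) := by
  refine Finset.card_biUnion_le.trans ?_
  calc _ ≤ ∑ _p : Fin n × Bool, (2 ^ (a + 1)) ^ (n - 1) := by
        refine Finset.sum_le_sum fun p _ => ?_
        rw [Fintype.card_piFinset]
        calc _ ≤ ∏ l : Fin n, (if l = p.1 then 1 else 2 ^ (a + 1)) := by
              refine Finset.prod_le_prod' fun l _ => ?_
              split_ifs with hl
              -- The coordinate normal to the face is pinned to one value and contributes at most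
              -- one lattice coordinate, which leaves `n - 1` free factors.
              · have := card_latticeIcc_le (j := j) (u := w p.1 p.2) (v := w p.1 p.2) le_rfl
                  (by simp)
                rw [zero_add] at this
                exact_mod_cast this
              · have h1 := card_latticeIcc_le (by positivity) (h l)
                have h2 : ((latticeIcc j (u l) (v l)).card : ℝ) ≤ ((2 ^ (a + 1) : ℕ) : ℝ) := by
                  push_cast
                  have : (1 : ℝ) ≤ 2 ^ a := one_le_pow₀ (by norm_num)
                  rw [pow_succ]; linarith
                exact_mod_cast h2
          _ = _ := by
              rw [Finset.prod_ite]
              simp [Finset.filter_ne', Finset.card_erase_of_mem]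
    _ = _ := by
        simp [Fintype.card_prod]; ring

/-- The lattice points of scale `j` at which the cube `β` can be replaced by `α`, which is
preferred to `β`, in the passage to the next scale. -/
def IsSwitch (k₀ : ℕ) (α β : Index n) (j : ℕ) (m : Fin n → ℤ) : Prop :=
  α.1 + (k₀ + 2) ≤ j + 1 ∧ β.1 + (k₀ + 2) ≤ j ∧
    (∀ l, lo k₀ α l ≤ pt j m l ∧ pt j m l ≤ hi k₀ α l) ∧ pt j m ∈ dil k₀ β ∧
    ((α.1 + (k₀ + 2) = j + 1 ∧ β.1 < α.1) ∨ pt j m ∉ dil k₀ α)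

/-- The constant in the bound for the number of switches. -/
noncomputable def switchConst (n k₀ : ℕ) : ℝ≥0∞ :=
  ((2 : ℝ≥0∞) ^ (k₀ + 3)) ^ n + 2 * (2 * n * (2 ^ 2) ^ (n - 1))

lemma switchConst_ne_top (n k₀ : ℕ) : switchConst n k₀ ≠ ⊤ := by
  unfold switchConst
  finiteness

lemma mul_side_le {α : Index n} {j a : ℕ} {c : ℝ} (h : c ≤ 2 * side α) (hj : j + 1 ≤ a + α.1) :
    c * 2 ^ j ≤ 2 ^ a := by
  calc c * 2 ^ j ≤ 2 * side α * 2 ^ j := by gcongr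
    _ = 2 ^ (j + 1) / 2 ^ α.1 := by unfold side; rw [pow_succ]; field_simp
    _ ≤ 2 ^ a := by
      rw [div_le_iff₀ (by positivity), ← pow_add]
      exact pow_le_pow_right₀ (by norm_num) hj

-- A switch at the scale where `α` becomes eligible can occur throughout `α`, but only at one scale.
-- At all other scales the lattice point is on the boundary of `α`; about `2^((j-k)(n-1))` such
-- points weighted by `2^(-jn)` leave `2^(-kn) 2^(-(j-k))`, which is summable in `j`.
open Classical in
lemma tsum_switch_le (hn : 1 ≤ n) (k₀ : ℕ) (α β : Index n) :
    ∑' j : ℕ, ∑' m : Fin n → ℤ, (if IsSwitch k₀ α β j m then ((2 : ℝ≥0∞)⁻¹) ^ (j * n) else 0)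
      ≤ switchConst n k₀ * ((2 : ℝ≥0∞)⁻¹) ^ (max α.1 β.1 * n) := by
  set k := max α.1 β.1 with hk
  set q : ℝ≥0∞ := (2 : ℝ≥0∞)⁻¹ with hq
  have hq1 : q ≤ 1 := by simp [hq]
  have q2 : ∀ a : ℕ, q ^ a * 2 ^ a = 1 := fun a => by
    rw [← mul_pow, hq, ENNReal.inv_mul_cancel (by norm_num) (by norm_num), one_pow]
  have key : ∀ j : ℕ, ∑' m : Fin n → ℤ, (if IsSwitch k₀ α β j m then q ^ (j * n) else 0)
      ≤ (if j + 1 = k + (k₀ + 2) then ((2 : ℝ≥0∞) ^ (k₀ + 3)) ^ n * q ^ (k * n) else 0)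
        + (if k ≤ j then q ^ (j - k) else 0) *
          ((2 * n * (2 ^ 2) ^ (n - 1)) * q ^ (k * n)) := by
    intro j
    have split : ∀ m, (if IsSwitch k₀ α β j m then q ^ (j * n) else 0) ≤
        (if (j + 1 = k + (k₀ + 2) ∧ k = α.1 ∧ IsSwitch k₀ α β j m) then q ^ (j * n) else 0)
        + (if (k ≤ j ∧ pt j m ∉ dil k₀ α ∧ IsSwitch k₀ α β j m) then q ^ (j * n) else 0) := by
      intro m
      by_cases h : IsSwitch k₀ α β j m
      · obtain ⟨h1, h2, h3, h4, h5⟩ := h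
        have h' : IsSwitch k₀ α β j m := ⟨h1, h2, h3, h4, h5⟩
        rcases h5 with h5 | h5
        · have ek : k = α.1 := by omega
          simp [h', ek, h5.1]
        · have ek : k ≤ j := by omega
          simp [h', ek, h5]
      · simp [h]
    refine (ENNReal.tsum_le_tsum split).trans ?_
    rw [ENNReal.tsum_add]
    refine add_le_add ?_ ?_
    · by_cases hj : j + 1 = k + (k₀ + 2)
      · by_cases ek : k = α.1
        · refine (tsum_ite_le_card (Fintype.piFinset fun l =>
            latticeIcc j (lo k₀ α l) (hi k₀ α l)) ?_ _).trans ?_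
          · rintro m ⟨-, -, -, -, h3, -⟩
            rw [Fintype.mem_piFinset]
            exact fun l => mem_latticeIcc.2 (h3 l)
          · have hc := card_box_le (n := n) (j := j) (a := k₀ + 2) (u := lo k₀ α) (v := hi k₀ α)
              (fun l => mul_side_le (hi_sub_lo_le k₀ α l) (by omega))
            rw [if_pos hj]
            exact mul_le_mul' (by exact_mod_cast hc)
              (pow_le_pow_right_of_le_one' hq1 (Nat.mul_le_mul_right n (by omega)))
        · simp [ek]
      · simp [hj]
    · by_cases hj : k ≤ j
      · simp only [hj, true_and, if_true]
        -- The points lie in the closures of both cubes; they are counted inside the one of larger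
        -- rank.
        obtain ⟨δ, hδ, hδk⟩ : ∃ δ : Index n, (∀ m, IsSwitch k₀ α β j m →
            ∀ l, lo k₀ δ l ≤ pt j m l ∧ pt j m l ≤ hi k₀ δ l) ∧ δ.1 = k := by
          rcases le_total α.1 β.1 with h | h
          · refine ⟨β, fun m hm l => ?_, by omega⟩
            have := mem_dil.1 hm.2.2.2.1 l
            exact ⟨this.1.le, this.2.le⟩
          · exact ⟨α, fun m hm => hm.2.2.1, by omega⟩
        refine (tsum_ite_le_card ((Finset.univ : Finset (Fin n × Bool)).biUnion fun p =>
          Fintype.piFinset fun l => if l = p.1 then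
            latticeIcc j (if p.2 then hi k₀ α p.1 else lo k₀ α p.1)
              (if p.2 then hi k₀ α p.1 else lo k₀ α p.1)
            else latticeIcc j (lo k₀ δ l) (hi k₀ δ l)) ?_ _).trans ?_
        · rintro m ⟨hnot, hm⟩
          rw [mem_dil] at hnot
          push Not at hnot
          obtain ⟨l₀, hl₀⟩ := hnot
          have hb := hm.2.2.1 l₀
          -- A point of the closed box outside the open one has a coordinate equal to an endpoint.
          obtain ⟨e, he⟩ : ∃ e : Bool, pt j m l₀ = if e then hi k₀ α l₀ else lo k₀ α l₀ := by
            rcases hb.1.eq_or_lt with h | h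
            · exact ⟨false, by simp [h]⟩
            · exact ⟨true, by simpa using le_antisymm hb.2 (hl₀ h)⟩
          rw [Finset.mem_biUnion]
          refine ⟨(l₀, e), Finset.mem_univ _, ?_⟩
          rw [Fintype.mem_piFinset]
          intro l
          by_cases h1 : l = l₀
          · subst h1
            simp only [if_true]
            rw [mem_latticeIcc]
            exact ⟨he.symm.le, he.le⟩
          · simp only [h1, if_false]
            exact mem_latticeIcc.2 (hδ m hm l)
        · have hc := card_faces_le (n := n) (j := j) (a := j + 1 - k) (u := lo k₀ δ) (v := hi k₀ δ)
            (fun l e => if e then hi k₀ α l else lo k₀ α l)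
            (fun l => mul_side_le (hi_sub_lo_le k₀ δ l) (by omega))
          calc _ ≤ ((2 * n * (2 ^ (j + 1 - k + 1)) ^ (n - 1) : ℕ) : ℝ≥0∞) * q ^ (j * n) := by
                gcongr
            _ = _ := by
                obtain ⟨d, rfl⟩ := Nat.exists_eq_add_of_le hj
                obtain ⟨r, rfl⟩ := Nat.exists_eq_add_of_le hn
                have e1 : k + d + 1 - k + 1 = d + 2 := by omega
                have e2 : k + d - k = d := by omega
                have e3 : 1 + r - 1 = r := by omega
                rw [e1, e2, e3]
                push_cast
                -- With `n = 1 + r`, the factor `q ^ (d * r)` absorbs the count on the faces, and `q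
                -- ^ d` remains to make the series geometric.
                have : q ^ ((k + d) * (1 + r)) = q ^ (k * (1 + r)) * q ^ d * q ^ (d * r) := by
                  rw [← pow_add, ← pow_add]; congr 1; ring
                rw [this, pow_add 2 d 2, mul_pow, ← pow_mul 2 d r]
                calc _ = 2 * (1 + (r : ℝ≥0∞)) * (2 ^ 2) ^ r * q ^ (k * (1 + r)) * q ^ d *
                      (q ^ (d * r) * 2 ^ (d * r)) := by ring
                  _ = _ := by rw [q2]; ring
      · simp [hj]
  calc _ ≤ ∑' j : ℕ, ((if j + 1 = k + (k₀ + 2) then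
          ((2 : ℝ≥0∞) ^ (k₀ + 3)) ^ n * q ^ (k * n) else 0)
        + (if k ≤ j then q ^ (j - k) else 0) *
          ((2 * n * (2 ^ 2) ^ (n - 1)) * q ^ (k * n))) := ENNReal.tsum_le_tsum key
    _ ≤ ((2 : ℝ≥0∞) ^ (k₀ + 3)) ^ n * q ^ (k * n)
        + 2 * ((2 * n * (2 ^ 2) ^ (n - 1)) * q ^ (k * n)) := by
      rw [ENNReal.tsum_add, ENNReal.tsum_mul_right]
      gcongr
      · have := tsum_ite_le_card (P := fun j => j + 1 = k + (k₀ + 2)) {k + (k₀ + 1)}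
          (fun j hj => by simp; omega) (((2 : ℝ≥0∞) ^ (k₀ + 3)) ^ n * q ^ (k * n))
        simpa using this
      · exact tsum_half_pow_le k
    _ = _ := by unfold switchConst; ring

/-! ### Weak derivatives and locally finite sums -/

lemma isOpen_upperHalf (n : ℕ) : IsOpen (upperHalf n) :=
  isOpen_lt continuous_const continuous_snd

lemma continuous_mul_of_tsupport_subset {Ω : Set (Space n)} (hΩ : IsOpen Ω) {f ρ : Space n → ℝ}
    (hf : ContinuousOn f Ω) (hρ : Continuous ρ) (hs : tsupport ρ ⊆ Ω) :
    Continuous fun z => f z * ρ z := by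
  rw [continuous_iff_continuousAt]
  intro z
  by_cases hz : z ∈ Ω
  · exact (hf.continuousAt (hΩ.mem_nhds hz)).mul hρ.continuousAt
  · have h0 : (fun z => f z * ρ z) =ᶠ[𝓝 z] fun _ => 0 := by
      filter_upwards [notMem_tsupport_iff_eventuallyEq.1 (fun h => hz (hs h))] with w hw
      simp [hw]
    exact continuousAt_const.congr h0.symm

instance : (volume : Measure (Space n)).IsAddHaarMeasure :=
  inferInstanceAs ((volume : Measure (Base n)).prod (volume : Measure ℝ)).IsAddHaarMeasure

lemma hasWeakDerivOn_of_contDiffAt {Ω : Set (Space n)} (hΩ : IsOpen Ω) {f : Space n → ℝ}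
    (hf : ∀ z ∈ Ω, ContDiffAt ℝ 1 f z) (v : Space n) :
    HasWeakDerivOn Ω f v fun z => fderiv ℝ f z v := by
  have hfc : ContinuousOn f Ω := fun z hz => (hf z hz).continuousAt.continuousWithinAt
  have hdc : ContinuousOn (fun z => fderiv ℝ f z v) Ω := fun z hz =>
    (((hf z hz).continuousAt_fderiv (by norm_num)).clm_apply
      continuousAt_const).continuousWithinAt
  refine ⟨hfc.locallyIntegrableOn hΩ.measurableSet, hdc.locallyIntegrableOn hΩ.measurableSet, ?_⟩
  intro η hη hc hs
  have hη1 : ContDiff ℝ 1 η := hη.of_le (by exact_mod_cast le_top)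
  have hηd : Continuous fun z => fderiv ℝ η z v :=
    (hη1.continuous_fderiv (by norm_num)).clm_apply continuous_const
  have hηs : tsupport (fun z => fderiv ℝ η z v) ⊆ Ω := by
    refine (closure_minimal ?_ (isClosed_tsupport η)).trans hs
    intro z hz
    refine support_fderiv_subset ℝ (f := η) ?_
    intro h0; apply hz; simp [h0]
  have I1 : Integrable fun z => f z * fderiv ℝ η z v :=
    (continuous_mul_of_tsupport_subset hΩ hfc hηd hηs).integrable_of_hasCompactSupport
      (HasCompactSupport.mul_left (hc.fderiv_apply ℝ v))
  have I2 : Integrable fun z => fderiv ℝ f z v * η z :=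
    (continuous_mul_of_tsupport_subset hΩ hdc hη.continuous hs).integrable_of_hasCompactSupport
      hc.mul_left
  have I3 : Integrable fun z => f z * η z :=
    (continuous_mul_of_tsupport_subset hΩ hfc hη.continuous hs).integrable_of_hasCompactSupport
      hc.mul_left
  -- Both integrands vanish off `Ω`, so the integration by parts takes place on the whole space.
  rw [setIntegral_eq_integral_of_forall_compl_eq_zero, setIntegral_eq_integral_of_forall_compl_eq_zero]
  · exact integral_mul_fderiv_eq_neg_fderiv_mul_of_integrable I2 I1 I3
      (fun z hz => (hf z (hs hz)).differentiableAt (by norm_num))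
      (fun z _ => hη1.differentiable (by norm_num) z)
  · intro z hz
    rw [image_eq_zero_of_notMem_tsupport (fun h => hz (hs h)), mul_zero]
  · intro z hz
    rw [image_eq_zero_of_notMem_tsupport (f := fun z => fderiv ℝ η z v) (fun h => hz (hηs h)),
      mul_zero]

section locallyFinite

variable {ι : Type*} {a : ι → ℝ} {b : ι → Space n → ℝ}

/-- The family `b` is locally finite on the upper half-space. -/
def LocFinite (b : ι → Space n → ℝ) : Prop :=
  ∀ z ∈ upperHalf n, ∃ U ∈ 𝓝 z, ∃ T : Finset ι, ∀ i ∉ T, ∀ w ∈ U, b i w = 0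

lemma LocFinite.eventuallyEq (hb : LocFinite b) (a : ι → ℝ) {z : Space n} (hz : z ∈ upperHalf n) :
    ∃ T : Finset ι, (fun w => ∑' i, a i * b i w) =ᶠ[𝓝 z] (fun w => ∑ i ∈ T, a i * b i w) ∧
      ∀ i ∉ T, b i =ᶠ[𝓝 z] fun _ => 0 := by
  obtain ⟨U, hU, T, hT⟩ := hb z hz
  refine ⟨T, ?_, fun i hi => ?_⟩
  · filter_upwards [hU] with w hw
    exact tsum_eq_sum fun i hi => by rw [hT i hi w hw, mul_zero]
  · filter_upwards [hU] with w hw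
    exact hT i hi w hw

lemma LocFinite.contDiffAt (hb : LocFinite b) (hs : ∀ i, ContDiff ℝ 1 (b i)) (a : ι → ℝ)
    {z : Space n} (hz : z ∈ upperHalf n) : ContDiffAt ℝ 1 (fun w => ∑' i, a i * b i w) z := by
  obtain ⟨T, h1, -⟩ := hb.eventuallyEq a hz
  refine ContDiffAt.congr_of_eventuallyEq ?_ h1
  exact ContDiffAt.sum fun i _ => contDiffAt_const.mul (hs i).contDiffAt

lemma LocFinite.enorm_le (hb : LocFinite b) (a : ι → ℝ) {z : Space n} (hz : z ∈ upperHalf n) :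
    ‖∑' i, a i * b i z‖ₑ ≤ ∑' i, ‖a i‖ₑ * ‖b i z‖ₑ := by
  obtain ⟨T, h1, -⟩ := hb.eventuallyEq a hz
  rw [show ∑' i, a i * b i z = ∑ i ∈ T, a i * b i z from h1.eq_of_nhds]
  refine (enorm_sum_le _ _).trans ?_
  simp only [enorm_mul]
  exact ENNReal.sum_le_tsum T

lemma LocFinite.enorm_fderiv_le (hb : LocFinite b) (hs : ∀ i, ContDiff ℝ 1 (b i)) (a : ι → ℝ)
    {z : Space n} (hz : z ∈ upperHalf n) (v : Space n) :
    ‖fderiv ℝ (fun w => ∑' i, a i * b i w) z v‖ₑ ≤ ∑' i, ‖a i‖ₑ * ‖fderiv ℝ (b i) z v‖ₑ := by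
  obtain ⟨T, h1, -⟩ := hb.eventuallyEq a hz
  have hd : ∀ i, DifferentiableAt ℝ (b i) z := fun i => (hs i).differentiable (by norm_num) z
  rw [h1.fderiv_eq, fderiv_fun_sum fun i _ => (hd i).const_mul (a i)]
  rw [_root_.sum_apply]
  refine (enorm_sum_le _ _).trans ?_
  refine (Finset.sum_le_sum fun i _ => ?_).trans (ENNReal.sum_le_tsum T)
  rw [fderiv_const_mul (hd i)]
  simp [enorm_mul]

/-- Local finiteness permits termwise differentiation, and Tonelli does the rest. The factor `n + 2`
counts the multi-indices of order at most one. -/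
lemma sobolevNorm_tsum_le [Countable ι] (hb : LocFinite b) (hs : ∀ i, ContDiff ℝ 1 (b i))
    (a : ι → ℝ) {γ : Space n → ℝ} (hγ : AEMeasurable γ) {D : ι → ℝ≥0∞}
    (h0 : ∀ i, ∫⁻ z in upperHalf n, ‖γ z * b i z‖ₑ ≤ D i)
    (h1 : ∀ i, ∀ v : Space n, ‖v‖ ≤ 1 → ∫⁻ z in upperHalf n, ‖γ z * fderiv ℝ (b i) z v‖ₑ ≤ D i) :
    sobolevNorm (upperHalf n) γ (fun z => ∑' i, a i * b i z)
      ≤ (n + 2) * ∑' i, ‖a i‖ₑ * D i := by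
  have hΩ := (isOpen_upperHalf n).measurableSet
  have main : ∀ (g : Space n → ℝ) (c : ι → Space n → ℝ), (∀ i, Continuous (c i)) →
      (∀ z ∈ upperHalf n, ‖g z‖ₑ ≤ ∑' i, ‖a i‖ₑ * ‖c i z‖ₑ) →
      (∀ i, ∫⁻ z in upperHalf n, ‖γ z * c i z‖ₑ ≤ D i) →
      ∫⁻ z in upperHalf n, ‖γ z * g z‖ₑ ≤ ∑' i, ‖a i‖ₑ * D i := by
    intro g c hc hg hD
    calc ∫⁻ z in upperHalf n, ‖γ z * g z‖ₑ
        ≤ ∫⁻ z in upperHalf n, ∑' i, ‖a i‖ₑ * ‖γ z * c i z‖ₑ := by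
          refine setLIntegral_mono_ae' hΩ (ae_of_all _ fun z hz => ?_)
          rw [enorm_mul]
          refine (mul_le_mul_right (hg z hz) _).trans ?_
          rw [← ENNReal.tsum_mul_left]
          refine ENNReal.tsum_le_tsum fun i => ?_
          rw [enorm_mul]
          exact le_of_eq (by ring)
      _ = ∑' i, ∫⁻ z in upperHalf n, ‖a i‖ₑ * ‖γ z * c i z‖ₑ := by
          refine lintegral_tsum fun i => ?_
          exact ((hγ.restrict.mul (hc i).measurable.aemeasurable).enorm).const_mul _
      _ ≤ ∑' i, ‖a i‖ₑ * D i := by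
          refine ENNReal.tsum_le_tsum fun i => ?_
          rw [lintegral_const_mul' _ _ enorm_ne_top]
          gcongr
          exact hD i
  have wd : ∀ v : Space n, ‖v‖ ≤ 1 → weakDerivNorm (upperHalf n) γ (fun z => ∑' i, a i * b i z) v
      ≤ ∑' i, ‖a i‖ₑ * D i := by
    intro v hv
    refine (iInf₂_le _ (hasWeakDerivOn_of_contDiffAt (isOpen_upperHalf n)
      (fun z hz => hb.contDiffAt hs a hz) v)).trans ?_
    refine main _ (fun i z => fderiv ℝ (b i) z v) (fun i => ?_)
      (fun z hz => hb.enorm_fderiv_le hs a hz v) (fun i => h1 i v hv)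
    exact ((hs i).continuous_fderiv (by norm_num)).clm_apply continuous_const
  unfold sobolevNorm
  calc _ ≤ (∑' i, ‖a i‖ₑ * D i) + (∑ _i : Fin n, ∑' i, ‖a i‖ₑ * D i) + ∑' i, ‖a i‖ₑ * D i := by
        refine add_le_add (add_le_add ?_ (Finset.sum_le_sum fun i _ => wd _ ?_)) (wd _ ?_)
        · exact main _ b (fun i => (hs i).continuous) (fun z hz => hb.enorm_le a hz) h0
        · simp [Prod.norm_def, Pi.norm_single]
        · simp [Prod.norm_def]
    _ = _ := by simp; ring

end locallyFinite

/-! ### Bump functions -/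

/-- A smooth function supported in `[-2/3, 2/3]` whose integer translates form a partition of
unity. -/
noncomputable def tent (u : ℝ) : ℝ :=
  Real.smoothTransition (3 * u + 2) - Real.smoothTransition (3 * u - 1)

lemma contDiff_tent : ContDiff ℝ 1 tent :=
  (Real.smoothTransition.contDiff.comp ((contDiff_const.mul contDiff_id).add contDiff_const)).sub
    (Real.smoothTransition.contDiff.comp ((contDiff_const.mul contDiff_id).sub contDiff_const))

lemma tent_nonneg (u : ℝ) : 0 ≤ tent u :=
  sub_nonneg.2 (Real.smoothTransition.monotone (by linarith))

lemma tent_le_one (u : ℝ) : tent u ≤ 1 := by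
  have h1 := Real.smoothTransition.le_one (3 * u + 2)
  have h2 := Real.smoothTransition.nonneg (3 * u - 1)
  unfold tent; linarith

lemma tent_eq_zero {u : ℝ} (h : 2 / 3 ≤ |u|) : tent u = 0 := by
  unfold tent
  rcases le_abs'.1 h with h | h
  · rw [Real.smoothTransition.zero_of_nonpos (by linarith),
      Real.smoothTransition.zero_of_nonpos (by linarith), sub_zero]
  · rw [Real.smoothTransition.one_of_one_le (by linarith),
      Real.smoothTransition.one_of_one_le (by linarith), sub_self]

lemma tent_sub_eq_zero {u : ℝ} {k : ℤ} (h : k ∉ ({⌊u⌋, ⌊u⌋ + 1} : Finset ℤ)) :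
    tent (u - k) = 0 := by
  apply tent_eq_zero
  simp only [Finset.mem_insert, Finset.mem_singleton, not_or] at h
  have h1 := Int.floor_le u
  have h2 := Int.lt_floor_add_one u
  rcases lt_or_gt_of_ne h.1 with h3 | h3
  · have : ((k + 1 : ℤ) : ℝ) ≤ ⌊u⌋ := by exact_mod_cast h3
    push_cast at this
    rw [le_abs]; left; linarith
  · have : ((⌊u⌋ + 2 : ℤ) : ℝ) ≤ k := by
      have : ⌊u⌋ + 2 ≤ k := by omega
      exact_mod_cast this
    push_cast at this
    rw [le_abs]; right; linarith

/-- The subtracted transition in `tent v` is the leading one in `tent (v - 1)`, so consecutive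
translates telescope; the two outer terms are constant for `0 ≤ v < 1`. -/
lemma sum_tent (u : ℝ) : ∑ k ∈ ({⌊u⌋, ⌊u⌋ + 1} : Finset ℤ), tent (u - k) = 1 := by
  have h1 := Int.floor_le u
  have h2 := Int.lt_floor_add_one u
  rw [Finset.sum_pair (by omega)]
  unfold tent
  push_cast
  rw [Real.smoothTransition.one_of_one_le (x := 3 * (u - ⌊u⌋) + 2) (by linarith),
    Real.smoothTransition.zero_of_nonpos (x := 3 * (u - (⌊u⌋ + 1)) - 1) (by linarith),
    show 3 * (u - (⌊u⌋ + 1)) + 2 = 3 * (u - ⌊u⌋) - 1 by ring]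
  ring

/-- The bump function at the lattice point `2⁻ʲ m`. -/
noncomputable def psi (j : ℕ) (m : Fin n → ℤ) (x : Base n) : ℝ :=
  ∏ i, tent (2 ^ j * x i - m i)

lemma psi_nonneg (j : ℕ) (m : Fin n → ℤ) (x : Base n) : 0 ≤ psi j m x :=
  Finset.prod_nonneg fun _ _ => tent_nonneg _

lemma psi_ne_zero {j : ℕ} {m : Fin n → ℤ} {x : Base n} (h : psi j m x ≠ 0) (i : Fin n) :
    |2 ^ j * x i - m i| < 2 / 3 := by
  by_contra! h'
  exact h (Finset.prod_eq_zero (Finset.mem_univ i) (tent_eq_zero h'))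

/-- The lattice points whose bump functions may be nonzero at `x`. -/
noncomputable def nearLattice (j : ℕ) (x : Base n) : Finset (Fin n → ℤ) :=
  Fintype.piFinset fun i => {⌊2 ^ j * x i⌋, ⌊2 ^ j * x i⌋ + 1}

lemma psi_eq_zero_of_notMem {j : ℕ} {m : Fin n → ℤ} {x : Base n} (h : m ∉ nearLattice j x) :
    psi j m x = 0 := by
  unfold nearLattice at h
  rw [Fintype.mem_piFinset] at h
  push Not at h
  obtain ⟨i, hi⟩ := h
  exact Finset.prod_eq_zero (Finset.mem_univ i) (tent_sub_eq_zero hi)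

lemma sum_psi {j : ℕ} {x : Base n} {M : Finset (Fin n → ℤ)} (hM : nearLattice j x ⊆ M) :
    ∑ m ∈ M, psi j m x = 1 := by
  rw [← Finset.sum_subset hM fun m _ hm => psi_eq_zero_of_notMem hm]
  unfold psi nearLattice
  rw [← Finset.prod_univ_sum (fun i => ({⌊2 ^ j * x i⌋, ⌊2 ^ j * x i⌋ + 1} : Finset ℤ))
    (fun i k => tent (2 ^ j * x i - k))]
  exact Finset.prod_eq_one fun i _ => sum_tent _

/-- A cut-off in the vertical direction. -/
noncomputable def cut (j : ℕ) (t : ℝ) : ℝ := Real.smoothTransition (2 - 2 ^ (j + 1) * t)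

lemma cut_eq_one {j : ℕ} {t : ℝ} (h : t ≤ 1 / 2 ^ (j + 1)) : cut j t = 1 := by
  apply Real.smoothTransition.one_of_one_le
  rw [le_div_iff₀ (by positivity)] at h
  linarith

lemma cut_eq_zero {j : ℕ} {t : ℝ} (h : 1 / 2 ^ j ≤ t) : cut j t = 0 := by
  apply Real.smoothTransition.zero_of_nonpos
  rw [div_le_iff₀ (by positivity)] at h
  rw [pow_succ]
  linarith

/-- The smooth building blocks of the extension operator. -/
noncomputable def bump (i : ℕ × (Fin n → ℤ) × (Fin n → ℤ)) (z : Space n) : ℝ :=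
  psi (i.1 + 1) i.2.1 z.1 * psi i.1 i.2.2 z.1 * cut (i.1 + 1) z.2

/-- The lattice points `m` of scale `j + 1` and `m'` of scale `j` are adjacent. -/
def Adj (m m' : Fin n → ℤ) : Prop := ∀ l, |m l - 2 * m' l| ≤ 1

/-- The supports give `|m - 2m'| < 2/3 + 2 · 2/3 = 2`, hence at most `1` for integers. This is where
the support radius `2/3` matters. -/
lemma adj_of_bump_ne_zero {i : ℕ × (Fin n → ℤ) × (Fin n → ℤ)} {z : Space n} (h : bump i z ≠ 0) :
    Adj i.2.1 i.2.2 := by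
  intro l
  have h1 := psi_ne_zero (left_ne_zero_of_mul (left_ne_zero_of_mul h)) l
  have h2 := psi_ne_zero (right_ne_zero_of_mul (left_ne_zero_of_mul h)) l
  rw [pow_succ] at h1
  rw [abs_lt] at h1 h2
  have h3 : ((i.2.1 l - 2 * i.2.2 l : ℤ) : ℝ) < (2 : ℤ) := by push_cast; linarith [h1.1, h2.2]
  have h4 : ((-2 : ℤ) : ℝ) < (i.2.1 l - 2 * i.2.2 l : ℤ) := by push_cast; linarith [h1.2, h2.1]
  rw [abs_le]
  have h3' := Int.cast_lt.1 h3
  have h4' := Int.cast_lt.1 h4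
  omega

/-- A region containing the support of the building blocks. -/
def bumpRegion (j : ℕ) (m : Fin n → ℤ) : Set (Space n) :=
  {z | (∀ i, |2 ^ j * z.1 i - m i| ≤ 2 / 3) ∧ z.2 ≤ 1 / 2 ^ j}

lemma isClosed_bumpRegion (j : ℕ) (m : Fin n → ℤ) : IsClosed (bumpRegion j m) := by
  have : bumpRegion j m = (⋂ i, {z : Space n | |2 ^ j * z.1 i - m i| ≤ 2 / 3}) ∩
      {z | z.2 ≤ 1 / 2 ^ j} := by
    ext z; simp [bumpRegion]
  rw [this]
  refine (isClosed_iInter fun i => isClosed_le ?_ continuous_const).inter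
    (isClosed_le continuous_snd continuous_const)
  fun_prop

lemma support_bump_subset (i : ℕ × (Fin n → ℤ) × (Fin n → ℤ)) :
    Function.support (bump i) ⊆ bumpRegion (i.1 + 1) i.2.1 := by
  intro z hz
  refine ⟨fun l => (psi_ne_zero (left_ne_zero_of_mul (left_ne_zero_of_mul hz)) l).le, ?_⟩
  by_contra! h
  exact hz (by rw [bump, cut_eq_zero h.le, mul_zero])

lemma support_fderiv_bump_subset (i : ℕ × (Fin n → ℤ) × (Fin n → ℤ)) :
    Function.support (fderiv ℝ (bump i)) ⊆ bumpRegion (i.1 + 1) i.2.1 :=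
  (support_fderiv_subset ℝ).trans
    (closure_minimal (support_bump_subset i) (isClosed_bumpRegion _ _))

lemma bump_eq_zero_of_not_adj {i : ℕ × (Fin n → ℤ) × (Fin n → ℤ)} (h : ¬ Adj i.2.1 i.2.2) :
    bump i = fun _ => 0 := by
  ext z
  by_contra hz
  exact h (adj_of_bump_ne_zero hz)

/-! ### Uniform bounds and local finiteness of the building blocks -/

/-- `g` is continuously differentiable, bounded by one, with gradient bounded by `D`. -/
structure IsUnitBump (g : Space n → ℝ) (D : ℝ) : Prop where
  contDiff : ContDiff ℝ 1 g
  abs_le : ∀ z, |g z| ≤ 1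
  norm_fderiv_le : ∀ z, ‖fderiv ℝ g z‖ ≤ D

lemma IsUnitBump.mul {g h : Space n → ℝ} {D E : ℝ} (hg : IsUnitBump g D) (hh : IsUnitBump h E) :
    IsUnitBump (fun z => g z * h z) (D + E) where
  contDiff := hg.contDiff.mul hh.contDiff
  abs_le z := by
    rw [abs_mul]
    exact mul_le_one₀ (hg.abs_le z) (abs_nonneg _) (hh.abs_le z)
  norm_fderiv_le z := by
    rw [fderiv_fun_mul (hg.contDiff.differentiable (by norm_num) z)
      (hh.contDiff.differentiable (by norm_num) z)]
    refine (norm_add_le _ _).trans ?_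
    rw [norm_smul, norm_smul, add_comm]
    refine add_le_add ?_ ?_
    · calc _ ≤ 1 * D := mul_le_mul (hh.abs_le z) (hg.norm_fderiv_le z) (norm_nonneg _) zero_le_one
        _ = D := one_mul _
    · calc _ ≤ 1 * E := mul_le_mul (hg.abs_le z) (hh.norm_fderiv_le z) (norm_nonneg _) zero_le_one
        _ = E := one_mul _

lemma IsUnitBump.prod {κ : Type*} (T : Finset κ) {g : κ → Space n → ℝ} {D : ℝ}
    (hg : ∀ k ∈ T, IsUnitBump (g k) D) : IsUnitBump (fun z => ∏ k ∈ T, g k z) (T.card * D) := by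
  classical
  induction T using Finset.induction_on with
  | empty => exact ⟨by simpa using contDiff_const, by simp, by simp⟩
  | insert k T hk ih =>
    have := (hg k (Finset.mem_insert_self _ _)).mul
      (ih fun l hl => hg l (Finset.mem_insert_of_mem hl))
    simp only [Finset.prod_insert hk, Finset.card_insert_of_notMem hk]
    push_cast
    rw [show ((T.card : ℝ) + 1) * D = D + T.card * D by ring]
    exact this

lemma isUnitBump_comp {G : ℝ → ℝ} {L : ℝ} (hG : ContDiff ℝ 1 G) (h1 : ∀ u, |G u| ≤ 1)
    (hL : ∀ u, |deriv G u| ≤ L) (ℓ : Space n →L[ℝ] ℝ) (hℓ : ‖ℓ‖ ≤ 1) (c d : ℝ) :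
    IsUnitBump (fun z => G (c * ℓ z + d)) (L * |c|) where
  contDiff := hG.comp ((contDiff_const.mul ℓ.contDiff).add contDiff_const)
  abs_le z := h1 _
  norm_fderiv_le z := by
    have h := ((hG.differentiable (by norm_num) (c * ℓ z + d)).hasDerivAt).comp_hasFDerivAt z
      ((ℓ.hasFDerivAt.const_mul c).add_const d)
    have e : fderiv ℝ (fun z => G (c * ℓ z + d)) z = deriv G (c * ℓ z + d) • c • ℓ := h.fderiv
    rw [e, norm_smul, norm_smul]
    have hL0 : 0 ≤ L := (abs_nonneg _).trans (hL 0)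
    calc _ ≤ L * (|c| * 1) := by
          refine mul_le_mul (hL _) ?_ (by positivity) hL0
          exact mul_le_mul_of_nonneg_left hℓ (abs_nonneg c)
      _ = _ := by rw [mul_one]

lemma exists_deriv_smoothTransition_le : ∃ L : ℝ, ∀ u, |deriv Real.smoothTransition u| ≤ L := by
  have hc : Continuous (deriv Real.smoothTransition) :=
    (Real.smoothTransition.contDiff (n := 1)).continuous_deriv (by norm_num)
  have hs : HasCompactSupport (deriv Real.smoothTransition) := by
    refine HasCompactSupport.of_support_subset_isCompact (K := Icc 0 1) isCompact_Icc ?_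
    intro u hu
    by_contra h
    apply hu
    rw [mem_Icc, not_and_or, not_le, not_le] at h
    rcases h with h | h
    · have : Real.smoothTransition =ᶠ[𝓝 u] fun _ => 0 := by
        filter_upwards [gt_mem_nhds h] with w hw
        exact Real.smoothTransition.zero_of_nonpos hw.le
      rw [this.deriv_eq]; simp
    · have : Real.smoothTransition =ᶠ[𝓝 u] fun _ => 1 := by
        filter_upwards [lt_mem_nhds h] with w hw
        exact Real.smoothTransition.one_of_one_le hw.le
      rw [this.deriv_eq]; simp
  obtain ⟨L, hL⟩ := hc.bounded_above_of_compact_support hs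
  exact ⟨L, fun u => by simpa using hL u⟩

lemma exists_deriv_tent_le : ∃ L : ℝ, ∀ u, |deriv tent u| ≤ L := by
  obtain ⟨L, hL⟩ := exists_deriv_smoothTransition_le
  refine ⟨6 * L, fun u => ?_⟩
  have hd : Differentiable ℝ Real.smoothTransition :=
    (Real.smoothTransition.contDiff (n := 1)).differentiable (by norm_num)
  have h1 : HasDerivAt (fun u => Real.smoothTransition (3 * u + 2))
      (deriv Real.smoothTransition (3 * u + 2) * (3 * 1)) u :=
    (hd _).hasDerivAt.comp u (((hasDerivAt_id u).const_mul 3).add_const 2)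
  have h2 : HasDerivAt (fun u => Real.smoothTransition (3 * u - 1))
      (deriv Real.smoothTransition (3 * u - 1) * (3 * 1)) u :=
    (hd _).hasDerivAt.comp u (((hasDerivAt_id u).const_mul 3).sub_const 1)
  have h3 : deriv tent u = _ := (h1.sub h2).deriv
  rw [h3]
  have a := abs_le.1 (hL (3 * u + 2))
  have b := abs_le.1 (hL (3 * u - 1))
  rw [abs_le]
  constructor <;> linarith [a.1, a.2, b.1, b.2]

/-- A coordinate of the base as a functional on the whole space. -/
noncomputable def coordFunctional (i : Fin n) : Space n →L[ℝ] ℝ :=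
  (ContinuousLinearMap.proj i).comp (ContinuousLinearMap.fst ℝ (Base n) ℝ)

lemma norm_coordFunctional_le (i : Fin n) : ‖coordFunctional i‖ ≤ 1 := by
  refine ContinuousLinearMap.opNorm_le_bound _ zero_le_one fun z => ?_
  rw [one_mul]
  exact (norm_le_pi_norm z.1 i).trans (norm_fst_le z)

lemma exists_bump_bound (n : ℕ) : ∃ B : ℝ, 1 ≤ B ∧
    ∀ i : ℕ × (Fin n → ℤ) × (Fin n → ℤ), IsUnitBump (bump i) (B * 2 ^ (i.1 + 1)) := by
  obtain ⟨L, hL⟩ := exists_deriv_smoothTransition_le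
  obtain ⟨L', hL'⟩ := exists_deriv_tent_le
  have hL0 : 0 ≤ L := (abs_nonneg _).trans (hL 0)
  have hL0' : 0 ≤ L' := (abs_nonneg _).trans (hL' 0)
  -- In units of `2^(i.1 + 1)`, the two horizontal factors contribute `n L'` and `n L' / 2` to the
  -- gradient and the cut-off contributes `2 L`; the last `1` ensures `1 ≤ B`.
  refine ⟨2 * (n * L') + 2 * L + 1, by nlinarith [mul_nonneg (Nat.cast_nonneg (α := ℝ) n) hL0'],
    fun i => ?_⟩
  have hpsi : ∀ (j : ℕ) (m : Fin n → ℤ),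
      IsUnitBump (fun z : Space n => psi j m z.1) (n * (L' * 2 ^ j)) := by
    intro j m
    have := IsUnitBump.prod (n := n) (Finset.univ : Finset (Fin n)) (D := L' * 2 ^ j)
      (g := fun i z => tent (2 ^ j * z.1 i - m i)) (fun i _ => by
        have := isUnitBump_comp contDiff_tent
          (fun u => by rw [abs_of_nonneg (tent_nonneg u)]; exact tent_le_one u) hL'
          (coordFunctional i) (norm_coordFunctional_le i) (2 ^ j) (-(m i : ℝ))
        rw [abs_of_nonneg (by positivity)] at this
        simpa [coordFunctional, sub_eq_add_neg] using this)
    simpa [psi] using this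
  have hcut : IsUnitBump (fun z : Space n => cut (i.1 + 1) z.2) (L * 2 ^ (i.1 + 1 + 1)) := by
    have := isUnitBump_comp (n := n) Real.smoothTransition.contDiff
      (fun u => by
        rw [abs_of_nonneg (Real.smoothTransition.nonneg u)]
        exact Real.smoothTransition.le_one u) hL
      (ContinuousLinearMap.snd ℝ (Base n) ℝ) (ContinuousLinearMap.norm_snd_le _ _ _)
      (-(2 ^ (i.1 + 1 + 1))) 2
    rw [abs_neg, abs_of_nonneg (by positivity)] at this
    simpa [cut, sub_eq_add_neg, add_comm] using this
  have h := ((hpsi (i.1 + 1) i.2.1).mul (hpsi i.1 i.2.2)).mul hcut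
  refine ⟨h.contDiff, h.abs_le, fun z => (h.norm_fderiv_le z).trans ?_⟩
  have e : (2 : ℝ) ^ (i.1 + 1) = 2 * 2 ^ i.1 := by rw [pow_succ]; ring
  have e' : (2 : ℝ) ^ (i.1 + 1 + 1) = 4 * 2 ^ i.1 := by rw [pow_succ, pow_succ]; ring
  rw [e, e']
  have hp : (0 : ℝ) < 2 ^ i.1 := by positivity
  have h2 : 0 ≤ n * L' * 2 ^ i.1 := by positivity
  nlinarith

/-- At positive height the cut-offs of fine scale vanish, and at each remaining scale only finitely
many lattice points are near. -/
lemma locFinite_bump : LocFinite (bump (n := n)) := by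
  rintro ⟨x, t⟩ ht
  simp only [upperHalf, mem_ofPred_eq] at ht
  obtain ⟨N, hN⟩ := pow_unbounded_of_one_lt (2 / t) (one_lt_two)
  obtain ⟨M, hM⟩ := exists_nat_gt (2 ^ N * (‖x‖ + 1) + 1)
  have hMbound : ∀ j ≤ N, ∀ w : Base n, ‖w - x‖ < 1 → ∀ m : Fin n → ℤ, psi j m w ≠ 0 →
      m ∈ Fintype.piFinset fun _ : Fin n => Finset.Icc (-(M : ℤ)) M := by
    intro j hj w hw m hm
    rw [Fintype.mem_piFinset]
    intro l
    have h1 := abs_lt.1 (psi_ne_zero hm l)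
    have h2 : |w l| ≤ ‖x‖ + 1 := by
      have := norm_le_pi_norm w l
      rw [Real.norm_eq_abs] at this
      have h3 : ‖w‖ ≤ ‖x‖ + ‖w - x‖ := by
        calc ‖w‖ = ‖x + (w - x)‖ := by rw [add_sub_cancel]
          _ ≤ _ := norm_add_le _ _
      linarith
    have h3 : |2 ^ j * w l| ≤ 2 ^ N * (‖x‖ + 1) := by
      rw [abs_mul, abs_of_nonneg (by positivity)]
      gcongr
      norm_num
    have h4 := abs_le.1 h3
    have h5 : (-(M : ℤ) : ℝ) ≤ m l := by push_cast; linarith [h1.1, h1.2]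
    have h6 : (m l : ℝ) ≤ M := by linarith [h1.1, h1.2]
    rw [Finset.mem_Icc]
    exact ⟨by exact_mod_cast h5, by exact_mod_cast h6⟩
  refine ⟨{w | ‖w.1 - x‖ < 1 ∧ t / 2 < w.2}, ?_,
    Finset.range N ×ˢ (Fintype.piFinset fun _ : Fin n => Finset.Icc (-(M : ℤ)) M) ×ˢ
      (Fintype.piFinset fun _ : Fin n => Finset.Icc (-(M : ℤ)) M), ?_⟩
  · refine IsOpen.mem_nhds ?_ ⟨by simp, by simp; linarith⟩
    exact (isOpen_lt (f := fun w : Space n => ‖w.1 - x‖) (by fun_prop) continuous_const).inter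
      (isOpen_lt continuous_const continuous_snd)
  · rintro i hi w ⟨hw1, hw2⟩
    by_contra h
    have hj : i.1 < N := by
      by_contra! hj
      refine h ?_
      rw [bump, cut_eq_zero, mul_zero]
      refine le_trans ?_ hw2.le
      rw [div_le_div_iff₀ (by positivity) (by norm_num)]
      have : 2 / t < 2 ^ (i.1 + 1) :=
        hN.trans_le (pow_le_pow_right₀ (by norm_num) (by omega))
      rw [div_lt_iff₀ ht] at this
      linarith
    apply hi
    rw [Finset.mem_product, Finset.mem_product, Finset.mem_range]
    exact ⟨hj, hMbound _ (by omega) w.1 hw1 _ (left_ne_zero_of_mul (left_ne_zero_of_mul h)),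
      hMbound _ (by omega) w.1 hw1 _ (right_ne_zero_of_mul (left_ne_zero_of_mul h))⟩

/-! ### The telescoping extension operator -/

/-- The extension to the upper half-space of a family `F` of values at the lattice points. -/
noncomputable def latticeExtension (F : ℕ → (Fin n → ℤ) → ℝ) (z : Space n) : ℝ :=
  ∑' i : ℕ × (Fin n → ℤ) × (Fin n → ℤ), (F (i.1 + 1) i.2.1 - F i.1 i.2.2) * bump i z

/-- This explains the product form of `bump`: since each of the two partitions sums to one,
multiplying by the other rewrites the difference of two interpolants as a combination of differences
of values. -/
lemma sum_mul_psi_sub {M : Finset (Fin n → ℤ)} {x : Base n} {j : ℕ}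
    (h : nearLattice j x ⊆ M) (h' : nearLattice (j + 1) x ⊆ M) (F : ℕ → (Fin n → ℤ) → ℝ) (t : ℝ) :
    ∑ m ∈ M, ∑ m' ∈ M, (F (j + 1) m - F j m') * bump (j, m, m') (x, t)
      = cut (j + 1) t * (∑ m ∈ M, psi (j + 1) m x * F (j + 1) m - ∑ m ∈ M, psi j m x * F j m) := by
  have e1 : ∑ m ∈ M, psi (j + 1) m x * F (j + 1) m
      = ∑ m ∈ M, ∑ m' ∈ M, psi (j + 1) m x * F (j + 1) m * psi j m' x := by
    simp_rw [← Finset.mul_sum, sum_psi h, mul_one]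
  have e2 : ∑ m ∈ M, psi j m x * F j m
      = ∑ m ∈ M, ∑ m' ∈ M, psi (j + 1) m x * (psi j m' x * F j m') := by
    simp_rw [← Finset.mul_sum, ← Finset.sum_mul, sum_psi h', one_mul]
  rw [e1, e2, ← Finset.sum_sub_distrib, Finset.mul_sum]
  refine Finset.sum_congr rfl fun m _ => ?_
  rw [← Finset.sum_sub_distrib, Finset.mul_sum]
  refine Finset.sum_congr rfl fun m' _ => ?_
  simp only [bump]
  ring

/-- Close to the boundary, the extension is a convex combination of values of high scale. -/
lemma enorm_sub_latticeExtension_le {F : ℕ → (Fin n → ℤ) → ℝ} (hF : ∀ m, F 0 m = 0) {J : ℕ}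
    {x : Base n} {t y : ℝ} {R : ℝ≥0∞} (ht : 0 < t) (ht' : t < 1 / 2 ^ (J + 1))
    (h : ∀ j, J ≤ j → ∀ m, psi j m x ≠ 0 → ‖y - F j m‖ₑ ≤ R) :
    ‖y - latticeExtension F (x, t)‖ₑ ≤ R := by
  classical
  -- At this height the cut-off is one for the differences with `j < P` and zero for those with `j >
  -- P`; only the difference with `j = P` is partially present.
  obtain ⟨P, hJP, hP1, hP2⟩ : ∃ P : ℕ, J ≤ P ∧ 1 / 2 ^ (P + 2) < t ∧ t ≤ 1 / 2 ^ (P + 1) := by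
    have h1 : t ≤ 1 := ht'.le.trans (by
      rw [div_le_one (by positivity)]; exact one_le_pow₀ (by norm_num))
    obtain ⟨Q, h2, h3⟩ := exists_nat_pow_near_of_lt_one ht h1
      (show (0 : ℝ) < 1 / 2 by norm_num) (by norm_num)
    rw [one_div_pow] at h2 h3
    have h4 : J + 1 < Q + 1 := by
      have := h2.trans ht'
      rw [one_div_lt_one_div (by positivity) (by positivity)] at this
      exact (pow_lt_pow_iff_right₀ one_lt_two).1 this
    obtain ⟨P, rfl⟩ : ∃ P, Q = P + 1 := ⟨Q - 1, by omega⟩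
    exact ⟨P, by omega, h2, h3⟩
  set M : Finset (Fin n → ℤ) := (Finset.range (P + 2)).biUnion fun j => nearLattice j x with hM
  have hMj : ∀ j ≤ P + 1, nearLattice j x ⊆ M := fun j hj =>
    Finset.subset_biUnion_of_mem (fun j => nearLattice j x) (Finset.mem_range.2 (by omega))
  set G : ℕ → ℝ := fun j => ∑ m ∈ M, psi j m x * F j m with hG
  have hf : latticeExtension F (x, t) = G P + cut (P + 1) t * (G (P + 1) - G P) := by
    have h1 : latticeExtension F (x, t) = ∑ j ∈ Finset.range (P + 1),
        ∑ m ∈ M, ∑ m' ∈ M, (F (j + 1) m - F j m') * bump (j, m, m') (x, t) := by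
      rw [latticeExtension, tsum_eq_sum (s := Finset.range (P + 1) ×ˢ M ×ˢ M)]
      · simp only [Finset.sum_product]
      · rintro ⟨j, m, m'⟩ hi
        simp only [Finset.mem_product, Finset.mem_range, not_and_or, not_lt] at hi
        simp only [bump]
        by_cases hj : P + 1 ≤ j
        · rw [cut_eq_zero]
          · ring
          · refine le_trans ?_ hP1.le
            rw [one_div_le_one_div (by positivity) (by positivity)]
            exact pow_le_pow_right₀ one_le_two (by omega)
        · rcases hi with hi | hi | hi
          · exact absurd hi hj
          · rw [psi_eq_zero_of_notMem (fun h => hi (hMj _ (by omega) h))]; ring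
          · rw [psi_eq_zero_of_notMem (j := j) (fun h => hi (hMj _ (by omega) h))]; ring
    rw [h1, Finset.sum_congr rfl fun j hj => sum_mul_psi_sub
      (hMj j (by have := Finset.mem_range.1 hj; omega))
      (hMj (j + 1) (by have := Finset.mem_range.1 hj; omega)) F t, Finset.sum_range_succ]
    congr 1
    -- The full differences telescope to `G P - G 0`, and `G 0 = 0` since `F` vanishes at scale
    -- zero.
    rw [Finset.sum_congr rfl fun j hj => by
      rw [cut_eq_one (j := j + 1) (t := t) (hP2.trans (by
        rw [one_div_le_one_div (by positivity) (by positivity)]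
        exact pow_le_pow_right₀ one_le_two (by have := Finset.mem_range.1 hj; omega))), one_mul],
      Finset.sum_range_sub G P]
    simp [hG, hF]
  have hR : ∀ j, J ≤ j → j ≤ P + 1 → ‖y - G j‖ₑ ≤ R := by
    intro j hj hj'
    have e : y - G j = ∑ m ∈ M, psi j m x * (y - F j m) := by
      simp_rw [mul_sub, Finset.sum_sub_distrib, ← Finset.sum_mul, sum_psi (hMj j hj'), one_mul, hG]
    rw [e]
    calc _ ≤ ∑ m ∈ M, ‖psi j m x * (y - F j m)‖ₑ := enorm_sum_le _ _
      _ ≤ ∑ m ∈ M, ENNReal.ofReal (psi j m x) * R := by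
        refine Finset.sum_le_sum fun m _ => ?_
        rw [enorm_mul, Real.enorm_of_nonneg (psi_nonneg _ _ _)]
        by_cases h0 : psi j m x = 0
        · simp [h0]
        · gcongr; exact h j hj m h0
      _ = R := by
        rw [← Finset.sum_mul, ← ENNReal.ofReal_sum_of_nonneg fun m _ => psi_nonneg _ _ _,
          sum_psi (hMj j hj'), ENNReal.ofReal_one, one_mul]
  have hc0 : 0 ≤ cut (P + 1) t := Real.smoothTransition.nonneg _
  have hc1 : 0 ≤ 1 - cut (P + 1) t := sub_nonneg.2 (Real.smoothTransition.le_one _)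
  rw [hf, show y - (G P + cut (P + 1) t * (G (P + 1) - G P))
    = (1 - cut (P + 1) t) * (y - G P) + cut (P + 1) t * (y - G (P + 1)) by ring]
  calc _ ≤ ‖(1 - cut (P + 1) t) * (y - G P)‖ₑ + ‖cut (P + 1) t * (y - G (P + 1))‖ₑ :=
        enorm_add_le _ _
    _ ≤ ENNReal.ofReal (1 - cut (P + 1) t) * R + ENNReal.ofReal (cut (P + 1) t) * R := by
        rw [enorm_mul, enorm_mul, Real.enorm_of_nonneg hc0, Real.enorm_of_nonneg hc1]
        gcongr
        · exact hR P hJP (by omega)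
        · exact hR (P + 1) (by omega) le_rfl
    _ = R := by
        rw [← add_mul, ← ENNReal.ofReal_add hc1 hc0, sub_add_cancel, ENNReal.ofReal_one, one_mul]

lemma contDiffAt_latticeExtension (F : ℕ → (Fin n → ℤ) → ℝ) {z : Space n}
    (hz : z ∈ upperHalf n) : ContDiffAt ℝ 1 (latticeExtension F) z := by
  obtain ⟨B, -, hB⟩ := exists_bump_bound n
  exact locFinite_bump.contDiffAt (fun i => (hB i).contDiff) _ hz

open Classical in
/-- The weighted Sobolev norm of the extension is controlled by the differences of values at
adjacent lattice points. -/
lemma exists_sobolevNorm_latticeExtension_le (n : ℕ) : ∃ B : ℝ≥0∞, B ≠ ⊤ ∧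
    ∀ (F : ℕ → (Fin n → ℤ) → ℝ) (γ : Space n → ℝ), AEMeasurable γ →
      sobolevNorm (upperHalf n) γ (latticeExtension F) ≤
        B * ∑' i : ℕ × (Fin n → ℤ) × (Fin n → ℤ), if Adj i.2.1 i.2.2 then
          ‖F (i.1 + 1) i.2.1 - F i.1 i.2.2‖ₑ * (2 ^ (i.1 + 1) *
            ∫⁻ z in upperHalf n ∩ bumpRegion (i.1 + 1) i.2.1, ‖γ z‖ₑ) else 0 := by
  obtain ⟨B, hB1, hB⟩ := exists_bump_bound n
  refine ⟨(n + 2) * ENNReal.ofReal B, by finiteness, fun F γ hγ => ?_⟩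
  have hΩ := (isOpen_upperHalf n).measurableSet
  -- One bound serves the block and its derivatives, because `1 ≤ B * 2 ^ (i.1 + 1)`.
  have key : ∀ (i : ℕ × (Fin n → ℤ) × (Fin n → ℤ)) (g : Space n → ℝ),
      Function.support g ⊆ bumpRegion (i.1 + 1) i.2.1 → (¬ Adj i.2.1 i.2.2 → ∀ z, g z = 0) →
      (∀ z, |g z| ≤ B * 2 ^ (i.1 + 1)) →
      ∫⁻ z in upperHalf n, ‖γ z * g z‖ₑ ≤ if Adj i.2.1 i.2.2 then ENNReal.ofReal B *
        (2 ^ (i.1 + 1) * ∫⁻ z in upperHalf n ∩ bumpRegion (i.1 + 1) i.2.1, ‖γ z‖ₑ) else 0 := by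
    intro i g hs h0 hg
    split_ifs with hadj
    · have hm := (isClosed_bumpRegion (n := n) (i.1 + 1) i.2.1).measurableSet
      calc ∫⁻ z in upperHalf n, ‖γ z * g z‖ₑ
          ≤ ∫⁻ z in upperHalf n, (bumpRegion (i.1 + 1) i.2.1).indicator
              (fun z => ENNReal.ofReal (B * 2 ^ (i.1 + 1)) * ‖γ z‖ₑ) z := by
            refine lintegral_mono fun z => ?_
            by_cases hz : z ∈ bumpRegion (i.1 + 1) i.2.1
            · rw [indicator_of_mem hz, enorm_mul, mul_comm]
              gcongr
              rw [← ofReal_norm]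
              exact ENNReal.ofReal_le_ofReal (hg z)
            · have : g z = 0 := by
                by_contra h; exact hz (hs h)
              simp [this]
        _ = ∫⁻ z in upperHalf n ∩ bumpRegion (i.1 + 1) i.2.1,
              ENNReal.ofReal (B * 2 ^ (i.1 + 1)) * ‖γ z‖ₑ := by
            rw [lintegral_indicator hm, Measure.restrict_restrict hm, inter_comm]
        _ = _ := by
            rw [lintegral_const_mul' _ _ ENNReal.ofReal_ne_top,
              ENNReal.ofReal_mul (by linarith), ENNReal.ofReal_pow (by norm_num),
              ENNReal.ofReal_ofNat, mul_assoc]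
    · simp [h0 hadj]
  have hpow : ∀ j : ℕ, (1 : ℝ) ≤ B * 2 ^ j := fun j =>
    one_le_mul_of_one_le_of_one_le hB1 (one_le_pow₀ one_le_two)
  refine (sobolevNorm_tsum_le locFinite_bump (fun i => (hB i).contDiff) _ hγ
    (D := fun i => if Adj i.2.1 i.2.2 then ENNReal.ofReal B * (2 ^ (i.1 + 1) *
      ∫⁻ z in upperHalf n ∩ bumpRegion (i.1 + 1) i.2.1, ‖γ z‖ₑ) else 0)
    (fun i => key i (bump i) (support_bump_subset i)
      (fun h z => by rw [bump_eq_zero_of_not_adj h]) (fun z => ((hB i).abs_le z).trans (hpow _)))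
    (fun i v hv => key i _ ?_ ?_ ?_)).trans ?_
  · intro z hz
    refine support_fderiv_bump_subset i fun h => hz ?_
    simp [h]
  · intro h z
    rw [bump_eq_zero_of_not_adj h]; simp
  · intro z
    calc |fderiv ℝ (bump i) z v| ≤ ‖fderiv ℝ (bump i) z‖ * ‖v‖ :=
          (fderiv ℝ (bump i) z).le_opNorm v
      _ ≤ B * 2 ^ (i.1 + 1) * 1 :=
          mul_le_mul ((hB i).norm_fderiv_le z) hv (norm_nonneg _) (by linarith [hpow (i.1 + 1)])
      _ = _ := mul_one _
  · rw [mul_assoc]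
    refine mul_le_mul' le_rfl ?_
    rw [← ENNReal.tsum_mul_left]
    refine ENNReal.tsum_le_tsum fun i => ?_
    split_ifs
    · exact le_of_eq (by ring)
    · simp

/-! ### Selection of a cube for each lattice point -/

/-- Pairs `(s, β)`, where `β` is a cube of the reduced `s`-th family whose dilation contains the
lattice point `2⁻ʲ m` and whose size is large compared with `2⁻ʲ`. -/
def candidates (k₀ : ℕ) (A' : ℕ → Set (Index n)) (j : ℕ) (m : Fin n → ℤ) : Set (ℕ × Index n) :=
  {b | b.2 ∈ A' b.1 ∧ pt j m ∈ dil k₀ b.2 ∧ b.2.1 + (k₀ + 2) ≤ j}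

/-- Cubes of later levels are preferred; within a level the enumeration decides. -/
def Preferred (b b' : ℕ × Index n) : Prop :=
  b'.1 < b.1 ∨ (b'.1 = b.1 ∧ Encodable.encode b.2 < Encodable.encode b'.2)

lemma Preferred.asymm {b b' : ℕ × Index n} (h : Preferred b b') : ¬ Preferred b' b := by
  unfold Preferred at *
  omega

/-- The preferred candidate. -/
noncomputable def sel (k₀ : ℕ) (A' : ℕ → Set (Index n)) (j : ℕ) (m : Fin n → ℤ) : ℕ × Index n :=
  Classical.epsilon fun b =>
    b ∈ candidates k₀ A' j m ∧ ∀ b' ∈ candidates k₀ A' j m, b' ≠ b → Preferred b b'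

/-- A lattice point in a dilated cube that is much larger than the lattice spacing keeps a
lattice step from the boundary. -/
lemma lo_add_le_pt {k₀ j : ℕ} {m : Fin n → ℤ} {α : Index n} (h : pt j m ∈ dil k₀ α)
    (hj : α.1 + (k₀ + 2) ≤ j) (i : Fin n) :
    lo k₀ α i + 1 / 2 ^ j ≤ pt j m i ∧ pt j m i + 1 / 2 ^ j ≤ hi k₀ α i := by
  have := mem_dil.1 h i
  exact ⟨grid_gap (by omega) le_rfl this.1, grid_gap le_rfl (by omega) this.2⟩

lemma mem_dil_of_near {k₀ j : ℕ} {m : Fin n → ℤ} {α : Index n} (h : pt j m ∈ dil k₀ α)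
    (hj : α.1 + (k₀ + 2) ≤ j) {x : Base n} (hx : ∀ i, |2 ^ j * x i - m i| < 1) : x ∈ dil k₀ α := by
  rw [mem_dil]
  intro i
  have h1 := lo_add_le_pt h hj i
  have h2 := abs_lt.1 (hx i)
  have hp : (0 : ℝ) < 2 ^ j := by positivity
  have e : 2 ^ j * pt j m i = m i := by unfold pt; field_simp
  have e' : (2 : ℝ) ^ j * (1 / 2 ^ j) = 1 := by field_simp
  constructor
  · refine lt_of_mul_lt_mul_left (a := (2 : ℝ) ^ j) ?_ hp.le
    nlinarith [mul_le_mul_of_nonneg_left h1.1 hp.le]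
  · refine lt_of_mul_lt_mul_left (a := (2 : ℝ) ^ j) ?_ hp.le
    nlinarith [mul_le_mul_of_nonneg_left h1.2 hp.le]

lemma Adj.pt_sub {m m' : Fin n → ℤ} (h : Adj m m') (j : ℕ) (i : Fin n) :
    |pt (j + 1) m i - pt j m' i| ≤ 1 / 2 ^ (j + 1) := by
  have e : pt (j + 1) m i - pt j m' i = ((m i - 2 * m' i : ℤ) : ℝ) / 2 ^ (j + 1) := by
    unfold pt; push_cast; rw [pow_succ]; field_simp
  rw [e, abs_div, abs_of_pos (show (0 : ℝ) < 2 ^ (j + 1) by positivity)]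
  gcongr
  exact_mod_cast h i

/-- Moving slightly from `z'` towards `z` enters the open convex cube `α` without leaving the open
cube `β`. -/
lemma exists_mem_inter_dil {k₀ : ℕ} {α β : Index n} {z z' : Base n} (hz : z ∈ dil k₀ α)
    (hz' : ∀ i, lo k₀ α i ≤ z' i ∧ z' i ≤ hi k₀ α i) (hβ : z' ∈ dil k₀ β) :
    ∃ y, y ∈ dil k₀ α ∧ y ∈ dil k₀ β := by
  have hc : Continuous fun ε : ℝ => z' + ε • (z - z') := by fun_prop
  have h0 : ∀ᶠ ε in 𝓝[>] (0 : ℝ), z' + ε • (z - z') ∈ dil k₀ β := by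
    refine (hc.tendsto 0).mono_left nhdsWithin_le_nhds ?_
    exact (isOpen_dil k₀ β).mem_nhds (by simpa using hβ)
  have h1 : ∀ᶠ ε in 𝓝[>] (0 : ℝ), ε < 1 := nhdsWithin_le_nhds (gt_mem_nhds one_pos)
  obtain ⟨ε, hε, hε1, hε0⟩ := (h0.and (h1.and self_mem_nhdsWithin)).exists
  refine ⟨_, ?_, hε⟩
  have hε0 : 0 < ε := hε0
  rw [mem_dil] at hz ⊢
  intro i
  have a := hz i
  have b := hz' i
  simp only [Pi.add_apply, Pi.smul_apply, Pi.sub_apply, smul_eq_mul]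
  constructor <;> nlinarith

section

variable {k₀ : ℕ} {γ : Space n → ℝ} {c₁ c₂ : ℝ} {A A' : ℕ → Set (Index n)}

lemma IsReduction.exists_mem_dil {A A' : Set (Index n)}
    (h : IsReduction (1 + ((2 : ℝ) ^ k₀)⁻¹) A A') (x : Base n) : ∃ β ∈ A', x ∈ dil k₀ β := by
  have := h.cover ▸ mem_univ x
  simpa only [mem_iUnion, exists_prop] using this

/-- Candidates exist because a level-zero cube has rank zero, which is where `k₀ + 2 ≤ j` is needed.
Their levels are bounded by their ranks, hence by `j`, so a last level exists, and in it a first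
element of the enumeration. -/
lemma sel_spec (hA : IsAdmissible (1 + ((2 : ℝ) ^ k₀)⁻¹) γ c₁ c₂ A)
    (hA' : ∀ s, IsReduction (1 + ((2 : ℝ) ^ k₀)⁻¹) (A s) (A' s)) {j : ℕ} (hj : k₀ + 2 ≤ j)
    (m : Fin n → ℤ) :
    sel k₀ A' j m ∈ candidates k₀ A' j m ∧
      ∀ b' ∈ candidates k₀ A' j m, b' ≠ sel k₀ A' j m → Preferred (sel k₀ A' j m) b' := by
  refine Classical.epsilon_spec (p := fun b =>
    b ∈ candidates k₀ A' j m ∧ ∀ b' ∈ candidates k₀ A' j m, b' ≠ b → Preferred b b') ?_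
  let S : Set ℕ := {s | ∃ β, (s, β) ∈ candidates k₀ A' j m}
  have hne : S.Nonempty := by
    obtain ⟨β, hβ, hx⟩ := (hA' 0).exists_mem_dil (pt j m)
    have := hA.rank_zero ((hA' 0).subset hβ)
    exact ⟨0, β, hβ, hx, by simp only; omega⟩
  have hbdd : BddAbove S := by
    refine ⟨j, ?_⟩
    rintro s ⟨β, hβ, -, hk⟩
    have := hA.level_le_rank ((hA' s).subset hβ)
    exact this.trans ((Nat.le_add_right _ _).trans hk)
  have hs := Nat.sSup_mem hne hbdd
  obtain ⟨β, hβ, hmin⟩ := WellFounded.has_min (measure (Encodable.encode (α := Index n))).wf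
    {β | (sSup S, β) ∈ candidates k₀ A' j m} hs
  refine ⟨(sSup S, β), hβ, ?_⟩
  rintro ⟨s, β'⟩ hb' hne'
  have hle : s ≤ sSup S := le_csSup hbdd ⟨β', hb'⟩
  rcases hle.lt_or_eq with h | h
  · exact Or.inl h
  · subst h
    refine Or.inr ⟨rfl, ?_⟩
    have h1 : ¬ Encodable.encode β' < Encodable.encode β := hmin β' hb'
    have h2 : Encodable.encode β' ≠ Encodable.encode β := fun h =>
      hne' (by rw [Encodable.encode_injective h])
    simp only
    omega

/-- The cubes of the level after the selected one are small. -/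
lemma lt_rank_of_succ_level (hA : IsAdmissible (1 + ((2 : ℝ) ^ k₀)⁻¹) γ c₁ c₂ A)
    (hA' : ∀ s, IsReduction (1 + ((2 : ℝ) ^ k₀)⁻¹) (A s) (A' s)) {j : ℕ} (hj : k₀ + 2 ≤ j)
    {m : Fin n → ℤ} {β : Index n} (hβ : β ∈ A' ((sel k₀ A' j m).1 + 1))
    (hx : pt j m ∈ dil k₀ β) : j < β.1 + (k₀ + 2) := by
  by_contra! h
  have := (sel_spec hA hA' hj m).2 ((sel k₀ A' j m).1 + 1, β) ⟨hβ, hx, h⟩ (by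
    intro he
    have := congrArg Prod.fst he
    simp at this)
  unfold Preferred at this
  simp only at this
  omega

/-- The selected cubes at adjacent lattice points of consecutive scales. -/
lemma sel_adjacent (hA : IsAdmissible (1 + ((2 : ℝ) ^ k₀)⁻¹) γ c₁ c₂ A)
    (hA' : ∀ s, IsReduction (1 + ((2 : ℝ) ^ k₀)⁻¹) (A s) (A' s)) {j : ℕ} (hj : k₀ + 2 ≤ j)
    {m m' : Fin n → ℤ} (hadj : Adj m m') :
    (dil k₀ (sel k₀ A' (j + 1) m).2 ∩ dil k₀ (sel k₀ A' j m').2).Nonempty ∧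
    (sel k₀ A' j m').1 ≤ (sel k₀ A' (j + 1) m).1 ∧
    (sel k₀ A' (j + 1) m).1 ≤ (sel k₀ A' j m').1 + 1 ∧
    (sel k₀ A' (j + 1) m ≠ sel k₀ A' j m' →
      IsSwitch k₀ (sel k₀ A' (j + 1) m).2 (sel k₀ A' j m').2 j m') := by
  obtain ⟨⟨hb, hz, hk⟩, hbest⟩ := sel_spec hA hA' (show k₀ + 2 ≤ j + 1 by omega) m
  obtain ⟨⟨hb', hz', hk'⟩, hbest'⟩ := sel_spec hA hA' hj m'
  -- The cube selected at the coarse point also contains the fine point, so it competes there.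
  have hz2 : pt (j + 1) m ∈ dil k₀ (sel k₀ A' j m').2 := by
    refine mem_dil_of_near hz' hk' fun i => ?_
    have := hadj.pt_sub j i
    have e : 2 ^ j * pt (j + 1) m i - m' i = 2 ^ j * (pt (j + 1) m i - pt j m' i) := by
      unfold pt; field_simp
    rw [e, abs_mul, abs_of_pos (by positivity : (0 : ℝ) < 2 ^ j)]
    calc _ ≤ (2 : ℝ) ^ j * (1 / 2 ^ (j + 1)) := by gcongr
      _ = 1 / 2 := by rw [pow_succ]; field_simp
      _ < 1 := by norm_num
  -- Conversely, the cube selected at the fine point need only contain the coarse point in its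
  -- closure; switches on the boundary come from this.
  have hcl : ∀ i, lo k₀ (sel k₀ A' (j + 1) m).2 i ≤ pt j m' i ∧
      pt j m' i ≤ hi k₀ (sel k₀ A' (j + 1) m).2 i := by
    intro i
    have h1 := lo_add_le_pt hz hk i
    have h2 := abs_le.1 (hadj.pt_sub j i)
    constructor <;> linarith [h1.1, h1.2, h2.1, h2.2]
  have hpref : sel k₀ A' (j + 1) m ≠ sel k₀ A' j m' →
      Preferred (sel k₀ A' (j + 1) m) (sel k₀ A' j m') := fun h =>
    hbest _ ⟨hb', hz2, hk'.trans (Nat.le_succ j)⟩ (Ne.symm h)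
  refine ⟨⟨_, hz, hz2⟩, ?_, ?_, fun hne => ⟨hk, hk', hcl, hz', ?_⟩⟩
  · by_cases h : sel k₀ A' (j + 1) m = sel k₀ A' j m'
    · rw [h]
    · have := hpref h
      unfold Preferred at this
      omega
  -- A cube of the level after the coarse selection containing the coarse point has rank above `j -
  -- k₀ - 2`. A selection of still later level would have an even larger rank, too large for scale
  -- `j + 1`.
  · by_contra! h
    obtain ⟨β, hβ, hxβ⟩ := (hA' ((sel k₀ A' j m').1 + 1)).exists_mem_dil (pt j m')
    have h1 := lt_rank_of_succ_level hA hA' hj hβ hxβ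
    obtain ⟨y, hy1, hy2⟩ := exists_mem_inter_dil hz hcl hxβ
    have := hA.rank_lt ((hA' _).subset hβ) ((hA' _).subset hb) h hy2 hy1
    omega
  -- Otherwise the fine selection would already be a candidate at the coarse point, and each of the
  -- two cubes would be preferred to the other.
  · by_contra! h
    have hk2 : (sel k₀ A' (j + 1) m).2.1 + (k₀ + 2) ≤ j := by
      by_contra h2
      have := h.1 (by omega)
      omega
    exact (hpref hne).asymm (hbest' _ ⟨hb, h.2, hk2⟩ hne)

end

/-! ### Weights -/

lemma openCube_eq_pi (a : Base n) (r : ℝ) :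
    openCube a r = Set.pi univ fun i => Ioo (a i) (a i + r) := by
  ext x; simp [openCube, Set.mem_pi]

lemma dyadicCube_eq_openCube (α : Index n) :
    dyadicCube α = openCube (fun i => (α.2 i : ℝ) * side α) (side α) := by
  ext x
  simp only [dyadicCube, openCube, mem_ofPred_eq, add_mul, one_mul]

/-- The cube over which `weightAvg` averages. -/
def box (α : Index n) : Set (Space n) := dyadicCube α ×ˢ Ioo 0 (side α)

lemma volume_cube (a : Base n) (b r : ℝ) :
    volume (openCube a r ×ˢ Ioo b (b + r)) = ENNReal.ofReal r ^ (n + 1) := by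
  rw [Measure.volume_eq_prod, Measure.prod_prod, openCube_eq_pi, volume_pi_pi]
  simp [pow_succ]

lemma volume_box (α : Index n) : volume (box α) = ENNReal.ofReal (side α) ^ (n + 1) := by
  have := volume_cube (fun i => (α.2 i : ℝ) * side α) 0 (side α)
  rwa [zero_add, ← dyadicCube_eq_openCube] at this

lemma integrableOn_cube {γ : Space n → ℝ} (h : LocallyIntegrable γ volume) (a : Base n) (b r : ℝ) :
    IntegrableOn γ (openCube a r ×ˢ Ioo b (b + r)) volume := by
  refine (h.integrableOn_isCompact (k := (Set.pi univ fun i => Icc (a i) (a i + r)) ×ˢ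
    Icc b (b + r)) ((isCompact_univ_pi fun _ => isCompact_Icc).prod isCompact_Icc)).mono_set ?_
  rw [openCube_eq_pi]
  exact prod_mono (pi_mono fun _ _ => Ioo_subset_Icc_self) Ioo_subset_Icc_self

lemma lintegral_eq_average_mul {γ : Space n → ℝ} (h0 : ∀ᵐ z, 0 < γ z) {U : Set (Space n)}
    (hi : IntegrableOn γ U volume) (hU : volume U ≠ ⊤) :
    ∫⁻ z in U, ‖γ z‖ₑ = ENNReal.ofReal (⨍ z in U, γ z) * volume U := by
  have h1 : ∫⁻ z in U, ‖γ z‖ₑ = ENNReal.ofReal (∫ z in U, γ z) := by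
    rw [ofReal_integral_eq_lintegral_ofReal hi (ae_restrict_of_ae (h0.mono fun z hz => hz.le))]
    refine lintegral_congr_ae (ae_restrict_of_ae (h0.mono fun z hz => ?_))
    exact Real.enorm_of_nonneg hz.le
  rcases eq_or_ne (volume U) 0 with h | h
  · rw [h, mul_zero, Measure.restrict_eq_zero.2 h, lintegral_zero_measure]
  · rw [h1, setAverage_eq, smul_eq_mul, Measure.real, ENNReal.ofReal_mul (by positivity),
      ENNReal.ofReal_inv_of_pos (ENNReal.toReal_pos h hU), ENNReal.ofReal_toReal hU, mul_comm,
      ← mul_assoc, ENNReal.mul_inv_cancel h hU, one_mul]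

section

variable {γ : Space n → ℝ} {Cγ : ℝ}

lemma IsA1locWeight.mono (h : IsA1locWeight γ Cγ) {C : ℝ} (hC : Cγ ≤ C) : IsA1locWeight γ C := by
  refine ⟨h.locallyIntegrable, h.pos, fun a b r hr hr1 => ?_⟩
  filter_upwards [h.average_le a b r hr hr1, ae_restrict_of_ae h.pos] with z hz hpos
  exact hz.trans (mul_le_mul_of_nonneg_right hC hpos.le)

lemma IsA1locWeight.weightAvg_nonneg (h : IsA1locWeight γ Cγ) (α : Index n) :
    0 ≤ weightAvg γ α := by
  unfold weightAvg
  rw [setAverage_eq]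
  exact smul_nonneg (by positivity)
    (integral_nonneg_of_ae (ae_restrict_of_ae (h.pos.mono fun z hz => hz.le)))

lemma IsA1locWeight.lintegral_box (h : IsA1locWeight γ Cγ) (α : Index n) :
    ∫⁻ z in box α, ‖γ z‖ₑ = ENNReal.ofReal (weightAvg γ α) * volume (box α) := by
  refine lintegral_eq_average_mul h.pos ?_ ?_
  · have := integrableOn_cube h.locallyIntegrable (fun i => (α.2 i : ℝ) * side α) 0 (side α)
    rwa [zero_add, ← dyadicCube_eq_openCube] at this
  · rw [volume_box]; finiteness

lemma IsA1locWeight.weightAvg_pos (h : IsA1locWeight γ Cγ) (α : Index n) :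
    0 < weightAvg γ α := by
  have h1 := h.lintegral_box α
  have h2 : ∫⁻ z in box α, ‖γ z‖ₑ ≠ 0 := by
    intro h0
    rw [lintegral_eq_zero_iff' h.locallyIntegrable.aestronglyMeasurable.enorm.restrict] at h0
    have h3 : ∀ᵐ z ∂(volume.restrict (box α)), False := by
      filter_upwards [h0, ae_restrict_of_ae h.pos] with z hz hz'
      simp at hz
      exact hz'.ne' hz
    rw [Filter.eventually_false_iff_eq_bot, ae_eq_bot, Measure.restrict_eq_zero, volume_box] at h3
    have := side_pos α
    simp [this.not_ge] at h3
  by_contra! h3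
  rw [ENNReal.ofReal_of_nonpos h3, zero_mul] at h1
  exact h2 h1

/-- The mean over a cube of side length at most one is controlled by the mean over a dyadic box
contained in it. -/
lemma IsA1locWeight.lintegral_cube_le (h : IsA1locWeight γ Cγ) (hC : 0 ≤ Cγ) {a : Base n}
    {r : ℝ} (hr : 0 < r) (hr1 : r ≤ 1) {α : Index n} (hsub : box α ⊆ openCube a r ×ˢ Ioo 0 (0 + r)) :
    ∫⁻ z in openCube a r ×ˢ Ioo 0 (0 + r), ‖γ z‖ₑ
      ≤ ENNReal.ofReal Cγ * ENNReal.ofReal r ^ (n + 1) * ENNReal.ofReal (weightAvg γ α) := by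
  set U := openCube a r ×ˢ Ioo (0 : ℝ) (0 + r) with hU
  have hUv : volume U = ENNReal.ofReal r ^ (n + 1) := volume_cube a 0 r
  have h1 := lintegral_eq_average_mul h.pos (integrableOn_cube h.locallyIntegrable a 0 r)
    (by rw [← hU, hUv]; finiteness)
  rw [← hU, hUv] at h1
  rw [h1]
  set M := ⨍ z in U, γ z
  have hbv : volume (box α) ≠ 0 := by
    rw [volume_box]
    have := side_pos α
    positivity
  have hbt : volume (box α) ≠ ⊤ := by rw [volume_box]; finiteness
  -- The A₁ inequality for the large cube, integrated over the small box only.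
  have h2 : ENNReal.ofReal M * volume (box α)
      ≤ ENNReal.ofReal Cγ * (ENNReal.ofReal (weightAvg γ α) * volume (box α)) := by
    rw [← h.lintegral_box, ← setLIntegral_const, ← lintegral_const_mul' _ _ ENNReal.ofReal_ne_top]
    refine lintegral_mono_ae ?_
    filter_upwards [ae_mono (Measure.restrict_mono hsub le_rfl) (h.average_le a 0 r hr hr1),
      ae_restrict_of_ae h.pos] with z hz hpos
    rw [Real.enorm_of_nonneg hpos.le, ← ENNReal.ofReal_mul hC]
    exact ENNReal.ofReal_le_ofReal hz
  rw [← mul_assoc] at h2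
  have h3 := (ENNReal.mul_le_mul_iff_left hbv hbt).1 h2
  calc _ ≤ ENNReal.ofReal Cγ * ENNReal.ofReal (weightAvg γ α) * ENNReal.ofReal r ^ (n + 1) := by
        gcongr
    _ = _ := by ring

/-- Lower bound for the averages over the cubes contained in a unit cube. -/
lemma IsA1locWeight.weightAvg_unit_le (h : IsA1locWeight γ Cγ) (hC : 0 ≤ Cγ) (α : Index n)
    (m : Fin n → ℤ) (hsub : dyadicCube α ⊆ dyadicCube ((0, m) : Index n)) :
    ENNReal.ofReal (weightAvg γ (0, m)) ≤ ENNReal.ofReal Cγ * ENNReal.ofReal (weightAvg γ α) := by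
  have hs : side ((0, m) : Index n) = 1 := by simp [side]
  have e : box ((0, m) : Index n) = openCube (fun i => (m i : ℝ)) 1 ×ˢ Ioo 0 (0 + 1) := by
    unfold box; rw [dyadicCube_eq_openCube, hs]; simp
  have h1 := h.lintegral_cube_le hC (a := fun i => (m i : ℝ)) one_pos le_rfl (α := α) (by
    rw [← e]
    refine prod_mono hsub (Ioo_subset_Ioo le_rfl ?_)
    rw [hs]; exact side_le_one α)
  rw [← e, h.lintegral_box, volume_box, hs] at h1
  simpa using h1

variable {k₀ : ℕ} {c₁ c₂ : ℝ} {A A' : ℕ → Set (Index n)}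

/-- The mass of the weight near a lattice point is controlled by the average over the selected
cube. -/
lemma lintegral_bumpRegion_le (h : IsA1locWeight γ Cγ) (hC : 0 ≤ Cγ) (hc₁ : 1 ≤ c₁) (hc₂ : 1 ≤ c₂)
    (hA : IsAdmissible (1 + ((2 : ℝ) ^ k₀)⁻¹) γ c₁ c₂ A)
    (hA' : ∀ s, IsReduction (1 + ((2 : ℝ) ^ k₀)⁻¹) (A s) (A' s)) {j : ℕ} (hj : k₀ + 2 ≤ j)
    (m : Fin n → ℤ) :
    2 ^ j * ∫⁻ z in upperHalf n ∩ bumpRegion j m, ‖γ z‖ₑ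
      ≤ ENNReal.ofReal (Cγ * (c₁ * c₂)) * (2 ^ (k₀ + 2)) ^ (n + 1) *
        ((2⁻¹) ^ (j * n) * ENNReal.ofReal (weightAvg γ (sel k₀ A' j m).2)) := by
  obtain ⟨⟨hb, hz, hk⟩, -⟩ := sel_spec hA hA' hj m
  -- A cube of the level after the selected one: it is not a candidate, so its size is at most a
  -- multiple of the lattice step, yet its average of `γ` is comparable to that of the selected
  -- cube.
  obtain ⟨β, hβ, hxβ⟩ := (hA' ((sel k₀ A' j m).1 + 1)).exists_mem_dil (pt j m)
  have hβk := lt_rank_of_succ_level hA hA' hj hβ hxβ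
  have havg : weightAvg γ β ≤ c₁ * c₂ * weightAvg γ (sel k₀ A' j m).2 :=
    hA.weightAvg_le hc₁ hc₂ h.weightAvg_nonneg ((hA' _).subset hβ) ((hA' _).subset hb)
      (by omega) (by omega) ⟨_, hxβ, hz⟩
  set r : ℝ := 2 ^ (k₀ + 2) / 2 ^ j with hr
  have hr0 : 0 < r := by positivity
  have hr1 : r ≤ 1 := by
    rw [hr, div_le_one (by positivity)]
    exact pow_le_pow_right₀ one_le_two hj
  have hside : side β ≤ r / 2 := by
    have : side β = 1 / 2 ^ β.1 := by unfold side; rw [one_div]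
    rw [this, hr, div_div, div_le_div_iff₀ (by positivity) (by positivity), one_mul, ← pow_succ,
      ← pow_add]
    exact pow_le_pow_right₀ one_le_two (by omega)
  have hstep : 4 * (1 / 2 ^ j) ≤ r := by
    rw [hr, mul_one_div]
    gcongr
    calc (4 : ℝ) = 2 ^ 2 := by norm_num
      _ ≤ 2 ^ (k₀ + 2) := pow_le_pow_right₀ one_le_two (by omega)
  have hs0 := side_pos β
  have hp : (0 : ℝ) < 2 ^ j := by positivity
  have hq : (0 : ℝ) < 1 / 2 ^ j := by positivity
  -- Lower corner of one cube of side `r` containing both the box over `β` and the relevant part of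
  -- the bump region.
  set a : Base n := fun i => min ((β.2 i : ℝ) * side β) (pt j m i - 1 / 2 ^ j) with ha
  have hsub : box β ⊆ openCube a r ×ˢ Ioo 0 (0 + r) := by
    refine prod_mono ?_ (Ioo_subset_Ioo le_rfl (by linarith))
    intro x hx i
    have h1 := hx i
    have h2 := (mem_dil.1 hxβ) i
    have h3 := margin_le k₀ β
    rw [lo_eq, hi_eq] at h2
    refine ⟨(min_le_left _ _).trans_lt h1.1, ?_⟩
    simp only [ha]
    rcases min_choice ((β.2 i : ℝ) * side β) (pt j m i - 1 / 2 ^ j) with e | e <;> rw [e] <;>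
      linarith [h1.2, h2.1, h2.2]
  have hreg : upperHalf n ∩ bumpRegion j m ⊆ openCube a r ×ˢ Ioo 0 (0 + r) := by
    rintro z ⟨hz0, hz1, hz2⟩
    refine ⟨fun i => ?_, hz0, by linarith⟩
    have h1 := abs_le.1 (hz1 i)
    have h2 := (mem_dil.1 hxβ) i
    have h3 := margin_le k₀ β
    rw [lo_eq, hi_eq] at h2
    have e1 : 2 ^ j * pt j m i = m i := by unfold pt; field_simp
    have e2 : (2 : ℝ) ^ j * (1 / 2 ^ j) = 1 := by field_simp
    have u1 : pt j m i - 1 / 2 ^ j < z.1 i := by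
      refine lt_of_mul_lt_mul_left (a := (2 : ℝ) ^ j) ?_ hp.le
      rw [mul_sub, e1, e2]; linarith [h1.1]
    have u2 : z.1 i < pt j m i + 1 / 2 ^ j := by
      refine lt_of_mul_lt_mul_left (a := (2 : ℝ) ^ j) ?_ hp.le
      rw [mul_add, e1, e2]; linarith [h1.2]
    refine ⟨(min_le_right _ _).trans_lt u1, ?_⟩
    simp only [ha]
    rcases min_choice ((β.2 i : ℝ) * side β) (pt j m i - 1 / 2 ^ j) with e | e <;> rw [e] <;>
      linarith [h1.2, h2.1, h2.2]
  calc 2 ^ j * ∫⁻ z in upperHalf n ∩ bumpRegion j m, ‖γ z‖ₑ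
      ≤ 2 ^ j * (ENNReal.ofReal Cγ * ENNReal.ofReal r ^ (n + 1) *
          ENNReal.ofReal (weightAvg γ β)) := by
        gcongr
        exact (lintegral_mono_set hreg).trans (h.lintegral_cube_le hC hr0 hr1 hsub)
    _ ≤ 2 ^ j * (ENNReal.ofReal Cγ * ENNReal.ofReal r ^ (n + 1) *
          ENNReal.ofReal (c₁ * c₂ * weightAvg γ (sel k₀ A' j m).2)) := by
        gcongr
    _ = _ := by
        have er : ENNReal.ofReal r = 2 ^ (k₀ + 2) * 2⁻¹ ^ j := by
          rw [hr, div_eq_mul_inv, ENNReal.ofReal_mul (by positivity),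
            ENNReal.ofReal_pow (by norm_num), ← inv_pow, ENNReal.ofReal_pow (by norm_num),
            ENNReal.ofReal_inv_of_pos (by norm_num), ENNReal.ofReal_ofNat]
        -- The gradient factor `2ʲ` cancels one of the `n + 1` powers of `2⁻ʲ`.
        have e2 : (2 : ℝ≥0∞) ^ j * 2⁻¹ ^ j = 1 := by
          rw [← mul_pow, ENNReal.mul_inv_cancel (by norm_num) (by norm_num), one_pow]
        rw [er, mul_pow, ENNReal.ofReal_mul (p := c₁ * c₂) (by positivity),
          ENNReal.ofReal_mul (p := Cγ) hC, ← pow_mul (2⁻¹ : ℝ≥0∞) j, mul_add, mul_one,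
          pow_add (2⁻¹ : ℝ≥0∞)]
        calc _ = (2 ^ j * 2⁻¹ ^ j) * (ENNReal.ofReal Cγ * ENNReal.ofReal (c₁ * c₂) *
              (2 ^ (k₀ + 2)) ^ (n + 1) * (2⁻¹ ^ (j * n) *
              ENNReal.ofReal (weightAvg γ (sel k₀ A' j m).2))) := by ring
          _ = _ := by rw [e2, one_mul]

end

/-! ### Oscillation estimates -/

/-- The `L₁` oscillation over a dilated cube. -/
noncomputable def osc (k₀ : ℕ) (φ : Base n → ℝ) (α : Index n) : ℝ≥0∞ :=
  ∫⁻ x in dil k₀ α, ‖dilatedAvg (1 + ((2 : ℝ) ^ k₀)⁻¹) φ α - φ x‖ₑ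

lemma enorm_dilatedAvg_mul_le (k₀ : ℕ) (φ : Base n → ℝ) (α : Index n) :
    ‖dilatedAvg (1 + ((2 : ℝ) ^ k₀)⁻¹) φ α‖ₑ * volume (dil k₀ α) ≤ ∫⁻ x in dil k₀ α, ‖φ x‖ₑ := by
  have h0 := (volume_dil_pos k₀ α).ne'
  have ht := (volume_dil_lt_top k₀ α).ne
  have h1 := measure_smul_setAverage (μ := volume) φ ht
  calc ‖dilatedAvg (1 + ((2 : ℝ) ^ k₀)⁻¹) φ α‖ₑ * volume (dil k₀ α)
      = ‖volume.real (dil k₀ α) • ⨍ x in dil k₀ α, φ x‖ₑ := by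
        rw [smul_eq_mul, enorm_mul, Real.enorm_of_nonneg measureReal_nonneg, Measure.real,
          ENNReal.ofReal_toReal ht, mul_comm]
        rfl
    _ = ‖∫ x in dil k₀ α, φ x‖ₑ := by rw [h1]
    _ ≤ _ := enorm_integral_le_lintegral_enorm _

lemma osc_le (k₀ : ℕ) (φ : Base n → ℝ) (α : Index n) :
    osc k₀ φ α ≤ 2 * ∫⁻ x in dil k₀ α, ‖φ x‖ₑ := by
  calc osc k₀ φ α
      ≤ ∫⁻ x in dil k₀ α, (‖dilatedAvg (1 + ((2 : ℝ) ^ k₀)⁻¹) φ α‖ₑ + ‖φ x‖ₑ) :=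
        lintegral_mono fun x => enorm_sub_le
    _ = ‖dilatedAvg (1 + ((2 : ℝ) ^ k₀)⁻¹) φ α‖ₑ * volume (dil k₀ α)
          + ∫⁻ x in dil k₀ α, ‖φ x‖ₑ := by
        rw [lintegral_add_left measurable_const, setLIntegral_const]
    _ ≤ _ := by
        rw [two_mul]; gcongr; exact enorm_dilatedAvg_mul_le k₀ φ α

/-- Both means are compared with `φ x` for `x` in the intersection, whose measure is at least
`2^(-(k+k₀+1)n)`. The integrals stay on the intersection so that bounded overlap can be used when
summing over pairs. -/
lemma enorm_avg_sub_avg_le {k₀ : ℕ} {φ : Base n → ℝ} (hφ : LocallyIntegrable φ volume)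
    {α β : Index n} (h : (dil k₀ α ∩ dil k₀ β).Nonempty) :
    ‖dilatedAvg (1 + ((2 : ℝ) ^ k₀)⁻¹) φ α - dilatedAvg (1 + ((2 : ℝ) ^ k₀)⁻¹) φ β‖ₑ *
        2⁻¹ ^ (max α.1 β.1 * n)
      ≤ (2 ^ (k₀ + 1)) ^ n *
        ((∫⁻ x in dil k₀ α ∩ dil k₀ β, ‖dilatedAvg (1 + ((2 : ℝ) ^ k₀)⁻¹) φ α - φ x‖ₑ)
          + ∫⁻ x in dil k₀ α ∩ dil k₀ β, ‖dilatedAvg (1 + ((2 : ℝ) ^ k₀)⁻¹) φ β - φ x‖ₑ) := by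
  set u := dilatedAvg (1 + ((2 : ℝ) ^ k₀)⁻¹) φ α
  set v := dilatedAvg (1 + ((2 : ℝ) ^ k₀)⁻¹) φ β
  set k := max α.1 β.1
  have hv := volume_dil_inter_ge h (le_max_left α.1 β.1) (le_max_right α.1 β.1)
  have e : ENNReal.ofReal (1 / 2 ^ (k + k₀ + 1)) = 2⁻¹ ^ k * 2⁻¹ ^ (k₀ + 1) := by
    rw [← pow_add, one_div, ← inv_pow, ENNReal.ofReal_pow (by norm_num),
      ENNReal.ofReal_inv_of_pos (by norm_num), ENNReal.ofReal_ofNat, add_assoc]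
  rw [e, mul_pow, ← pow_mul] at hv
  have e1 : (2 : ℝ≥0∞) ^ (k₀ + 1) * 2⁻¹ ^ (k₀ + 1) = 1 := by
    rw [← mul_pow, ENNReal.mul_inv_cancel (by norm_num) (by norm_num), one_pow]
  calc ‖u - v‖ₑ * 2⁻¹ ^ (k * n)
      = (2 ^ (k₀ + 1)) ^ n * (‖u - v‖ₑ * (2⁻¹ ^ (k * n) * (2⁻¹ ^ (k₀ + 1)) ^ n)) := by
        calc _ = ‖u - v‖ₑ * 2⁻¹ ^ (k * n) * (2 ^ (k₀ + 1) * 2⁻¹ ^ (k₀ + 1)) ^ n := by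
              rw [e1, one_pow, mul_one]
          _ = _ := by rw [mul_pow]; ring
    _ ≤ (2 ^ (k₀ + 1)) ^ n * (‖u - v‖ₑ * volume (dil k₀ α ∩ dil k₀ β)) := by gcongr
    _ = (2 ^ (k₀ + 1)) ^ n * ∫⁻ x in dil k₀ α ∩ dil k₀ β, ‖u - v‖ₑ := by
        rw [setLIntegral_const]
    _ ≤ (2 ^ (k₀ + 1)) ^ n * ∫⁻ x in dil k₀ α ∩ dil k₀ β, (‖u - φ x‖ₑ + ‖v - φ x‖ₑ) := by
        gcongr with x
        calc ‖u - v‖ₑ = ‖(u - φ x) - (v - φ x)‖ₑ := by rw [sub_sub_sub_cancel_right]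
          _ ≤ _ := enorm_sub_le
    _ = _ := by
        rw [lintegral_add_left']
        exact (aemeasurable_const.sub hφ.aestronglyMeasurable.aemeasurable.restrict).enorm

section

variable {k₀ : ℕ} {A A' : ℕ → Set (Index n)}

open Classical in
/-- Summation over cubes of finitely many levels costs a bounded factor. -/
lemma tsum_lintegral_inter_le (hA' : ∀ s, IsReduction (1 + ((2 : ℝ) ^ k₀)⁻¹) (A s) (A' s))
    {D : Set (Base n)} {g : Base n → ℝ≥0∞} (hg : AEMeasurable g) (L : Finset ℕ) :
    ∑' b : ℕ × Index n, (if b.1 ∈ L ∧ b.2 ∈ A' b.1 then ∫⁻ x in D ∩ dil k₀ b.2, g x else 0)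
      ≤ L.card * overlapBound n k₀ * ∫⁻ x in D, g x := by
  have h1 : ∀ b : ℕ × Index n,
      (if b.1 ∈ L ∧ b.2 ∈ A' b.1 then ∫⁻ x in D ∩ dil k₀ b.2, g x else 0)
      = ∫⁻ x in D, (if b.1 ∈ L ∧ b.2 ∈ A' b.1 then
          (dil k₀ b.2).indicator (fun _ => (1 : ℝ≥0∞)) x else 0) * g x := by
    intro b
    split_ifs
    · rw [inter_comm, ← Measure.restrict_restrict (measurableSet_dil k₀ b.2),
        ← lintegral_indicator (measurableSet_dil k₀ b.2)]
      refine lintegral_congr fun x => ?_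
      by_cases hx : x ∈ dil k₀ b.2 <;> simp [hx]
    · simp
  simp_rw [h1]
  -- By Tonelli it remains to count the cubes through a point: at most `overlapBound n k₀` for each
  -- level in `L`.
  rw [← lintegral_tsum, ← lintegral_const_mul'' _ hg.restrict]
  · refine lintegral_mono fun x => ?_
    simp only
    rw [ENNReal.tsum_mul_right]
    gcongr
    rw [ENNReal.tsum_prod']
    calc ∑' s, ∑' α : Index n, (if s ∈ L ∧ α ∈ A' s then
          (dil k₀ α).indicator (fun _ => (1 : ℝ≥0∞)) x else 0)
        ≤ ∑' s, (if s ∈ L then (overlapBound n k₀ : ℝ≥0∞) else 0) := by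
          refine ENNReal.tsum_le_tsum fun s => ?_
          split_ifs with hs
          · refine le_trans (le_of_eq ?_) ((hA' s).tsum_indicator_le x)
            rw [tsum_subtype (A' s) (fun α => (dil k₀ α).indicator (fun _ => (1 : ℝ≥0∞)) x)]
            refine tsum_congr fun α => ?_
            by_cases h : α ∈ A' s <;> simp [hs, h]
          · simp [hs]
      _ ≤ _ := tsum_ite_le_card L (fun _ h => h) _
  · intro b
    refine AEMeasurable.mul ?_ hg.restrict
    split_ifs
    · exact (measurable_const.indicator (measurableSet_dil k₀ b.2)).aemeasurable
    · exact aemeasurable_const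

lemma closed_ae_eq_dyadicCube (α : Index n) :
    closedDyadicCube α =ᵐ[volume] dyadicCube α := by
  have : closedDyadicCube α = Icc (fun i => (α.2 i : ℝ) * side α)
      (fun i => ((α.2 i : ℝ) + 1) * side α) := by
    ext x
    simp only [closedDyadicCube, mem_ofPred_eq, mem_Icc, Pi.le_def, forall_and]
  rw [this, dyadicCube_eq_pi]
  exact (Measure.univ_pi_Ioo_ae_eq_Icc (μ := fun _ => (volume : Measure ℝ))).symm

lemma lintegral_le_tsum_unit (D : Set (Base n)) (g : Base n → ℝ≥0∞) :
    ∫⁻ x in D, g x ≤ ∑' m : Fin n → ℤ, ∫⁻ x in dyadicCube ((0, m) : Index n) ∩ D, g x := by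
  calc ∫⁻ x in D, g x
      ≤ ∫⁻ x in ⋃ m : Fin n → ℤ, closedDyadicCube ((0, m) : Index n) ∩ D, g x := by
        refine lintegral_mono_set fun x hx => mem_iUnion.2 ⟨fun i => ⌊x i⌋, fun i => ?_, hx⟩
        simp only [side, pow_zero, inv_one, mul_one]
        exact ⟨Int.floor_le _, (Int.lt_floor_add_one _).le⟩
    _ ≤ ∑' m : Fin n → ℤ, ∫⁻ x in closedDyadicCube ((0, m) : Index n) ∩ D, g x :=
        lintegral_iUnion_le _ _
    _ = _ := tsum_congr fun m => setLIntegral_congr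
        ((closed_ae_eq_dyadicCube _).inter (ae_eq_refl D))

variable {γ : Space n → ℝ} {c₁ c₂ : ℝ} {φ : Base n → ℝ}

open Classical in
/-- The reduced cubes of level zero are controlled by the unit cubes. -/
lemma tsum_level_zero_le (hc₁ : 1 ≤ c₁) (hφ : LocallyIntegrable φ volume)
    (hA : IsAdmissible (1 + ((2 : ℝ) ^ k₀)⁻¹) γ c₁ c₂ A)
    (hA' : ∀ s, IsReduction (1 + ((2 : ℝ) ^ k₀)⁻¹) (A s) (A' s)) :
    ∑' b : ℕ × Index n, (if b.1 = 0 ∧ b.2 ∈ A' b.1 then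
        ENNReal.ofReal (weightAvg γ b.2) * ∫⁻ x in dil k₀ b.2, ‖φ x‖ₑ else 0)
      ≤ ENNReal.ofReal c₁ * overlapBound n k₀ * ∑' m : Fin n → ℤ,
        ENNReal.ofReal (weightAvg γ (0, m)) * ∫⁻ x in dyadicCube ((0, m) : Index n), ‖φ x‖ₑ := by
  have hm : AEMeasurable (fun x => ‖φ x‖ₑ) := hφ.aestronglyMeasurable.enorm
  calc _ ≤ ∑' b : ℕ × Index n, ∑' m : Fin n → ℤ, (ENNReal.ofReal c₁ *
        ENNReal.ofReal (weightAvg γ (0, m))) * (if b.1 ∈ ({0} : Finset ℕ) ∧ b.2 ∈ A' b.1 then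
          ∫⁻ x in dyadicCube ((0, m) : Index n) ∩ dil k₀ b.2, ‖φ x‖ₑ else 0) := by
        refine ENNReal.tsum_le_tsum fun b => ?_
        by_cases h1 : b.1 = 0 ∧ b.2 ∈ A' b.1
        · rw [if_pos h1]
          refine (mul_le_mul_right (lintegral_le_tsum_unit _ _) _).trans ?_
          rw [← ENNReal.tsum_mul_left]
          refine ENNReal.tsum_le_tsum fun m => ?_
          rw [if_pos (by simpa using h1)]
          -- Either the term vanishes or the two level-zero cubes are neighbours with comparable
          -- weights.
          rcases (dyadicCube ((0, m) : Index n) ∩ dil k₀ b.2).eq_empty_or_nonempty with he | hne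
          · simp [he]
          · gcongr
            rw [← ENNReal.ofReal_mul (by linarith)]
            refine ENNReal.ofReal_le_ofReal ?_
            obtain ⟨⟨s, β⟩, rfl, hβ⟩ : ∃ b' : ℕ × Index n, b = b' ∧ b.2 ∈ A' b.1 := ⟨b, rfl, h1.2⟩
            obtain ⟨x, hx1, hx2⟩ := hne
            simp only at h1 hβ hx2 ⊢
            rw [h1.1] at hβ
            exact hA.neighbours 0 β ((hA' 0).subset hβ) (0, m) (hA.unit_mem m)
              ⟨x, hx2, closed_subset_dil k₀ _ (dyadicCube_subset_closed _ hx1)⟩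
        · rw [if_neg h1]; exact zero_le
    _ = ∑' m : Fin n → ℤ, (ENNReal.ofReal c₁ * ENNReal.ofReal (weightAvg γ (0, m))) *
          ∑' b : ℕ × Index n, (if b.1 ∈ ({0} : Finset ℕ) ∧ b.2 ∈ A' b.1 then
          ∫⁻ x in dyadicCube ((0, m) : Index n) ∩ dil k₀ b.2, ‖φ x‖ₑ else 0) := by
        rw [ENNReal.tsum_comm]
        simp_rw [ENNReal.tsum_mul_left]
    _ ≤ ∑' m : Fin n → ℤ, (ENNReal.ofReal c₁ * ENNReal.ofReal (weightAvg γ (0, m))) *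
          (({0} : Finset ℕ).card * overlapBound n k₀ *
            ∫⁻ x in dyadicCube ((0, m) : Index n), ‖φ x‖ₑ) := by
        gcongr with m
        exact tsum_lintegral_inter_le hA' hm {0}
    _ = _ := by
        rw [← ENNReal.tsum_mul_left]
        refine tsum_congr fun m => ?_
        simp
        ring

lemma oscillationSum_eq : oscillationSum (1 + ((2 : ℝ) ^ k₀)⁻¹) γ φ A' =
    (∑' m : Fin n → ℤ, ENNReal.ofReal (weightAvg γ (0, m)) *
      ∫⁻ x in dyadicCube ((0, m) : Index n), ‖φ x‖ₑ)
    + ∑' s : ℕ, ∑' α : A' (s + 1), ENNReal.ofReal (weightAvg γ α.1) * osc k₀ φ α.1 := rfl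

open Classical in
/-- The oscillations over the reduced cubes of all levels are controlled by the oscillation
sum. -/
lemma tsum_osc_le (hc₁ : 1 ≤ c₁) (hφ : LocallyIntegrable φ volume)
    (hA : IsAdmissible (1 + ((2 : ℝ) ^ k₀)⁻¹) γ c₁ c₂ A)
    (hA' : ∀ s, IsReduction (1 + ((2 : ℝ) ^ k₀)⁻¹) (A s) (A' s)) :
    ∑' b : ℕ × Index n, (if b.2 ∈ A' b.1 then
        ENNReal.ofReal (weightAvg γ b.2) * osc k₀ φ b.2 else 0)
      ≤ (2 * (ENNReal.ofReal c₁ * overlapBound n k₀) + 1) *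
        oscillationSum (1 + ((2 : ℝ) ^ k₀)⁻¹) γ φ A' := by
  have hz := tsum_level_zero_le hc₁ hφ hA hA'
  rw [oscillationSum_eq]
  set S₁ := ∑' m : Fin n → ℤ, ENNReal.ofReal (weightAvg γ (0, m)) *
      ∫⁻ x in dyadicCube ((0, m) : Index n), ‖φ x‖ₑ
  set S₂ := ∑' s : ℕ, ∑' α : A' (s + 1), ENNReal.ofReal (weightAvg γ α.1) * osc k₀ φ α.1 with hS₂
  -- The oscillation sum starts at level one; at level zero the oscillation is at most twice the
  -- norm of `φ`.
  have h0 : ∑' α : Index n, (if α ∈ A' 0 then ENNReal.ofReal (weightAvg γ α) * osc k₀ φ α else 0)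
      ≤ 2 * (ENNReal.ofReal c₁ * overlapBound n k₀ * S₁) := by
    refine le_trans ?_ (mul_le_mul_right hz 2)
    rw [← ENNReal.tsum_mul_left]
    refine le_trans ?_ (ENNReal.tsum_comp_le_tsum_of_injective
      (f := fun α : Index n => ((0 : ℕ), α)) (Prod.mk_right_injective 0) _)
    refine ENNReal.tsum_le_tsum fun α => ?_
    by_cases hα : α ∈ A' 0
    · simp only [hα, if_true, and_self]
      calc _ ≤ ENNReal.ofReal (weightAvg γ α) * (2 * ∫⁻ x in dil k₀ α, ‖φ x‖ₑ) := by
            gcongr; exact osc_le k₀ φ α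
        _ = _ := by ring
    · simp [hα]
  rw [ENNReal.tsum_prod', tsum_eq_zero_add' ENNReal.summable]
  have h1 : ∑' s : ℕ, ∑' α : Index n,
      (if α ∈ A' (s + 1) then ENNReal.ofReal (weightAvg γ α) * osc k₀ φ α else 0) = S₂ := by
    rw [hS₂]
    refine tsum_congr fun s => ?_
    rw [tsum_subtype (A' (s + 1)) (fun α => ENNReal.ofReal (weightAvg γ α) * osc k₀ φ α)]
    refine tsum_congr fun α => ?_
    by_cases h : α ∈ A' (s + 1) <;> simp [h]
  simp only at h1 ⊢
  rw [h1]
  calc _ ≤ 2 * (ENNReal.ofReal c₁ * overlapBound n k₀ * S₁) + S₂ := by gcongr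
    _ ≤ 2 * (ENNReal.ofReal c₁ * overlapBound n k₀ * S₁) + S₂ +
        (2 * (ENNReal.ofReal c₁ * overlapBound n k₀) * S₂ + S₁) := le_self_add
    _ = _ := by ring

end

/-! ### The energy of the selected averages -/

/-- The values of the extension at lattice points: averages over the selected cubes. -/
noncomputable def latticeValue (k₀ : ℕ) (A' : ℕ → Set (Index n)) (φ : Base n → ℝ) (j : ℕ)
    (m : Fin n → ℤ) : ℝ :=
  -- Below scale `k₀ + 2` there need be no candidate. The value zero there also removes the initial
  -- term of the telescoping sum.
  if k₀ + 2 ≤ j then dilatedAvg (1 + ((2 : ℝ) ^ k₀)⁻¹) φ (sel k₀ A' j m).2 else 0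

open Classical in
lemma tsum_adj_left_le (m' : Fin n → ℤ) (c : ℝ≥0∞) :
    ∑' m : Fin n → ℤ, (if Adj m m' then c else 0) ≤ 3 ^ n * c := by
  refine (tsum_ite_le_card (Fintype.piFinset fun l => Finset.Icc (2 * m' l - 1) (2 * m' l + 1))
    (fun m hm => ?_) c).trans ?_
  · rw [Fintype.mem_piFinset]
    intro l
    have := abs_le.1 (hm l)
    rw [Finset.mem_Icc]
    omega
  · have : (Fintype.piFinset fun l => Finset.Icc (2 * m' l - 1) (2 * m' l + 1)).card = 3 ^ n := by
      rw [Fintype.card_piFinset]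
      rw [Finset.prod_congr rfl (g := fun _ => 3) fun l _ => by rw [Int.card_Icc]; omega]
      simp
    rw [this]
    push_cast
    rfl

open Classical in
lemma tsum_adj_right_le (m : Fin n → ℤ) (c : ℝ≥0∞) :
    ∑' m' : Fin n → ℤ, (if Adj m m' then c else 0) ≤ 2 ^ n * c := by
  refine (tsum_ite_le_card (Fintype.piFinset fun l => Finset.Icc (m l / 2) ((m l + 1) / 2))
    (fun m' hm => ?_) c).trans ?_
  · rw [Fintype.mem_piFinset]
    intro l
    have := abs_le.1 (hm l)
    rw [Finset.mem_Icc]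
    omega
  · have : (Fintype.piFinset fun l => Finset.Icc (m l / 2) ((m l + 1) / 2)).card ≤ 2 ^ n := by
      rw [Fintype.card_piFinset]
      refine (Finset.prod_le_prod' (g := fun _ => 2) fun l _ => ?_).trans (by simp)
      rw [Int.card_Icc]; omega
    gcongr
    exact_mod_cast this

section

variable {k₀ : ℕ} {A A' : ℕ → Set (Index n)} {γ : Space n → ℝ} {c₁ c₂ : ℝ} {φ : Base n → ℝ}

/-- Selected cubes of adjacent lattice points are in this relation. -/
def Related (k₀ : ℕ) (A' : ℕ → Set (Index n)) (b b' : ℕ × Index n) : Prop :=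
  b.2 ∈ A' b.1 ∧ b'.2 ∈ A' b'.1 ∧ b'.1 ≤ b.1 ∧ b.1 ≤ b'.1 + 1 ∧
    (dil k₀ b.2 ∩ dil k₀ b'.2).Nonempty

open Classical in
/-- Summation of the differences of averages over all related pairs. -/
lemma tsum_related_le (hc₁ : 1 ≤ c₁) (hc₂ : 1 ≤ c₂) (hφ : LocallyIntegrable φ volume)
    (hγ : ∀ α : Index n, 0 ≤ weightAvg γ α)
    (hA : IsAdmissible (1 + ((2 : ℝ) ^ k₀)⁻¹) γ c₁ c₂ A)
    (hA' : ∀ s, IsReduction (1 + ((2 : ℝ) ^ k₀)⁻¹) (A s) (A' s)) :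
    ∑' b : ℕ × Index n, ∑' b' : ℕ × Index n, (if Related k₀ A' b b' then
        ‖dilatedAvg (1 + ((2 : ℝ) ^ k₀)⁻¹) φ b.2 - dilatedAvg (1 + ((2 : ℝ) ^ k₀)⁻¹) φ b'.2‖ₑ *
          2⁻¹ ^ (max b.2.1 b'.2.1 * n) * ENNReal.ofReal (weightAvg γ b.2) else 0)
      ≤ (2 ^ (k₀ + 1)) ^ n * (1 + ENNReal.ofReal (c₁ * c₂)) * (2 * overlapBound n k₀) *
        ∑' b : ℕ × Index n, (if b.2 ∈ A' b.1 then
          ENNReal.ofReal (weightAvg γ b.2) * osc k₀ φ b.2 else 0) := by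
  set w : ℕ × Index n → ℝ≥0∞ := fun b => ENNReal.ofReal (weightAvg γ b.2) with hw
  set g : ℕ × Index n → Base n → ℝ≥0∞ := fun b x =>
    ‖dilatedAvg (1 + ((2 : ℝ) ^ k₀)⁻¹) φ b.2 - φ x‖ₑ with hg
  have hgm : ∀ b, AEMeasurable (g b) := fun b =>
    (aemeasurable_const.sub hφ.aestronglyMeasurable.aemeasurable).enorm
  set E := ∑' b : ℕ × Index n, (if b.2 ∈ A' b.1 then w b * osc k₀ φ b.2 else 0) with hE
  have hcard : ∀ L : Finset ℕ, L.card ≤ 2 →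
      (L.card : ℝ≥0∞) * overlapBound n k₀ ≤ 2 * overlapBound n k₀ := fun L h => by
    gcongr; exact_mod_cast h
  -- For a fixed cube `b` the partners lie in at most two levels, so bounded overlap sums the
  -- integrals over the intersections.
  have half : ∀ L : ℕ → Finset ℕ, (∀ s, (L s).card ≤ 2) →
      ∑' b : ℕ × Index n, ∑' b' : ℕ × Index n, (if b.2 ∈ A' b.1 ∧ b'.1 ∈ L b.1 ∧ b'.2 ∈ A' b'.1 then
        w b * ∫⁻ x in dil k₀ b.2 ∩ dil k₀ b'.2, g b x else 0)
      ≤ 2 * overlapBound n k₀ * E := by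
    intro L hL
    rw [hE, ← ENNReal.tsum_mul_left]
    refine ENNReal.tsum_le_tsum fun b => ?_
    by_cases hb : b.2 ∈ A' b.1
    · simp only [hb, true_and, if_true]
      calc _ = w b * ∑' b' : ℕ × Index n, (if b'.1 ∈ L b.1 ∧ b'.2 ∈ A' b'.1 then
              ∫⁻ x in dil k₀ b.2 ∩ dil k₀ b'.2, g b x else 0) := by
            rw [← ENNReal.tsum_mul_left]
            refine tsum_congr fun b' => ?_
            rw [mul_ite, mul_zero]
        _ ≤ w b * ((L b.1).card * overlapBound n k₀ * ∫⁻ x in dil k₀ b.2, g b x) := by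
            gcongr
            exact tsum_lintegral_inter_le hA' (hgm b) (L b.1)
        _ ≤ w b * (2 * overlapBound n k₀ * ∫⁻ x in dil k₀ b.2, g b x) := by
            gcongr w b * (?_ * _)
            exact hcard _ (hL _)
        _ = 2 * overlapBound n k₀ * (w b * osc k₀ φ b.2) := by
            simp only [hg, osc]; ring
    · simp [hb]
  -- For `s = 0` the truncated difference merely repeats level zero.
  have h1 := half (fun s => {s, s - 1}) (fun s => Finset.card_le_two)
  have h2 := half (fun s => {s, s + 1}) (fun s => Finset.card_le_two)
  rw [ENNReal.tsum_comm] at h2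
  calc _ ≤ ∑' b : ℕ × Index n, ∑' b' : ℕ × Index n,
        ((2 ^ (k₀ + 1)) ^ n * (if b.2 ∈ A' b.1 ∧ b'.1 ∈ ({b.1, b.1 - 1} : Finset ℕ) ∧
            b'.2 ∈ A' b'.1 then w b * ∫⁻ x in dil k₀ b.2 ∩ dil k₀ b'.2, g b x else 0)
        + (2 ^ (k₀ + 1)) ^ n * ENNReal.ofReal (c₁ * c₂) *
          (if b'.2 ∈ A' b'.1 ∧ b.1 ∈ ({b'.1, b'.1 + 1} : Finset ℕ) ∧
            b.2 ∈ A' b.1 then w b' * ∫⁻ x in dil k₀ b'.2 ∩ dil k₀ b.2, g b' x else 0)) := by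
        refine ENNReal.tsum_le_tsum fun b => ENNReal.tsum_le_tsum fun b' => ?_
        by_cases h : Related k₀ A' b b'
        · have hr := h
          obtain ⟨hb, hb', hl, hl', hne⟩ := h
          rw [if_pos hr, if_pos ⟨hb, by simp; omega, hb'⟩, if_pos ⟨hb', by simp; omega, hb⟩]
          -- The weight is transferred to `b'` so that each half carries the weight of the cube
          -- whose mean it contains.
          have hww : w b ≤ ENNReal.ofReal (c₁ * c₂) * w b' := by
            simp only [hw]
            rw [← ENNReal.ofReal_mul (by positivity)]
            exact ENNReal.ofReal_le_ofReal (hA.weightAvg_le hc₁ hc₂ hγ ((hA' _).subset hb)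
              ((hA' _).subset hb') (by omega) (by omega) hne)
          calc _ ≤ (2 ^ (k₀ + 1)) ^ n * ((∫⁻ x in dil k₀ b.2 ∩ dil k₀ b'.2, g b x)
                + ∫⁻ x in dil k₀ b.2 ∩ dil k₀ b'.2, g b' x) * w b := by
                exact mul_le_mul' (enorm_avg_sub_avg_le hφ hne) le_rfl
            _ = (2 ^ (k₀ + 1)) ^ n * (w b * ∫⁻ x in dil k₀ b.2 ∩ dil k₀ b'.2, g b x)
                + (2 ^ (k₀ + 1)) ^ n * (w b * ∫⁻ x in dil k₀ b'.2 ∩ dil k₀ b.2, g b' x) := by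
                rw [inter_comm (dil k₀ b'.2)]; ring
            _ ≤ (2 ^ (k₀ + 1)) ^ n * (w b * ∫⁻ x in dil k₀ b.2 ∩ dil k₀ b'.2, g b x)
                + (2 ^ (k₀ + 1)) ^ n * (ENNReal.ofReal (c₁ * c₂) * w b' *
                  ∫⁻ x in dil k₀ b'.2 ∩ dil k₀ b.2, g b' x) := by gcongr
            _ = _ := by ring
        · rw [if_neg h]; exact zero_le
    _ ≤ (2 ^ (k₀ + 1)) ^ n * (2 * overlapBound n k₀ * E) +
        (2 ^ (k₀ + 1)) ^ n * ENNReal.ofReal (c₁ * c₂) * (2 * overlapBound n k₀ * E) := by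
        simp_rw [ENNReal.tsum_add, ENNReal.tsum_mul_left]
        gcongr
    _ = _ := by ring

open Classical in
/-- The contribution of the first scale. -/
lemma tsum_first_scale_le
    (hA : IsAdmissible (1 + ((2 : ℝ) ^ k₀)⁻¹) γ c₁ c₂ A)
    (hA' : ∀ s, IsReduction (1 + ((2 : ℝ) ^ k₀)⁻¹) (A s) (A' s)) :
    ∑' m : Fin n → ℤ, ‖latticeValue k₀ A' φ (k₀ + 2) m‖ₑ *
        ENNReal.ofReal (weightAvg γ (sel k₀ A' (k₀ + 2) m).2)
      ≤ (2 ^ (k₀ + 4)) ^ n * ∑' b : ℕ × Index n, (if b.1 = 0 ∧ b.2 ∈ A' b.1 then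
        ENNReal.ofReal (weightAvg γ b.2) * ∫⁻ x in dil k₀ b.2, ‖φ x‖ₑ else 0) := by
  set c : ℕ × Index n → ℝ≥0∞ := fun b => if b.1 = 0 ∧ b.2 ∈ A' b.1 then
    ENNReal.ofReal (weightAvg γ b.2) * ∫⁻ x in dil k₀ b.2, ‖φ x‖ₑ else 0 with hc
  calc _ ≤ ∑' m : Fin n → ℤ, ∑' b : ℕ × Index n,
        (if (b.1 = 0 ∧ b.2 ∈ A' b.1) ∧ pt (k₀ + 2) m ∈ dil k₀ b.2 then c b else 0) := by
        refine ENNReal.tsum_le_tsum fun m => ?_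
        refine le_trans ?_ (ENNReal.le_tsum (sel k₀ A' (k₀ + 2) m))
        obtain ⟨⟨hb, hz, hk⟩, -⟩ := sel_spec hA hA' (le_refl (k₀ + 2)) m
        -- At the first scale eligibility forces rank zero, and the level is at most the rank.
        have hk0 : (sel k₀ A' (k₀ + 2) m).2.1 = 0 := by omega
        have hs0 : (sel k₀ A' (k₀ + 2) m).1 = 0 := by
          have := hA.level_le_rank ((hA' _).subset hb)
          omega
        rw [if_pos ⟨⟨hs0, hb⟩, hz⟩]
        simp only [hc]
        rw [if_pos ⟨hs0, hb⟩, mul_comm, latticeValue, if_pos le_rfl]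
        gcongr
        refine le_trans ?_ (enorm_dilatedAvg_mul_le k₀ φ _)
        refine le_mul_of_one_le_right' ?_
        refine le_trans ?_ (volume_dil_ge k₀ _)
        simp [side, hk0]
    _ = ∑' b : ℕ × Index n, ∑' m : Fin n → ℤ,
        (if (b.1 = 0 ∧ b.2 ∈ A' b.1) ∧ pt (k₀ + 2) m ∈ dil k₀ b.2 then c b else 0) :=
        ENNReal.tsum_comm
    _ ≤ _ := by
        rw [← ENNReal.tsum_mul_left]
        refine ENNReal.tsum_le_tsum fun b => ?_
        by_cases hb : b.1 = 0 ∧ b.2 ∈ A' b.1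
        · have hk0 : b.2.1 = 0 := by
            have := (hA' b.1).subset hb.2
            rw [hb.1] at this
            exact hA.rank_zero this
          refine (tsum_ite_le_card (Fintype.piFinset fun l =>
            latticeIcc (k₀ + 2) (lo k₀ b.2 l) (hi k₀ b.2 l)) ?_ _).trans ?_
          · rintro m ⟨-, hm⟩
            rw [Fintype.mem_piFinset]
            intro l
            have := mem_dil.1 hm l
            exact mem_latticeIcc.2 ⟨this.1.le, this.2.le⟩
          · have := card_box_le (n := n) (j := k₀ + 2) (a := k₀ + 3) (u := lo k₀ b.2)
              (v := hi k₀ b.2) (fun l => mul_side_le (hi_sub_lo_le k₀ b.2 l) (by omega))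
            gcongr
            exact_mod_cast this
        · simp [hb]

open Classical in
lemma tsum_adj_switch_le (hn : 1 ≤ n) (b b' : ℕ × Index n) :
    ∑' i : ℕ × (Fin n → ℤ) × (Fin n → ℤ), (if Adj i.2.1 i.2.2 ∧ IsSwitch k₀ b.2 b'.2 i.1 i.2.2 then
        (2⁻¹ : ℝ≥0∞) ^ (i.1 * n) else 0)
      ≤ 3 ^ n * (switchConst n k₀ * 2⁻¹ ^ (max b.2.1 b'.2.1 * n)) := by
  refine le_trans ?_ (mul_le_mul_right (tsum_switch_le hn k₀ b.2 b'.2) _)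
  rw [ENNReal.tsum_prod', ← ENNReal.tsum_mul_left]
  refine ENNReal.tsum_le_tsum fun j => ?_
  rw [ENNReal.tsum_prod', ENNReal.tsum_comm, ← ENNReal.tsum_mul_left]
  refine ENNReal.tsum_le_tsum fun m' => ?_
  by_cases h : IsSwitch k₀ b.2 b'.2 j m'
  · simp only [h, and_true, if_true]
    exact tsum_adj_left_le m' _
  · simp [h]

open Classical in
/-- The contribution of the pairs of consecutive scales. -/
lemma tsum_pairs_le (hn : 1 ≤ n)
    (hA : IsAdmissible (1 + ((2 : ℝ) ^ k₀)⁻¹) γ c₁ c₂ A)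
    (hA' : ∀ s, IsReduction (1 + ((2 : ℝ) ^ k₀)⁻¹) (A s) (A' s)) :
    ∑' i : ℕ × (Fin n → ℤ) × (Fin n → ℤ), (if Adj i.2.1 i.2.2 ∧ k₀ + 2 ≤ i.1 then
        ‖latticeValue k₀ A' φ (i.1 + 1) i.2.1 - latticeValue k₀ A' φ i.1 i.2.2‖ₑ *
          (2⁻¹ ^ ((i.1 + 1) * n) * ENNReal.ofReal (weightAvg γ (sel k₀ A' (i.1 + 1) i.2.1).2))
        else 0)
      ≤ 3 ^ n * switchConst n k₀ *
        ∑' b : ℕ × Index n, ∑' b' : ℕ × Index n, (if Related k₀ A' b b' then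
        ‖dilatedAvg (1 + ((2 : ℝ) ^ k₀)⁻¹) φ b.2 - dilatedAvg (1 + ((2 : ℝ) ^ k₀)⁻¹) φ b'.2‖ₑ *
          2⁻¹ ^ (max b.2.1 b'.2.1 * n) * ENNReal.ofReal (weightAvg γ b.2) else 0) := by
  set G : ℕ × Index n → ℕ × Index n → ℝ≥0∞ := fun b b' => if Related k₀ A' b b' then
    ‖dilatedAvg (1 + ((2 : ℝ) ^ k₀)⁻¹) φ b.2 - dilatedAvg (1 + ((2 : ℝ) ^ k₀)⁻¹) φ b'.2‖ₑ *
      ENNReal.ofReal (weightAvg γ b.2) else 0 with hG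
  calc _ ≤ ∑' i : ℕ × (Fin n → ℤ) × (Fin n → ℤ), ∑' b : ℕ × Index n, ∑' b' : ℕ × Index n,
        G b b' * (if Adj i.2.1 i.2.2 ∧ IsSwitch k₀ b.2 b'.2 i.1 i.2.2 then
          (2⁻¹ : ℝ≥0∞) ^ (i.1 * n) else 0) := by
        refine ENNReal.tsum_le_tsum fun i => ?_
        by_cases h : Adj i.2.1 i.2.2 ∧ k₀ + 2 ≤ i.1
        · rw [if_pos h]
          by_cases he : sel k₀ A' (i.1 + 1) i.2.1 = sel k₀ A' i.1 i.2.2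
          · have : latticeValue k₀ A' φ (i.1 + 1) i.2.1 = latticeValue k₀ A' φ i.1 i.2.2 := by
              rw [latticeValue, latticeValue, if_pos h.2, if_pos (by omega), he]
            simp [this]
          · refine le_trans ?_ (ENNReal.le_tsum (sel k₀ A' (i.1 + 1) i.2.1))
            refine le_trans ?_ (ENNReal.le_tsum (sel k₀ A' i.1 i.2.2))
            obtain ⟨hne, hl, hl', hsw⟩ := sel_adjacent hA hA' h.2 h.1
            have hb := (sel_spec hA hA' (show k₀ + 2 ≤ i.1 + 1 by omega) i.2.1).1.1
            have hb' := (sel_spec hA hA' h.2 i.2.2).1.1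
            rw [if_pos ⟨h.1, hsw he⟩]
            simp only [hG]
            rw [if_pos ⟨hb, hb', hl, hl', hne⟩, latticeValue, latticeValue, if_pos h.2,
              if_pos (by omega : k₀ + 2 ≤ i.1 + 1), mul_assoc, mul_comm (2⁻¹ ^ ((i.1 + 1) * n))]
            gcongr _ * (_ * ?_)
            exact pow_le_pow_right_of_le_one' (by simp) (Nat.mul_le_mul_right n (Nat.le_succ _))
        · rw [if_neg h]; exact zero_le
    _ = ∑' b : ℕ × Index n, ∑' b' : ℕ × Index n, G b b' *
        ∑' i : ℕ × (Fin n → ℤ) × (Fin n → ℤ), (if Adj i.2.1 i.2.2 ∧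
          IsSwitch k₀ b.2 b'.2 i.1 i.2.2 then (2⁻¹ : ℝ≥0∞) ^ (i.1 * n) else 0) := by
        rw [ENNReal.tsum_comm]
        refine tsum_congr fun b => ?_
        rw [ENNReal.tsum_comm]
        refine tsum_congr fun b' => ?_
        rw [ENNReal.tsum_mul_left]
    _ ≤ ∑' b : ℕ × Index n, ∑' b' : ℕ × Index n, G b b' *
        (3 ^ n * (switchConst n k₀ * 2⁻¹ ^ (max b.2.1 b'.2.1 * n))) := by
        gcongr with b b'
        exact tsum_adj_switch_le hn b b'
    _ = _ := by
        rw [← ENNReal.tsum_mul_left]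
        refine tsum_congr fun b => ?_
        rw [← ENNReal.tsum_mul_left]
        refine tsum_congr fun b' => ?_
        simp only [hG]
        split_ifs
        · ring
        · simp

end

/-- The energy bound: the weighted Sobolev norm of the extension is controlled by the oscillation
sum. -/
theorem exists_sobolevNorm_le (hn : 1 ≤ n) (k₀ : ℕ) {Cγ c₁ c₂ : ℝ} (hC : 0 ≤ Cγ) (hc₁ : 1 ≤ c₁)
    (hc₂ : 1 ≤ c₂) : ∃ B : ℝ≥0∞, B ≠ ⊤ ∧
      ∀ γ : Space n → ℝ, IsA1locWeight γ Cγ →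
      ∀ φ : Base n → ℝ, LocallyIntegrable φ volume →
      ∀ A : ℕ → Set (Index n), IsAdmissible (1 + ((2 : ℝ) ^ k₀)⁻¹) γ c₁ c₂ A →
      ∀ A' : ℕ → Set (Index n), (∀ s, IsReduction (1 + ((2 : ℝ) ^ k₀)⁻¹) (A s) (A' s)) →
      sobolevNorm (upperHalf n) γ (latticeExtension (latticeValue k₀ A' φ))
        ≤ B * oscillationSum (1 + ((2 : ℝ) ^ k₀)⁻¹) γ φ A' := by
  classical
  obtain ⟨B, hB, hsob⟩ := exists_sobolevNorm_latticeExtension_le n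
  refine ⟨B * (ENNReal.ofReal (Cγ * (c₁ * c₂)) * (2 ^ (k₀ + 2)) ^ (n + 1) *
    (2 ^ n * ((2 ^ (k₀ + 4)) ^ n * (ENNReal.ofReal c₁ * overlapBound n k₀)) +
      3 ^ n * switchConst n k₀ * ((2 ^ (k₀ + 1)) ^ n * (1 + ENNReal.ofReal (c₁ * c₂)) *
        (2 * overlapBound n k₀) * (2 * (ENNReal.ofReal c₁ * overlapBound n k₀) + 1)))), ?_, ?_⟩
  · have := switchConst_ne_top n k₀
    finiteness
  intro γ hγ φ hφ A hA A' hA'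
  refine (hsob _ γ hγ.locallyIntegrable.aestronglyMeasurable.aemeasurable).trans ?_
  rw [mul_assoc]
  refine mul_le_mul' le_rfl ?_
  set W := ENNReal.ofReal (Cγ * (c₁ * c₂)) * (2 ^ (k₀ + 2)) ^ (n + 1) with hW
  set S := oscillationSum (1 + ((2 : ℝ) ^ k₀)⁻¹) γ φ A' with hS
  have hfirst : ∑' m : Fin n → ℤ, ‖latticeValue k₀ A' φ (k₀ + 2) m‖ₑ *
        ENNReal.ofReal (weightAvg γ (sel k₀ A' (k₀ + 2) m).2)
      ≤ (2 ^ (k₀ + 4)) ^ n * (ENNReal.ofReal c₁ * overlapBound n k₀) * S := by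
    refine (tsum_first_scale_le hA hA').trans ?_
    rw [mul_assoc]
    refine mul_le_mul' le_rfl ((tsum_level_zero_le hc₁ hφ hA hA').trans (mul_le_mul' le_rfl ?_))
    rw [hS, oscillationSum_eq]
    exact le_self_add
  have hpairs := (tsum_pairs_le (φ := φ) hn hA hA').trans (mul_le_mul' le_rfl
    ((tsum_related_le hc₁ hc₂ hφ hγ.weightAvg_nonneg hA hA').trans
      (mul_le_mul' le_rfl (tsum_osc_le hc₁ hφ hA hA'))))
  rw [← hS] at hpairs
  calc _ ≤ ∑' i : ℕ × (Fin n → ℤ) × (Fin n → ℤ), W *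
        ((if Adj i.2.1 i.2.2 then (if i.1 = k₀ + 1 then
          ‖latticeValue k₀ A' φ (k₀ + 2) i.2.1‖ₑ *
            ENNReal.ofReal (weightAvg γ (sel k₀ A' (k₀ + 2) i.2.1).2) else 0) else 0)
        + (if Adj i.2.1 i.2.2 ∧ k₀ + 2 ≤ i.1 then
        ‖latticeValue k₀ A' φ (i.1 + 1) i.2.1 - latticeValue k₀ A' φ i.1 i.2.2‖ₑ *
          (2⁻¹ ^ ((i.1 + 1) * n) * ENNReal.ofReal (weightAvg γ (sel k₀ A' (i.1 + 1) i.2.1).2))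
        else 0)) := by
        refine ENNReal.tsum_le_tsum fun i => ?_
        by_cases hadj : Adj i.2.1 i.2.2
        · simp only [hadj, if_true, true_and]
          -- Below `k₀ + 1` both values vanish; at `k₀ + 1` only the finer one survives and is
          -- estimated by the norm of `φ`; above it, genuine differences of means occur.
          rcases lt_trichotomy i.1 (k₀ + 1) with h | h | h
          · have e1 : latticeValue k₀ A' φ (i.1 + 1) i.2.1 = 0 := if_neg (by omega)
            have e2 : latticeValue k₀ A' φ i.1 i.2.2 = 0 := if_neg (by omega)
            simp [e1, e2]
          · have e2 : latticeValue k₀ A' φ i.1 i.2.2 = 0 := if_neg (by omega)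
            have hreg := lintegral_bumpRegion_le hγ hC hc₁ hc₂ hA hA'
              (show k₀ + 2 ≤ i.1 + 1 by omega) i.2.1
            rw [if_pos h, if_neg (by omega), add_zero, e2, sub_zero]
            obtain ⟨j, m, m'⟩ := i
            simp only at h hreg ⊢
            subst h
            refine (mul_le_mul' le_rfl hreg).trans ?_
            rw [← hW, mul_left_comm]
            refine mul_le_mul' le_rfl (mul_le_mul' le_rfl ?_)
            exact mul_le_of_le_one_left' (pow_le_one' (by simp) _)
          · have hreg := lintegral_bumpRegion_le hγ hC hc₁ hc₂ hA hA'
              (show k₀ + 2 ≤ i.1 + 1 by omega) i.2.1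
            rw [if_neg (by omega), if_pos (by omega), zero_add]
            refine (mul_le_mul' le_rfl hreg).trans (le_of_eq ?_)
            rw [← hW, mul_left_comm]
        · rw [if_neg hadj]; exact zero_le
    _ ≤ W * (2 ^ n * ((2 ^ (k₀ + 4)) ^ n * (ENNReal.ofReal c₁ * overlapBound n k₀) * S) +
        3 ^ n * switchConst n k₀ * ((2 ^ (k₀ + 1)) ^ n * (1 + ENNReal.ofReal (c₁ * c₂)) *
        (2 * overlapBound n k₀) *
          ((2 * (ENNReal.ofReal c₁ * overlapBound n k₀) + 1) * S))) := by
        rw [ENNReal.tsum_mul_left, ENNReal.tsum_add]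
        refine mul_le_mul' le_rfl (add_le_add ?_ hpairs)
        refine le_trans ?_ (mul_le_mul' le_rfl hfirst)
        rw [ENNReal.tsum_prod', ← ENNReal.tsum_mul_left]
        rw [tsum_eq_single (k₀ + 1) (fun j hj => by simp [hj]), ENNReal.tsum_prod']
        refine ENNReal.tsum_le_tsum fun m => ?_
        simp only [if_true]
        exact tsum_adj_right_le m _
    _ = _ := by ring

/-! ### The trace of the extension -/

/-- The unit dyadic cube containing a given dyadic cube. -/
lemma dyadicCube_subset_unit (α : Index n) :
    dyadicCube α ⊆ dyadicCube ((0, fun i => α.2 i / 2 ^ α.1) : Index n) := by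
  intro x hx i
  have h := hx i
  have hp : (0 : ℤ) < 2 ^ α.1 := by positivity
  have h1 : (α.2 i / 2 ^ α.1) * 2 ^ α.1 ≤ α.2 i := Int.ediv_mul_le _ hp.ne'
  have h2 : α.2 i + 1 ≤ (α.2 i / 2 ^ α.1 + 1) * 2 ^ α.1 := Int.lt_ediv_add_one_mul_self _ hp
  have hs := side_pos α
  have e : (2 : ℝ) ^ α.1 * side α = 1 := by unfold side; field_simp
  have h1' : ((α.2 i / 2 ^ α.1 : ℤ) : ℝ) * 2 ^ α.1 ≤ α.2 i := by exact_mod_cast h1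
  have h2' : (α.2 i : ℝ) + 1 ≤ (((α.2 i / 2 ^ α.1 : ℤ) : ℝ) + 1) * 2 ^ α.1 := by
    exact_mod_cast h2
  have h3 := mul_le_mul_of_nonneg_right h1' hs.le
  have h4 := mul_le_mul_of_nonneg_right h2' hs.le
  rw [mul_assoc, e, mul_one] at h3 h4
  simp only [side, pow_zero, inv_one, mul_one]
  simp only [side] at h h3 h4
  exact ⟨h3.trans_lt h.1, h.2.trans_le h4⟩

section

variable {k₀ : ℕ} {A A' : ℕ → Set (Index n)} {γ : Space n → ℝ} {Cγ c₁ c₂ : ℝ} {φ : Base n → ℝ}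

/-- The weight averages over the cubes meeting a bounded set are bounded below. -/
lemma IsA1locWeight.exists_le_weightAvg (h : IsA1locWeight γ Cγ) (hC : 0 ≤ Cγ) (k₀ : ℕ)
    (a : Base n) (r : ℝ) : ∃ c : ℝ≥0∞, c ≠ 0 ∧ c ≠ ⊤ ∧ ∀ α : Index n,
      (openCube a r ∩ dil k₀ α).Nonempty →
        c ≤ ENNReal.ofReal Cγ * ENNReal.ofReal (weightAvg γ α) := by
  -- Generous margins: `T` contains the index of every unit cube containing a dyadic cube whose
  -- dilation meets the bounded cube.
  set T : Finset (Fin n → ℤ) := Fintype.piFinset fun i => Finset.Icc ⌊a i - 3⌋ ⌈a i + r + 3⌉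
  -- The `1` keeps the constant finite even if `T` is empty.
  refine ⟨min 1 (T.inf fun m => ENNReal.ofReal (weightAvg γ (0, m))), ?_, ?_, ?_⟩
  · refine (lt_min one_pos ?_).ne'
    rw [Finset.lt_inf_iff (by simp)]
    intro m _
    exact ENNReal.ofReal_pos.2 (h.weightAvg_pos _)
  · exact ((min_le_left _ _).trans_lt ENNReal.one_lt_top).ne
  · rintro α ⟨x, hxQ, hxα⟩
    have hmem : (fun i => α.2 i / 2 ^ α.1) ∈ T := by
      rw [Fintype.mem_piFinset]
      intro i
      have h1 := hxQ i
      have h2 := mem_dil.1 hxα i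
      have h3 := margin_le k₀ α
      have h4 := side_le_one α
      have h5 := side_pos α
      rw [lo_eq, hi_eq] at h2
      have h6 := (dyadicCube_subset_unit α (a := fun i => ((α.2 i : ℝ) + 1 / 2) * side α)
        (fun l => by constructor <;> simp only <;> nlinarith)) i
      simp only [side, pow_zero, inv_one, mul_one] at h6
      simp only [side] at h2 h3 h4 h5
      rw [Finset.mem_Icc]
      constructor
      · have : (a i - 3 : ℝ) < ((α.2 i / 2 ^ α.1 : ℤ) : ℝ) + 1 := by linarith [h6.2, h1.1, h2.2]
        have h7 := (Int.floor_le (a i - 3)).trans_lt this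
        have : ⌊a i - 3⌋ < α.2 i / 2 ^ α.1 + 1 := by exact_mod_cast h7
        omega
      · have : ((α.2 i / 2 ^ α.1 : ℤ) : ℝ) < a i + r + 3 := by linarith [h6.1, h1.2, h2.1]
        have h7 := this.le.trans (Int.le_ceil (a i + r + 3))
        exact_mod_cast h7
    exact ((min_le_right _ _).trans (Finset.inf_le hmem)).trans
      (h.weightAvg_unit_le hC α _ (dyadicCube_subset_unit α))

/-- At high scales the selected cubes have high levels. -/
lemma exists_level_le_sel (hA : IsAdmissible (1 + ((2 : ℝ) ^ k₀)⁻¹) γ c₁ c₂ A)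
    (hA' : ∀ s, IsReduction (1 + ((2 : ℝ) ^ k₀)⁻¹) (A s) (A' s)) (s : ℕ) :
    ∃ J, k₀ + 2 ≤ J ∧ ∀ j, J ≤ j → ∀ m, s ≤ (sel k₀ A' j m).1 := by
  obtain ⟨l, -, -, hl⟩ := hA.side_ge
  -- Cubes of level `s` have rank at most `l s`, so from this scale on they compete everywhere, and
  -- later levels win.
  refine ⟨l s + (k₀ + 2), by omega, fun j hj m => ?_⟩
  obtain ⟨β, hβ, hx⟩ := (hA' s).exists_mem_dil (pt j m)
  have h1 := hl s β ((hA' s).subset hβ)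
  have h2 : β.1 ≤ l s := side_le_side_iff.1 (show side ((l s, β.2) : Index n) ≤ side β from h1)
  by_cases h : ((s, β) : ℕ × Index n) = sel k₀ A' j m
  · rw [← h]
  · have := (sel_spec hA hA' (by omega) m).2 (s, β) ⟨hβ, hx, by simp only; omega⟩ h
    unfold Preferred at this
    simp only at this
    omega

open Classical in
/-- The extension has the original function as its trace. -/
theorem hasTrace_latticeExtension (hγ : IsA1locWeight γ Cγ) (hC : 0 ≤ Cγ) (hc₁ : 1 ≤ c₁)
    (hφ : LocallyIntegrable φ volume)
    (hA : IsAdmissible (1 + ((2 : ℝ) ^ k₀)⁻¹) γ c₁ c₂ A)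
    (hA' : ∀ s, IsReduction (1 + ((2 : ℝ) ^ k₀)⁻¹) (A s) (A' s))
    (hS : oscillationSum (1 + ((2 : ℝ) ^ k₀)⁻¹) γ φ A' < ⊤) :
    HasTrace (latticeExtension (latticeValue k₀ A' φ)) φ := by
  intro a r
  set f := latticeExtension (latticeValue k₀ A' φ) with hf
  have hm : ∀ t, 0 < t → AEStronglyMeasurable (fun x => φ x - f (x, t)) volume := by
    intro t ht
    refine hφ.aestronglyMeasurable.sub (Continuous.aestronglyMeasurable ?_)
    rw [continuous_iff_continuousAt]
    intro x
    have h1 : ContinuousAt f (x, t) :=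
      (contDiffAt_latticeExtension (latticeValue k₀ A' φ) (z := (x, t)) ht).continuousAt
    exact ContinuousAt.comp (f := fun x => (x, t)) h1 (by fun_prop)
  obtain ⟨c, hc0, hct, hc⟩ := hγ.exists_le_weightAvg hC k₀ a r
  set g : ℕ → ℝ≥0∞ := fun s => ∑' α : Index n, (if α ∈ A' s then
    ENNReal.ofReal (weightAvg γ α) * osc k₀ φ α else 0) with hg
  have hgfin : ∑' s, g s ≠ ⊤ := by
    have h1 := tsum_osc_le hc₁ hφ hA hA'
    rw [ENNReal.tsum_prod'] at h1
    refine ne_top_of_le_ne_top ?_ h1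
    have := hS.ne
    finiteness
  have htail : Tendsto (fun s₀ => ENNReal.ofReal Cγ * ∑' s, g (s + s₀)) atTop (𝓝 0) := by
    have := ENNReal.Tendsto.const_mul (a := ENNReal.ofReal Cγ)
      (ENNReal.tendsto_sum_nat_add g hgfin) (Or.inr ENNReal.ofReal_ne_top)
    rwa [mul_zero] at this
  have main : Tendsto (fun t : ℝ => ∫⁻ x in openCube a r, ‖φ x - f (x, t)‖ₑ) (𝓝[>] 0) (𝓝 0) := by
    rw [ENNReal.tendsto_nhds_zero]
    intro ε hε
    obtain ⟨s₀, hs₀⟩ := (ENNReal.tendsto_nhds_zero.1 htail (c * ε)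
      (ENNReal.mul_pos hc0 hε.ne')).exists
    obtain ⟨J, hJ, hlev⟩ := exists_level_le_sel hA hA' s₀
    have hev : ∀ᶠ t : ℝ in 𝓝[>] 0, t < 1 / 2 ^ (J + 1) :=
      nhdsWithin_le_nhds (gt_mem_nhds (by positivity))
    filter_upwards [hev, self_mem_nhdsWithin] with t ht ht0
    have ht0 : 0 < t := ht0
    set G : ℕ × Index n → Base n → ℝ≥0∞ := fun b x =>
      (dil k₀ b.2).indicator (fun x => ‖dilatedAvg (1 + ((2 : ℝ) ^ k₀)⁻¹) φ b.2 - φ x‖ₑ) x with hG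
    have hGm : ∀ b, AEMeasurable (G b) := fun b =>
      ((aemeasurable_const.sub hφ.aestronglyMeasurable.aemeasurable).enorm).indicator
        (measurableSet_dil k₀ b.2)
    -- Every value near `(x, t)` is the mean over a cube of level at least `s₀` containing `x`; its
    -- deviation from `φ x` is one term of this sum.
    have hpt : ∀ x, ‖φ x - f (x, t)‖ₑ ≤ ∑' b : ℕ × Index n,
        (if s₀ ≤ b.1 ∧ b.2 ∈ A' b.1 then G b x else 0) := by
      intro x
      refine enorm_sub_latticeExtension_le (fun m => if_neg (by omega)) ht0 ht fun j hj m hψ => ?_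
      obtain ⟨⟨hb, hz, hk⟩, -⟩ := sel_spec hA hA' (hJ.trans hj) m
      have hx : x ∈ dil k₀ (sel k₀ A' j m).2 :=
        mem_dil_of_near hz hk fun i => (psi_ne_zero hψ i).trans (by norm_num)
      refine le_trans ?_ (ENNReal.le_tsum (sel k₀ A' j m))
      rw [if_pos ⟨hlev j hj m, hb⟩]
      simp only [hG]
      rw [indicator_of_mem hx, latticeValue, if_pos (hJ.trans hj), ← enorm_neg, neg_sub]
    -- The lower bound `c` inserts the weight averages and turns the pointwise bound into a tail of
    -- the convergent series.
    have h2 : c * ∫⁻ x in openCube a r, ‖φ x - f (x, t)‖ₑ ≤ c * ε := by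
      calc c * ∫⁻ x in openCube a r, ‖φ x - f (x, t)‖ₑ
          ≤ c * ∫⁻ x in openCube a r, ∑' b : ℕ × Index n,
            (if s₀ ≤ b.1 ∧ b.2 ∈ A' b.1 then G b x else 0) := by
            gcongr with x
            exact hpt x
        _ = ∑' b : ℕ × Index n, c * ∫⁻ x in openCube a r,
            (if s₀ ≤ b.1 ∧ b.2 ∈ A' b.1 then G b x else 0) := by
            rw [lintegral_tsum, ENNReal.tsum_mul_left]
            intro b
            split_ifs
            · exact (hGm b).restrict
            · exact aemeasurable_const
        _ ≤ ∑' b : ℕ × Index n, ENNReal.ofReal Cγ * (if s₀ ≤ b.1 then (if b.2 ∈ A' b.1 then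
            ENNReal.ofReal (weightAvg γ b.2) * osc k₀ φ b.2 else 0) else 0) := by
            refine ENNReal.tsum_le_tsum fun b => ?_
            by_cases hb : s₀ ≤ b.1 ∧ b.2 ∈ A' b.1
            · simp only [hb, and_self, if_true]
              simp only [hG]
              rw [lintegral_indicator (measurableSet_dil k₀ b.2),
                Measure.restrict_restrict (measurableSet_dil k₀ b.2)]
              rcases (openCube a r ∩ dil k₀ b.2).eq_empty_or_nonempty with he | hne
              · simp [inter_comm (dil k₀ b.2), he]
              · rw [← mul_assoc]
                refine mul_le_mul' (hc b.2 hne) (lintegral_mono_set inter_subset_left)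
            · simp [hb]
        _ = ENNReal.ofReal Cγ * ∑' s, g (s + s₀) := by
            rw [ENNReal.tsum_mul_left, ENNReal.tsum_prod']
            congr 1
            rw [← (add_left_injective s₀).tsum_eq (f := fun s => ∑' α : Index n,
              (if s₀ ≤ s then (if α ∈ A' s then
                ENNReal.ofReal (weightAvg γ α) * osc k₀ φ α else 0) else 0))]
            · simp [hg]
            · intro s hs
              have : s₀ ≤ s := by
                by_contra h
                simp [h] at hs
              exact ⟨s - s₀, by simp only; omega⟩
        _ ≤ c * ε := hs₀
    exact (ENNReal.mul_le_mul_iff_right hc0 hct).1 h2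
  refine ⟨?_, ?_⟩
  · filter_upwards [main.eventually (gt_mem_nhds (zero_lt_one' ℝ≥0∞)), self_mem_nhdsWithin] with t ht ht0
    exact ⟨(hm t ht0).restrict, ht.trans ENNReal.one_lt_top⟩
  · have h1 := (ENNReal.tendsto_toReal ENNReal.zero_ne_top).comp main
    refine Tendsto.congr' ?_ h1
    filter_upwards [self_mem_nhdsWithin] with t ht0
    exact (integral_norm_eq_lintegral_enorm (hm t ht0).restrict).symm

end

end WeightedTrace

/-! ### The trace theorem -/

theorem theorem4p2 (n : ℕ) (hn : 1 ≤ n) (k₀ : ℕ) (Cγ c₁ c₂ : ℝ) (hc₁ : 1 ≤ c₁) (hc₂ : 1 ≤ c₂) :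
    ∃ C : ℝ, 0 < C ∧
      ∀ γ : Space n → ℝ, IsA1locWeight γ Cγ →
      ∀ φ : Base n → ℝ, LocallyIntegrable φ volume →
      ∀ A : ℕ → Set (Index n), IsAdmissible (1 + ((2 : ℝ) ^ k₀)⁻¹) γ c₁ c₂ A →
      ∀ A' : ℕ → Set (Index n), (∀ s, IsReduction (1 + ((2 : ℝ) ^ k₀)⁻¹) (A s) (A' s)) →
      oscillationSum (1 + ((2 : ℝ) ^ k₀)⁻¹) γ φ A' < ⊤ →
      ∃ f : Space n → ℝ,
        MemSobolev (upperHalf n) γ f ∧ HasTrace f φ ∧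
        ENNReal.ofReal C * sobolevNorm (upperHalf n) γ f
          ≤ oscillationSum (1 + ((2 : ℝ) ^ k₀)⁻¹) γ φ A' := by
  -- The estimates need a nonnegative constant, and enlarging `Cγ` preserves the A₁ condition.
  have hC : (0 : ℝ) ≤ max Cγ 0 := le_max_right _ _
  obtain ⟨B, hB, hsob⟩ := exists_sobolevNorm_le hn k₀ hC hc₁ hc₂
  -- Adding one makes the bound invertible even if `B = 0`.
  have hB1 : B + 1 ≠ ⊤ := by finiteness
  have hB0 : B + 1 ≠ 0 := by simp
  refine ⟨(B + 1).toReal⁻¹, inv_pos.2 (ENNReal.toReal_pos hB0 hB1), ?_⟩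
  intro γ hγ φ hφ A hA A' hA' hS
  have hγ' := hγ.mono (le_max_left Cγ 0)
  have h1 : sobolevNorm (upperHalf n) γ (latticeExtension (latticeValue k₀ A' φ))
      ≤ (B + 1) * oscillationSum (1 + ((2 : ℝ) ^ k₀)⁻¹) γ φ A' :=
    (hsob γ hγ' φ hφ A hA A' hA').trans (mul_le_mul' le_self_add le_rfl)
  refine ⟨latticeExtension (latticeValue k₀ A' φ), ⟨?_, h1.trans_lt ?_⟩,
    hasTrace_latticeExtension hγ' hC hc₁ hφ hA hA' hS, ?_⟩
  · refine ContinuousOn.locallyIntegrableOn (fun z hz => ?_) (isOpen_upperHalf n).measurableSet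
    exact (contDiffAt_latticeExtension _ hz).continuousAt.continuousWithinAt
  · exact ENNReal.mul_lt_top hB1.lt_top hS
  · rw [ENNReal.ofReal_inv_of_pos (ENNReal.toReal_pos hB0 hB1), ENNReal.ofReal_toReal hB1]
    calc _ ≤ (B + 1)⁻¹ * ((B + 1) * oscillationSum (1 + ((2 : ℝ) ^ k₀)⁻¹) γ φ A') := by gcongr
      _ = _ := by rw [← mul_assoc, ENNReal.inv_mul_cancel hB0 hB1, one_mul]
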